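/- Let $\Omega\subset\mathbb R^2$ be a bounded domain with Lipschitz boundary $\Gamma$, let $\mathbf n$ be the outward unit normal (defined almost everywhere on $\Gamma$ with respect to arc length $ds$), and let $\mathbf c:\overline\Omega\to\mathbb R^2$ be a Lipschitz continuous velocity field. Put $$\Gamma_i=\{\zeta\in\Gamma:\ \mathbf c^\top\mathbf n<0\},\qquad \Gamma_o=\{\zeta\in\Gamma:\ \mathbf c^\top\mathbf n>0\}.$$ Let $\Phi=(\phi_1,\dots,\phi_N)^\top$ with $\phi_1,\dots,\phi_N\in H^1(\Omega)$, and let $x_d:[0,\infty)\to\mathbb R^N$ be a differentiable solution of the Galerkin approximation of the transport equation $\partial_t x+\operatorname{div}(\mathbf c\,x)=0$, that is, with $x^{ap}(\zeta,t)=\Phi(\zeta)^\top x_d(t)$, $$\iint_\Omega \Phi\,\bigl[\Phi^\top\dot x_d(t)+\operatorname{div}(\mathbf c\,\Phi^\top x_d(t))\bigr]\,d\zeta=0\qquad (t\ge 0),$$ where divergences are taken in the weak sense. Let the input $u$ and the output $y$ be the boundary values (traces) of $x^{ap}$: $u(\cdot,t)=x^{ap}(\cdot,t)$ on $\Gamma_i$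 and $y(\cdot,t)=x^{ap}(\cdot,t)$ on $\Gamma_o$. Let $$H_d(t)=\tfrac12\iint_\Omega x^{ap}(\zeta,t)^2\,d\zeta .$$ Then all the integrals below exist, and for every $t\ge 0$ (one-sided derivative at $t=0$): 1. $H_d(t)=\tfrac12\,x_d(t)^\top M x_d(t)$ with $M=\iint_\Omega\Phi\Phi^\top d\zeta$; 2. $\displaystyle \dot H_d(t)=-\tfrac12\iint_\Omega (x^{ap})^2\operatorname{div}(\mathbf c)\,d\zeta-\tfrac12\int_\Gamma (x^{ap})^2\,\mathbf c^\top\mathbf n\,ds$; 3. $\displaystyle \dot H_d(t)=-\tfrac12\,x_d(t)^\top\Bigl(\iint_\Omega\Phi\operatorname{div}(\mathbf c)\Phi^\top d\zeta\Bigr)x_d(t)+\tfrac12\int_{\Gamma_i}u^2\,|\mathbf c^\top\mathbf n|\,ds-\tfrac12\int_{\Gamma_o}y^2\,\mathbf c^\top\mathbf n\,ds$; 4. if $\operatorname{div}(\mathbf c)=0$ almost everywhere in $\Omega$, the scattering energy preserving balance holds exactly: $$\dot H_d(t)=\tfrac12\int_{\Gamma_i}u^2\,|\mathbf c^\top\mathbf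 n|\,ds-\tfrac12\int_{\Gamma_o}y^2\,\mathbf c^\top\mathbf n\,ds .$$ -/

import Mathlib

open MeasureTheory Set Filter Topology
open scoped ContDiff ENNReal

noncomputable section

namespace Transport2D

/-- The Euclidean plane. -/
abbrev Plane : Type := EuclideanSpace ℝ (Fin 2)

/-- A bounded open set with Lipschitz boundary: near every boundary point, and in suitable
Cartesian coordinates, the set is the strict epigraph of a Lipschitz function. -/
structure IsBoundedLipschitz (Ω : Set Plane) : Prop where
  isOpen : IsOpen Ω
  isBounded : Bornology.IsBounded Ω
  boundary : ∀ z ∈ frontier Ω, ∃ (e : Plane ≃ᵃⁱ[ℝ] Plane) (f : ℝ → ℝ) (K : NNReal),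
    LipschitzWith K f ∧ ∀ᶠ p in 𝓝 z, (p ∈ Ω ↔ f (e p 0) < e p 1)

/-- Arc length on the boundary `Γ` of `Ω`: the one-dimensional Hausdorff measure. -/
def boundaryMeasure (Ω : Set Plane) : Measure Plane :=
  (Measure.hausdorffMeasure 1).restrict (frontier Ω)

/-- `n` is the outward unit normal of `Ω` at `z`: up to arbitrarily thin cones around the line
orthogonal to `n`, the set `Ω` is, near `z`, the half-plane on the side of `-n`.
There is at most one such `n`. -/
def IsOuterNormal (Ω : Set Plane) (z n : Plane) : Prop :=
  ‖n‖ = 1 ∧ ∀ ε : ℝ, 0 < ε → ∀ᶠ p in 𝓝 z,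
    (inner ℝ (p - z) n < -(ε * ‖p - z‖) → p ∈ Ω) ∧
    (ε * ‖p - z‖ < inner ℝ (p - z) n → p ∉ Ω)

open Classical in
/-- The outward unit normal field (`0` at the boundary points without a normal, e.g. corners). -/
def outerNormal (Ω : Set Plane) (z : Plane) : Plane :=
  if h : ∃ n, IsOuterNormal Ω z n then h.choose else 0

/-- Smooth functions with compact support in `Ω`. -/
def IsTest (Ω : Set Plane) (ψ : Plane → ℝ) : Prop :=
  ContDiff ℝ ∞ ψ ∧ HasCompactSupport ψ ∧ tsupport ψ ⊆ Ω

/-- `G` is the weak gradient of `φ` in `Ω`. -/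
def IsWeakGrad (Ω : Set Plane) (φ : Plane → ℝ) (G : Plane → Plane) : Prop :=
  LocallyIntegrableOn φ Ω ∧ LocallyIntegrableOn G Ω ∧
  ∀ ψ, IsTest Ω ψ → ∀ v : Plane,
    ∫ z in Ω, φ z * fderiv ℝ ψ z v = -∫ z in Ω, inner ℝ (G z) v * ψ z

/-- `d` is the weak divergence of the vector field `w` in `Ω`. -/
def IsWeakDiv (Ω : Set Plane) (w : Plane → Plane) (d : Plane → ℝ) : Prop :=
  LocallyIntegrableOn w Ω ∧ LocallyIntegrableOn d Ω ∧
  ∀ ψ, IsTest Ω ψ → ∫ z in Ω, fderiv ℝ ψ z (w z) = -∫ z in Ω, d z * ψ z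

open Classical in
/-- The divergence of `w` in `Ω`, in the weak sense (determined almost everywhere in `Ω`). -/
def weakDiv (Ω : Set Plane) (w : Plane → Plane) : Plane → ℝ :=
  if h : ∃ d, IsWeakDiv Ω w d then h.choose else 0

/-- The Sobolev space `H¹(Ω)`. -/
def MemH1 (Ω : Set Plane) (φ : Plane → ℝ) : Prop :=
  MemLp φ 2 (volume.restrict Ω) ∧
  ∃ G : Plane → Plane, IsWeakGrad Ω φ G ∧ MemLp G 2 (volume.restrict Ω)

/-- `g ∈ L²(Γ)` is the trace of `φ` on the boundary: the value at `φ` of the continuous extension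
to `H¹(Ω)` of the restriction map `ψ ↦ ψ|_Γ` on functions that are smooth up to the boundary. -/
def IsTrace (Ω : Set Plane) (φ g : Plane → ℝ) : Prop :=
  MemLp g 2 (boundaryMeasure Ω) ∧
  ∃ (G : Plane → Plane) (ψ : ℕ → Plane → ℝ), IsWeakGrad Ω φ G ∧ (∀ k, ContDiff ℝ ∞ (ψ k)) ∧
    Tendsto (fun k => eLpNorm (fun z => ψ k z - φ z) 2 (volume.restrict Ω)) atTop (𝓝 0) ∧
    Tendsto (fun k => eLpNorm (fun z => gradient (ψ k) z - G z) 2 (volume.restrict Ω))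
      atTop (𝓝 0) ∧
    Tendsto (fun k => eLpNorm (fun z => ψ k z - g z) 2 (boundaryMeasure Ω)) atTop (𝓝 0)

open Classical in
/-- The trace of `φ` on the boundary of `Ω` (determined almost everywhere on the boundary). -/
def boundaryTrace (Ω : Set Plane) (φ : Plane → ℝ) : Plane → ℝ :=
  if h : ∃ g, IsTrace Ω φ g then h.choose else 0

/-- The normal component `cᵀn` of the velocity on the boundary. -/
def normalFlux (Ω : Set Plane) (c : Plane → Plane) (z : Plane) : ℝ :=
  inner ℝ (c z) (outerNormal Ω z)

/-- The input boundary `Γ_i`. -/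
def inflow (Ω : Set Plane) (c : Plane → Plane) : Set Plane :=
  {z ∈ frontier Ω | normalFlux Ω c z < 0}

/-- The output boundary `Γ_o`. -/
def outflow (Ω : Set Plane) (c : Plane → Plane) : Set Plane :=
  {z ∈ frontier Ω | 0 < normalFlux Ω c z}

variable {N : ℕ}

/-- The approximation `x^{ap} = Φᵀ x_d`. -/
def approx (Φ : Fin N → Plane → ℝ) (a : Fin N → ℝ) (z : Plane) : ℝ :=
  ∑ j, Φ j z * a j

/-- The mass matrix `M = ∬ Φ Φᵀ`. -/
def massMatrix (Ω : Set Plane) (Φ : Fin N → Plane → ℝ) : Matrix (Fin N) (Fin N) ℝ :=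
  Matrix.of fun i j => ∫ z in Ω, Φ i z * Φ j z

/-- The matrix `∬ Φ div(c) Φᵀ`. -/
def divMatrix (Ω : Set Plane) (c : Plane → Plane) (Φ : Fin N → Plane → ℝ) :
    Matrix (Fin N) (Fin N) ℝ :=
  Matrix.of fun i j => ∫ z in Ω, Φ i z * weakDiv Ω c z * Φ j z

/-- The discretized Hamiltonian: `½ ∬ x²` evaluated at `x = x^{ap}`. -/
def discreteHamiltonian (Ω : Set Plane) (Φ : Fin N → Plane → ℝ) (a : Fin N → ℝ) : ℝ :=
  1 / 2 * ∫ z in Ω, approx Φ a z * approx Φ a z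

/-- `x_d` is, for `t ≥ 0`, a differentiable solution of the Galerkin system
`∬ Φ [Φᵀ ẋ_d + div(c Φᵀ x_d)] = 0`. -/
def IsGalerkinSolution (Ω : Set Plane) (c : Plane → Plane) (Φ : Fin N → Plane → ℝ)
    (xd : ℝ → Fin N → ℝ) : Prop :=
  ∀ t : ℝ, 0 ≤ t → ∃ v : Fin N → ℝ, HasDerivWithinAt xd v (Ici 0) t ∧
    ∀ i, ∫ z in Ω, Φ i z *
      (approx Φ v z + weakDiv Ω (fun p => approx Φ (xd t) p • c p) z) = 0

end Transport2D

end

noncomputable section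

namespace Transport2D

open scoped NNReal

/-! Weight the Galerkin equations by the coefficients `xd t` themselves: the approximation x becomes
its own test function, so the derivative of the Hamiltonian is ∫ x ẋ = -∫ x div(c x). Everything
then rests on one identity for an H¹ function x with trace g and a Lipschitz field c
(`flux_balance`): ∫_Ω x div(c x) = ½ ∫_Ω x² div c + ½ ∫_Γ g² c·n ds. It combines the weak product
rule div(c x) = ∇x·c + x div c (`isWeakDiv_smul`) with the divergence theorem for x² c, that is 2 ∫
x ∇x·c + ∫ x² div c = ∫_Γ g² c·n ds (`integral_sq_trace`). Splitting Γ by the sign of c·n gives the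
input and output terms.

Since arc length is a Hausdorff measure and the normal is defined by thin cones, the divergence
theorem is derived from the charts. The area formula
(`IsGraphParam.hausdorffMeasure_restrict_range`) gives arc length the density √(1 + f'²) on a
Lipschitz graph. By Rademacher's theorem the normal is (f', -1)/√(1 + f'²) almost everywhere, and
the two square roots cancel. On an epigraph the indicator function is replaced by a steep Lipschitz
ramp; integration by parts in the whole plane has no boundary term, and the layer where the ramp
increases concentrates on the graph (`integral_epigraph_lineDeriv`). A partition of unity globalizes
this (`integral_lineDeriv_eq_boundary`).

The passage to H¹ needs density and traces. Functions smooth up to the boundary are dense because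
mollification with a kernel shifted along an interior cone reads only values inside Ω
(`exists_cone`, `exists_local_approx`, `exists_smooth_approx`). Green's formula with a constant
field transversal to the graph bounds boundary values by the H¹ norm (`exists_trace_bound`), so the
boundary values of the approximants converge in L²(Γ) (`exists_isTrace`). Every term of the
identities is continuous under these convergences. -/

lemma abs_sqrt_sub_sqrt_le (x y z : ℝ) : |√(x ^ 2 + y ^ 2) - √(x ^ 2 + z ^ 2)| ≤ |y - z| := by
  have h := abs_norm_sub_norm_le (!₂[x, y] : EuclideanSpace ℝ (Fin 2)) !₂[x, z]
  simpa [EuclideanSpace.norm_eq, Fin.sum_univ_two, Real.sqrt_sq_eq_abs] using h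

/-- The length element of the graph of `f`. -/
def arcDensity (f : ℝ → ℝ) (s : ℝ) : ℝ := √(1 + deriv f s ^ 2)

lemma one_le_arcDensity (f : ℝ → ℝ) (s : ℝ) : 1 ≤ arcDensity f s := by
  rw [arcDensity, Real.one_le_sqrt]; nlinarith [sq_nonneg (deriv f s)]

lemma arcDensity_pos (f : ℝ → ℝ) (s : ℝ) : 0 < arcDensity f s :=
  zero_lt_one.trans_le (one_le_arcDensity f s)

lemma measurable_arcDensity (f : ℝ → ℝ) : Measurable (arcDensity f) :=
  ((measurable_deriv f).pow_const 2).const_add 1 |>.sqrt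

/-! ### Area formula for Lipschitz graphs. -/

section Graph

variable {X : Type*} [MetricSpace X] {γ : ℝ → X} {f : ℝ → ℝ}

/-- `γ` parametrizes an isometric copy of the graph of `f`. -/
def IsGraphParam (γ : ℝ → X) (f : ℝ → ℝ) : Prop :=
  ∀ s t, dist (γ s) (γ t) = √((s - t) ^ 2 + (f s - f t) ^ 2)

lemma IsGraphParam.antilipschitz (hγ : IsGraphParam γ f) : AntilipschitzWith 1 γ := by
  refine AntilipschitzWith.of_le_mul_dist fun s t => ?_
  rw [hγ s t, Real.dist_eq, NNReal.coe_one, one_mul]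
  exact Real.abs_le_sqrt (by nlinarith [sq_nonneg (f s - f t)])

lemma IsGraphParam.lipschitz (hγ : IsGraphParam γ f) {K : ℝ≥0} (hf : LipschitzWith K f) :
    LipschitzWith (1 + K) γ := by
  refine LipschitzWith.of_dist_le_mul fun s t => ?_
  have h := hf.dist_le_mul s t
  rw [Real.dist_eq, Real.dist_eq] at h
  rw [hγ s t, Real.dist_eq]
  have := abs_sqrt_sub_sqrt_le (s - t) (f s - f t) 0
  have h2 : √((s - t) ^ 2 + 0 ^ 2) = |s - t| := by simp [Real.sqrt_sq_eq_abs]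
  rw [h2, sub_zero] at this
  have := (abs_le.1 this).2
  push_cast
  linarith

lemma IsGraphParam.isClosedEmbedding (hγ : IsGraphParam γ f) {K : ℝ≥0} (hf : LipschitzWith K f) :
    IsClosedEmbedding γ :=
  hγ.antilipschitz.isClosedEmbedding (hγ.lipschitz hf).uniformContinuous

/-- By the reverse triangle inequality, the Euclidean norm changes by no more than the second
coordinate does, so the linearization error of f passes unchanged to the length of chords. -/
lemma IsGraphParam.abs_dist_sub_le (hγ : IsGraphParam γ f) {A : Set ℝ} {L : ℝ →L[ℝ] ℝ} {ε : ℝ≥0}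
    (h : ApproximatesLinearOn f L A ε) {s t : ℝ} (hs : s ∈ A) (ht : t ∈ A) :
    |dist (γ s) (γ t) - √(1 + L 1 ^ 2) * dist s t| ≤ ε * dist s t := by
  rw [Real.dist_eq s t]
  have h1 := h s hs t ht
  have h2 : L (s - t) = L 1 * (s - t) := by
    have := L.map_smul (s - t) (1 : ℝ)
    simp only [smul_eq_mul, mul_one] at this
    rw [this, mul_comm]
  rw [h2, Real.norm_eq_abs, Real.norm_eq_abs] at h1
  have h3 : √(1 + L 1 ^ 2) * |s - t| = √((s - t) ^ 2 + (L 1 * (s - t)) ^ 2) := by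
    rw [← Real.sqrt_sq_eq_abs, ← Real.sqrt_mul (by positivity)]
    congr 1; ring
  rw [h3, hγ s t]
  exact (abs_sqrt_sub_sqrt_le _ _ _).trans h1

variable [MeasurableSpace X] [BorelSpace X]

lemma IsGraphParam.measurableEmbedding (hγ : IsGraphParam γ f) {K : ℝ≥0}
    (hf : LipschitzWith K f) : MeasurableEmbedding γ :=
  (hγ.isClosedEmbedding hf).measurableEmbedding

lemma IsGraphParam.hausdorffMeasure_image_le (hγ : IsGraphParam γ f) {A : Set ℝ}
    {L : ℝ →L[ℝ] ℝ} {ε : ℝ≥0} (h : ApproximatesLinearOn f L A ε) :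
    Measure.hausdorffMeasure 1 (γ '' A) ≤ ENNReal.ofReal (√(1 + L 1 ^ 2) + ε) * volume A := by
  have hl : LipschitzOnWith (Real.toNNReal (√(1 + L 1 ^ 2) + ε)) γ A := by
    refine LipschitzOnWith.of_dist_le_mul fun s hs t ht => ?_
    rw [Real.coe_toNNReal _ (by positivity)]
    have := (abs_le.1 (hγ.abs_dist_sub_le h hs ht)).2
    linarith
  have := hl.hausdorffMeasure_image_le (d := 1) zero_le_one
  rwa [hausdorffMeasure_real, ENNReal.rpow_one] at this

/-- The inverse of γ is Lipschitz on the image with the reciprocal constant. The constant is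
positive because ε < 1 ≤ √(1 + (L 1)²). -/
lemma IsGraphParam.le_hausdorffMeasure_image (hγ : IsGraphParam γ f) {A : Set ℝ}
    {L : ℝ →L[ℝ] ℝ} {ε : ℝ≥0} (hε : ε < 1) (h : ApproximatesLinearOn f L A ε) :
    ENNReal.ofReal (√(1 + L 1 ^ 2) - ε) * volume A ≤ Measure.hausdorffMeasure 1 (γ '' A) := by
  have h1 : 1 ≤ √(1 + L 1 ^ 2) := by rw [Real.one_le_sqrt]; nlinarith [sq_nonneg (L 1)]
  have hε' : (ε : ℝ) < 1 := by exact_mod_cast hε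
  have hpos : 0 < √(1 + L 1 ^ 2) - ε := by linarith
  have hinj := hγ.antilipschitz.injective
  have hl : LipschitzOnWith (Real.toNNReal (√(1 + L 1 ^ 2) - ε))⁻¹ (Function.invFun γ)
      (γ '' A) := by
    refine LipschitzOnWith.of_dist_le_mul ?_
    rintro _ ⟨s, hs, rfl⟩ _ ⟨t, ht, rfl⟩
    rw [Function.leftInverse_invFun hinj, Function.leftInverse_invFun hinj, NNReal.coe_inv,
      Real.coe_toNNReal _ hpos.le, ← div_eq_inv_mul, le_div_iff₀ hpos]
    have := (abs_le.1 (hγ.abs_dist_sub_le h hs ht)).1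
    linarith
  have := hl.hausdorffMeasure_image_le (d := 1) zero_le_one
  rw [hausdorffMeasure_real, ENNReal.rpow_one, image_image] at this
  simp only [Function.leftInverse_invFun hinj _, image_id'] at this
  have hne : Real.toNNReal (√(1 + L 1 ^ 2) - ε) ≠ 0 := by simpa using hpos
  rw [ENNReal.coe_inv hne, mul_comm, ← div_eq_mul_inv,
    ENNReal.le_div_iff_mul_le (Or.inl (by simpa using hpos)) (Or.inl (by simp))] at this
  rw [mul_comm]; exact this

/-- Cut A into countably many pieces on which f is ε-close to a linear map. On each piece γ is
nearly a similarity, so its Hausdorff measure is known up to ε; summing and letting ε tend to 0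
gives the integral. -/
lemma IsGraphParam.hausdorffMeasure_image_of_differentiable (hγ : IsGraphParam γ f) {K : ℝ≥0}
    (hf : LipschitzWith K f) {A : Set ℝ} (hA : MeasurableSet A) (hfin : volume A ≠ ⊤)
    (hd : ∀ s ∈ A, DifferentiableAt ℝ f s) :
    Measure.hausdorffMeasure 1 (γ '' A) = ∫⁻ s in A, ENNReal.ofReal (arcDensity f s) := by
  -- The error 2ε has two sources: the Lipschitz constants of γ and its inverse, and the distance
  -- between the density at a point and that of the linear map of its piece.
  have key : ∀ ε : ℝ≥0, 0 < ε → ε < 1 →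
      Measure.hausdorffMeasure 1 (γ '' A)
        ≤ (∫⁻ s in A, ENNReal.ofReal (arcDensity f s)) + 2 * ε * volume A ∧
      (∫⁻ s in A, ENNReal.ofReal (arcDensity f s))
        ≤ Measure.hausdorffMeasure 1 (γ '' A) + 2 * ε * volume A := by
    intro ε ε0 ε1
    obtain ⟨t, L, tdisj, tmeas, tcov, ht, -⟩ :=
      exists_partition_approximatesLinearOn_of_hasFDerivWithinAt f A (fderiv ℝ f)
        (fun x hx => (hd x hx).hasFDerivAt.hasFDerivWithinAt) (fun _ => ε) (fun _ => ε0.ne')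
    have hM : ∀ n, MeasurableSet (A ∩ t n) := fun n => hA.inter (tmeas n)
    have hD : Pairwise (Function.onFun Disjoint fun n => A ∩ t n) :=
      pairwise_disjoint_mono tdisj fun n => inter_subset_right
    have hU : (⋃ n, A ∩ t n) = A := by
      rw [← inter_iUnion, inter_eq_self_of_subset_left tcov]
    have hclose : ∀ n, ∀ᵐ x ∂(volume.restrict (A ∩ t n)),
        |arcDensity f x - √(1 + L n 1 ^ 2)| ≤ ε := by
      intro n
      filter_upwards [(ht n).norm_fderiv_sub_le volume (hM n) (fderiv ℝ f)
        (fun x hx => (hd x hx.1).hasFDerivAt.hasFDerivWithinAt)] with x hx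
      have h1 := abs_sqrt_sub_sqrt_le 1 (deriv f x) (L n 1)
      rw [one_pow] at h1
      refine h1.trans ?_
      have h2 := (fderiv ℝ f x - L n).le_opNorm 1
      rw [norm_one, mul_one] at h2
      exact h2.trans (by exact_mod_cast hx)
    have e1 : Measure.hausdorffMeasure 1 (γ '' A)
        = ∑' n, Measure.hausdorffMeasure 1 (γ '' (A ∩ t n)) := by
      conv_lhs => rw [← hU, image_iUnion]
      refine measure_iUnion (fun i j hij => ?_)
        fun n => (hγ.measurableEmbedding hf).measurableSet_image.2 (hM n)
      exact (disjoint_image_iff hγ.antilipschitz.injective).2 (hD hij)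
    have e2 : (∫⁻ s in A, ENNReal.ofReal (arcDensity f s))
        = ∑' n, ∫⁻ s in A ∩ t n, ENNReal.ofReal (arcDensity f s) := by
      conv_lhs => rw [← hU]
      rw [lintegral_iUnion hM hD]
    have e3 : 2 * ε * volume A = ∑' n, 2 * ε * volume (A ∩ t n) := by
      rw [ENNReal.tsum_mul_left, ← measure_iUnion hD hM, hU]
    have two_eps : ENNReal.ofReal (2 * ε) = 2 * ε := by
      rw [ENNReal.ofReal_mul (by norm_num)]; simp
    rw [e1, e2, e3, ← ENNReal.tsum_add, ← ENNReal.tsum_add]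
    have hconst : ∀ n (a : ℝ≥0∞), ∫⁻ _ in A ∩ t n, a = a * volume (A ∩ t n) := by
      intro n a; simp
    refine ⟨ENNReal.tsum_le_tsum fun n => ?_, ENNReal.tsum_le_tsum fun n => ?_⟩
    · refine (hγ.hausdorffMeasure_image_le (ht n)).trans ?_
      rw [← hconst n, ← hconst n, ← lintegral_add_right _ measurable_const]
      refine lintegral_mono_ae ?_
      filter_upwards [hclose n] with x hx
      rw [← two_eps, ← ENNReal.ofReal_add (arcDensity_pos f x).le (by positivity)]
      exact ENNReal.ofReal_le_ofReal (by have := (abs_le.1 hx).1; linarith)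
    · refine le_trans ?_ (add_le_add_left (hγ.le_hausdorffMeasure_image ε1 (ht n)) _)
      rw [← hconst n, ← hconst n, ← lintegral_add_right _ measurable_const]
      refine lintegral_mono_ae ?_
      filter_upwards [hclose n] with x hx
      have h1 : 1 ≤ √(1 + L n 1 ^ 2) := by rw [Real.one_le_sqrt]; nlinarith [sq_nonneg (L n 1)]
      have hε' : (ε : ℝ) < 1 := by exact_mod_cast ε1
      rw [← two_eps, ← ENNReal.ofReal_add (by linarith) (by positivity)]
      exact ENNReal.ofReal_le_ofReal (by have := (abs_le.1 hx).2; linarith)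
  -- The error term disappears in the limit only because A has finite volume.
  have lim : ∀ c : ℝ≥0∞, Tendsto (fun ε : ℝ≥0 => c + 2 * ε * volume A) (𝓝[>] 0) (𝓝 c) := by
    intro c
    have h0 : Tendsto (fun ε : ℝ≥0 => (ε : ℝ≥0∞)) (𝓝[>] 0) (𝓝 0) :=
      (ENNReal.tendsto_coe.2 tendsto_id).mono_left nhdsWithin_le_nhds
    have h1 := ENNReal.Tendsto.const_mul (a := 2) h0 (Or.inr (by simp))
    have h2 := ENNReal.Tendsto.mul_const (b := volume A) h1 (Or.inr hfin)
    simpa using tendsto_const_nhds.add h2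
  have hev : ∀ᶠ ε : ℝ≥0 in 𝓝[>] 0, 0 < ε ∧ ε < 1 := Ioo_mem_nhdsGT zero_lt_one
  exact le_antisymm (ge_of_tendsto (lim _) (hev.mono fun ε h => (key ε h.1 h.2).1))
    (ge_of_tendsto (lim _) (hev.mono fun ε h => (key ε h.1 h.2).2))

lemma IsGraphParam.hausdorffMeasure_image_null (hγ : IsGraphParam γ f) {K : ℝ≥0}
    (hf : LipschitzWith K f) {A : Set ℝ} (hA : volume A = 0) :
    Measure.hausdorffMeasure 1 (γ '' A) = 0 := by
  have := (hγ.lipschitz hf).hausdorffMeasure_image_le (d := 1) zero_le_one A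
  rw [hausdorffMeasure_real, hA, mul_zero] at this
  exact le_antisymm this zero_le

/-- The one-dimensional Hausdorff measure on a Lipschitz graph is arc length. -/
theorem IsGraphParam.hausdorffMeasure_restrict_range (hγ : IsGraphParam γ f) {K : ℝ≥0}
    (hf : LipschitzWith K f) :
    (Measure.hausdorffMeasure 1 : Measure X).restrict (range γ)
      = Measure.map γ (volume.withDensity fun s => ENNReal.ofReal (arcDensity f s)) := by
  have hγe := hγ.measurableEmbedding hf
  suffices h : Measure.comap γ (Measure.hausdorffMeasure 1 : Measure X)
      = volume.withDensity fun s => ENNReal.ofReal (arcDensity f s) by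
    rw [← h, hγe.map_comap]
  set D : Set ℝ := {s | DifferentiableAt ℝ f s} with hDdef
  have hD : MeasurableSet D := measurableSet_of_differentiableAt ℝ f
  -- Rademacher's theorem in dimension one; the image of the exceptional set is null because γ is
  -- Lipschitz.
  have hD0 : volume Dᶜ = 0 := hf.ae_differentiableAt_real
  have hfinA : ∀ A : Set ℝ, MeasurableSet A → volume A ≠ ⊤ →
      Measure.comap γ (Measure.hausdorffMeasure 1 : Measure X) A
        = (volume.withDensity fun s => ENNReal.ofReal (arcDensity f s)) A := by
    intro A hA hfin
    rw [hγe.comap_apply, withDensity_apply _ hA]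
    have hsub : volume (A ∩ D) ≠ ⊤ := measure_ne_top_of_subset inter_subset_left hfin
    have h1 := hγ.hausdorffMeasure_image_of_differentiable hf (hA.inter hD) hsub (fun s hs => hs.2)
    have hAD0 : volume (A \ D) = 0 := measure_mono_null (fun x hx => hx.2) hD0
    have h2 := hγ.hausdorffMeasure_image_null hf hAD0
    have h3 : Measure.hausdorffMeasure 1 (γ '' A) = Measure.hausdorffMeasure 1 (γ '' (A ∩ D)) := by
      refine le_antisymm ?_ (measure_mono (image_mono inter_subset_left))
      conv_lhs => rw [← inter_union_sdiff A D, image_union]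
      exact (measure_union_le _ _).trans (by rw [h2, add_zero])
    rw [h3, h1]
    refine setLIntegral_congr ?_
    exact inter_ae_eq_left_of_ae_eq_univ (ae_eq_univ.2 hD0)
  -- The formula is known for sets of finite volume. They form a π-system generating the Borel sets,
  -- and the first measure is finite on an exhausting sequence of them.
  refine Measure.ext_of_generateFrom_of_iUnion {A : Set ℝ | MeasurableSet A ∧ volume A ≠ ⊤}
    (fun n => spanningSets volume n) ?_ ?_ (iUnion_spanningSets volume) ?_ ?_ ?_
  · refine le_antisymm (fun A hA => ?_) (MeasurableSpace.generateFrom_le fun A hA => hA.1)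
    have : A = ⋃ n, A ∩ spanningSets volume n := by
      rw [← inter_iUnion, iUnion_spanningSets, inter_univ]
    rw [this]
    refine MeasurableSet.iUnion fun n => MeasurableSpace.measurableSet_generateFrom
      ⟨hA.inter (measurableSet_spanningSets volume n), ?_⟩
    exact measure_ne_top_of_subset inter_subset_right (measure_spanningSets_lt_top volume n).ne
  · intro A hA B hB _
    exact ⟨hA.1.inter hB.1, measure_ne_top_of_subset inter_subset_left hA.2⟩
  · exact fun n => ⟨measurableSet_spanningSets volume n, (measure_spanningSets_lt_top volume n).ne⟩
  · intro n
    rw [hγe.comap_apply]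
    have := (hγ.lipschitz hf).hausdorffMeasure_image_le (d := 1) zero_le_one
      (spanningSets volume n)
    rw [hausdorffMeasure_real, ENNReal.rpow_one] at this
    exact (this.trans_lt (ENNReal.mul_lt_top (by simp) (measure_spanningSets_lt_top volume n))).ne
  · exact fun A hA => hfinA A hA.1 hA.2

end Graph

/-! ### Normal and arc length in a chart. -/

/-- In the open set `U` and in the Cartesian coordinates `e`, the set `Ω` is the strict epigraph
of the Lipschitz function `f`. -/
structure IsChart (Ω U : Set Plane) (e : Plane ≃ᵃⁱ[ℝ] Plane) (f : ℝ → ℝ) (K : ℝ≥0) : Prop where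
  isOpen : IsOpen U
  lipschitz : LipschitzWith K f
  mem_iff : ∀ p ∈ U, (p ∈ Ω ↔ f (e p 0) < e p 1)

/-- The boundary curve in a chart. -/
def chartCurve (e : Plane ≃ᵃⁱ[ℝ] Plane) (f : ℝ → ℝ) (s : ℝ) : Plane := e.symm !₂[s, f s]

/-- The outward unit normal in a chart. -/
def chartNormal (e : Plane ≃ᵃⁱ[ℝ] Plane) (f : ℝ → ℝ) (s : ℝ) : Plane :=
  (arcDensity f s)⁻¹ • e.linearIsometryEquiv.symm !₂[deriv f s, -1]

lemma continuous_coord (e : Plane ≃ᵃⁱ[ℝ] Plane) (i : Fin 2) : Continuous fun q : Plane => e q i :=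
  (EuclideanSpace.proj i : Plane →L[ℝ] ℝ).continuous.comp e.continuous

lemma isGraphParam_chartCurve (e : Plane ≃ᵃⁱ[ℝ] Plane) (f : ℝ → ℝ) :
    IsGraphParam (chartCurve e f) f := by
  intro s t
  rw [chartCurve, chartCurve, e.symm.dist_map, EuclideanSpace.dist_eq]
  simp [Fin.sum_univ_two, Real.dist_eq]

lemma mem_range_chartCurve {e : Plane ≃ᵃⁱ[ℝ] Plane} {f : ℝ → ℝ} {p : Plane} :
    p ∈ range (chartCurve e f) ↔ e p 1 = f (e p 0) := by
  constructor
  · rintro ⟨s, rfl⟩; simp [chartCurve]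
  · intro h
    refine ⟨e p 0, ?_⟩
    rw [chartCurve, ← h, AffineIsometryEquiv.symm_apply_eq]
    ext i; fin_cases i <;> simp

lemma norm_chartNormal (e : Plane ≃ᵃⁱ[ℝ] Plane) (f : ℝ → ℝ) (s : ℝ) :
    ‖chartNormal e f s‖ = 1 := by
  rw [chartNormal, norm_smul, LinearIsometryEquiv.norm_map, EuclideanSpace.norm_eq]
  simp only [Fin.sum_univ_two, Real.norm_eq_abs, sq_abs, norm_inv]
  have h : √(deriv f s ^ 2 + (-1) ^ 2) = arcDensity f s := by
    rw [arcDensity]; congr 1; ring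
  have h' := arcDensity_pos f s
  simp only [Matrix.cons_val_zero, Matrix.cons_val_one, Matrix.cons_val_fin_one]
  rw [h, abs_of_pos h', inv_mul_cancel₀ h'.ne']

lemma inner_chartNormal (e : Plane ≃ᵃⁱ[ℝ] Plane) (f : ℝ → ℝ) (s : ℝ) (v : Plane) :
    inner ℝ v (chartNormal e f s) = (arcDensity f s)⁻¹ *
      (deriv f s * e.linearIsometryEquiv v 0 - e.linearIsometryEquiv v 1) := by
  rw [chartNormal, real_inner_smul_right]
  congr 1
  rw [← LinearIsometryEquiv.inner_map_map e.linearIsometryEquiv,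
    LinearIsometryEquiv.apply_symm_apply, PiLp.inner_apply, Fin.sum_univ_two]
  simp
  ring

lemma measurable_chartNormal (e : Plane ≃ᵃⁱ[ℝ] Plane) (f : ℝ → ℝ) :
    Measurable (chartNormal e f) := by
  refine (measurable_arcDensity f).inv.smul
    (e.linearIsometryEquiv.symm.continuous.measurable.comp ?_)
  refine (WithLp.measurable_toLp 2 _).comp (measurable_pi_iff.2 fun i => ?_)
  fin_cases i
  · simpa using measurable_deriv f
  · simp

/-- If n ≠ m, move from z in the direction v = m - n. Its products with n and m are -‖v‖²/2 and
‖v‖²/2, so the points reached are inside Ω according to n and outside according to m; ε = ‖v‖/4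
keeps both cones wide enough. -/
lemma IsOuterNormal.unique {Ω : Set Plane} {z n m : Plane} (hn : IsOuterNormal Ω z n)
    (hm : IsOuterNormal Ω z m) : n = m := by
  by_contra hne
  set v := m - n with hv
  have hv0 : 0 < ‖v‖ := norm_pos_iff.2 (sub_ne_zero.2 (Ne.symm hne))
  have h1 : inner ℝ v v = ‖v‖ ^ 2 := real_inner_self_eq_norm_sq v
  have hnn : inner ℝ n n = 1 := by rw [real_inner_self_eq_norm_sq, hn.1, one_pow]
  have hmm : inner ℝ m m = 1 := by rw [real_inner_self_eq_norm_sq, hm.1, one_pow]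
  have hnm : inner ℝ m n = inner ℝ n m := real_inner_comm _ _
  have h2 : inner ℝ v n = -(‖v‖ ^ 2 / 2) := by
    rw [← h1, hv]; simp only [inner_sub_left, inner_sub_right]; rw [hnn, hmm, hnm]; ring
  have h3 : inner ℝ v m = ‖v‖ ^ 2 / 2 := by
    rw [← h1, hv]; simp only [inner_sub_left, inner_sub_right]; rw [hnn, hmm, hnm]; ring
  have hε : 0 < ‖v‖ / 4 := by positivity
  have hev := (hn.2 _ hε).and (hm.2 _ hε)
  have ht : Tendsto (fun t : ℝ => z + t • v) (𝓝[>] 0) (𝓝 z) := by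
    have : Continuous fun t : ℝ => z + t • v := by fun_prop
    simpa using (this.tendsto 0).mono_left (nhdsWithin_le_nhds (s := Ioi 0))
  obtain ⟨t, ⟨⟨ha, -⟩, ⟨-, hb⟩⟩, ht0⟩ := ((ht.eventually hev).and self_mem_nhdsWithin).exists
  simp only [add_sub_cancel_left, real_inner_smul_left, norm_smul, Real.norm_eq_abs,
    abs_of_pos ht0, h2, h3] at ha hb
  have h4 : 0 < t * ‖v‖ ^ 2 := by positivity
  exact hb (by nlinarith) (ha (by nlinarith))

lemma IsOuterNormal.outerNormal_eq {Ω : Set Plane} {z n : Plane} (hn : IsOuterNormal Ω z n) :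
    outerNormal Ω z = n := by
  have h : ∃ n, IsOuterNormal Ω z n := ⟨n, hn⟩
  rw [outerNormal, dif_pos h]
  exact h.choose_spec.unique hn

lemma norm_outerNormal_le (Ω : Set Plane) (z : Plane) : ‖outerNormal Ω z‖ ≤ 1 := by
  rw [outerNormal]
  split_ifs with h
  · exact h.choose_spec.1.le
  · simp

namespace IsChart

variable {Ω U : Set Plane} {e : Plane ≃ᵃⁱ[ℝ] Plane} {f : ℝ → ℝ} {K : ℝ≥0}

lemma mem_frontier_iff (h : IsChart Ω U e f K) {p : Plane} (hp : p ∈ U) :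
    p ∈ frontier Ω ↔ p ∈ range (chartCurve e f) := by
  have hcf : Continuous f := h.lipschitz.continuous
  have hx : Continuous fun q : Plane => e q 0 := continuous_coord e 0
  have hy : Continuous fun q : Plane => e q 1 := continuous_coord e 1
  have hU : U ∈ 𝓝 p := h.isOpen.mem_nhds hp
  rw [mem_range_chartCurve]
  constructor
  · intro hfr
    rcases lt_trichotomy (e p 1) (f (e p 0)) with hlt | heq | hgt
    · exfalso
      have : ∀ᶠ q in 𝓝 p, q ∉ Ω := by
        filter_upwards [hU, hy.continuousAt.eventually_lt (hcf.comp hx).continuousAt hlt]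
          with q hq hq' hqΩ
        exact lt_asymm ((h.mem_iff q hq).1 hqΩ) hq'
      exact (mem_closure_iff_frequently.1 hfr.1) this
    · exact heq
    · exfalso
      refine hfr.2 (mem_interior_iff_mem_nhds.2 ?_)
      filter_upwards [hU, (hcf.comp hx).continuousAt.eventually_lt hy.continuousAt hgt]
        with q hq hq' using (h.mem_iff q hq).2 hq'
  · intro heq
    refine ⟨?_, fun hinteg => ?_⟩
    -- Moving vertically upwards from a point of the graph enters Ω at once.
    · rw [mem_closure_iff_frequently]
      have ht : Tendsto (fun t : ℝ => p + t • e.linearIsometryEquiv.symm !₂[0, 1])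
          (𝓝[>] 0) (𝓝 p) := by
        have : Continuous fun t : ℝ => p + t • e.linearIsometryEquiv.symm !₂[0, 1] := by fun_prop
        simpa using (this.tendsto 0).mono_left (nhdsWithin_le_nhds (s := Ioi 0))
      refine ht.frequently (Eventually.frequently ?_)
      filter_upwards [ht.eventually hU, self_mem_nhdsWithin] with t htU ht0
      rw [h.mem_iff _ htU, add_comm, ← vadd_eq_add, e.map_vadd]
      simp [heq]
      exact ht0
    · have := (h.mem_iff p hp).1 (interior_subset hinteg)
      linarith

/-- The product of p - z with the normal is, up to the factor `arcDensity`, the height of the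
tangent line minus the height of p. The tangent line differs from the graph by at most ε times the
distance, and `arcDensity` ≥ 1 only widens the margin. -/
lemma isOuterNormal (h : IsChart Ω U e f K) {s : ℝ} (hs : chartCurve e f s ∈ U)
    (hd : DifferentiableAt ℝ f s) :
    IsOuterNormal Ω (chartCurve e f s) (chartNormal e f s) := by
  refine ⟨norm_chartNormal e f s, fun ε hε => ?_⟩
  set z := chartCurve e f s with hz
  have hez : e z = !₂[s, f s] := by simp [hz, chartCurve]
  have hx : Continuous fun q : Plane => e q 0 := continuous_coord e 0
  have hxz : Tendsto (fun q : Plane => e q 0) (𝓝 z) (𝓝 s) := by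
    simpa [hez] using hx.tendsto z
  have ho := hxz.eventually ((hasDerivAt_iff_isLittleO.1 hd.hasDerivAt).def hε)
  filter_upwards [ho, h.isOpen.mem_nhds hs] with p hp hpU
  have hL : e.linearIsometryEquiv (p - z) = e p - e z := e.map_vsub p z
  rw [inner_chartNormal, hL, hez, h.mem_iff p hpU]
  have hle : |e p 0 - s| ≤ ‖p - z‖ := by
    rw [← e.linearIsometryEquiv.norm_map, hL, hez]
    have := PiLp.norm_apply_le (e p - !₂[s, f s]) 0
    simpa using this
  have hJ := one_le_arcDensity f s
  have hJ0 := arcDensity_pos f s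
  simp only [Real.norm_eq_abs, smul_eq_mul] at hp
  have hp2 := abs_le.1 (hp.trans (mul_le_mul_of_nonneg_left hle hε.le))
  have hn : 0 ≤ ε * ‖p - z‖ := by positivity
  simp only [PiLp.sub_apply, Matrix.cons_val_zero, Matrix.cons_val_one, Matrix.cons_val_fin_one,
    ← div_eq_inv_mul]
  rw [div_lt_iff₀ hJ0, lt_div_iff₀ hJ0]
  have hmul := mul_le_mul_of_nonneg_left hJ hn
  constructor
  · intro h1; nlinarith [hp2.1, hp2.2]
  · intro h1 h2; nlinarith [hp2.1, hp2.2]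

lemma outerNormal_eq (h : IsChart Ω U e f K) {s : ℝ} (hs : chartCurve e f s ∈ U)
    (hd : DifferentiableAt ℝ f s) :
    outerNormal Ω (chartCurve e f s) = chartNormal e f s :=
  (h.isOuterNormal hs hd).outerNormal_eq

lemma measurableEmbedding (h : IsChart Ω U e f K) : MeasurableEmbedding (chartCurve e f) :=
  (isGraphParam_chartCurve e f).measurableEmbedding h.lipschitz

/-- Arc length in a chart. -/
lemma boundaryMeasure_restrict (h : IsChart Ω U e f K) :
    (boundaryMeasure Ω).restrict U = Measure.map (chartCurve e f)
      ((volume.restrict (chartCurve e f ⁻¹' U)).withDensity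
        fun s => ENNReal.ofReal (arcDensity f s)) := by
  have hU := h.isOpen.measurableSet
  have h1 : U ∩ frontier Ω = range (chartCurve e f) ∩ U := by
    ext p
    constructor
    · exact fun hp => ⟨(h.mem_frontier_iff hp.1).1 hp.2, hp.1⟩
    · exact fun hp => ⟨hp.2, (h.mem_frontier_iff hp.2).2 hp.1⟩
  rw [boundaryMeasure, Measure.restrict_restrict hU, h1, inter_comm, ← Measure.restrict_restrict hU,
    (isGraphParam_chartCurve e f).hausdorffMeasure_restrict_range h.lipschitz,
    Measure.restrict_map h.measurableEmbedding.measurable hU,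
    restrict_withDensity (h.measurableEmbedding.measurable hU)]

/-- The density of arc length is positive, so null sets on the curve are exactly Lebesgue null sets
of parameters. -/
lemma ae_restrict_iff (h : IsChart Ω U e f K) {P : Plane → Prop} :
    (∀ᵐ z ∂((boundaryMeasure Ω).restrict U), P z) ↔
      ∀ᵐ s, chartCurve e f s ∈ U → P (chartCurve e f s) := by
  rw [h.boundaryMeasure_restrict, h.measurableEmbedding.ae_map_iff,
    ae_withDensity_iff (measurable_arcDensity f).ennreal_ofReal,
    MeasureTheory.ae_restrict_iff' (h.measurableEmbedding.measurable h.isOpen.measurableSet)]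
  refine eventually_congr (Eventually.of_forall fun s => ?_)
  simp [arcDensity_pos f s]

lemma ae_isOuterNormal (h : IsChart Ω U e f K) :
    ∀ᵐ z ∂((boundaryMeasure Ω).restrict U), IsOuterNormal Ω z (outerNormal Ω z) := by
  rw [h.ae_restrict_iff]
  filter_upwards [h.lipschitz.ae_differentiableAt_real] with s hd hs
  rw [h.outerNormal_eq hs hd]
  exact h.isOuterNormal hs hd

/-- The normal is obtained by choice, so measurability comes from its almost everywhere agreement
with `chartNormal`, an explicit function of the measurable derivative of f. -/
lemma aemeasurable_outerNormal (h : IsChart Ω U e f K) :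
    AEMeasurable (outerNormal Ω) ((boundaryMeasure Ω).restrict U) := by
  rw [h.boundaryMeasure_restrict, h.measurableEmbedding.aemeasurable_map_iff]
  refine ⟨chartNormal e f, measurable_chartNormal e f, ?_⟩
  refine (withDensity_absolutelyContinuous _ _).ae_le ?_
  refine (MeasureTheory.ae_restrict_iff' (h.measurableEmbedding.measurable h.isOpen.measurableSet)).2 ?_
  filter_upwards [h.lipschitz.ae_differentiableAt_real] with s hd hs
  exact h.outerNormal_eq hs hd

/-- A boundary integral in a chart. -/
lemma integral_boundary (h : IsChart Ω U e f K) (g : Plane → ℝ) (hg : ∀ z ∉ U, g z = 0)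
    (v : Plane) :
    ∫ z, g z * inner ℝ v (outerNormal Ω z) ∂(boundaryMeasure Ω) =
      ∫ s, g (chartCurve e f s) *
        (deriv f s * e.linearIsometryEquiv v 0 - e.linearIsometryEquiv v 1) := by
  have h1 : ∫ z, g z * inner ℝ v (outerNormal Ω z) ∂(boundaryMeasure Ω)
      = ∫ z in U, g z * inner ℝ v (outerNormal Ω z) ∂(boundaryMeasure Ω) := by
    rw [setIntegral_eq_integral_of_forall_compl_eq_zero]
    intro z hz; rw [hg z hz, zero_mul]
  have hm := h.measurableEmbedding.measurable h.isOpen.measurableSet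
  rw [h1, h.boundaryMeasure_restrict, h.measurableEmbedding.integral_map,
    integral_withDensity_eq_integral_toReal_smul (measurable_arcDensity f).ennreal_ofReal
      (Eventually.of_forall fun _ => ENNReal.ofReal_lt_top),
    ← setIntegral_eq_integral_of_forall_compl_eq_zero (s := chartCurve e f ⁻¹' U)
      (μ := volume) (f := fun s => g (chartCurve e f s) *
        (deriv f s * e.linearIsometryEquiv v 0 - e.linearIsometryEquiv v 1))]
  · refine setIntegral_congr_ae hm ?_
    filter_upwards [h.lipschitz.ae_differentiableAt_real] with s hd hs
    -- The arc length density cancels the normalizing factor of the normal.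
    rw [h.outerNormal_eq hs hd, inner_chartNormal,
      ENNReal.toReal_ofReal (arcDensity_pos f s).le, smul_eq_mul]
    field_simp [(arcDensity_pos f s).ne']
  · intro s hs; rw [hg _ hs, zero_mul]

end IsChart

lemma IsBoundedLipschitz.exists_chart {Ω : Set Plane} (hΩ : IsBoundedLipschitz Ω) {z : Plane}
    (hz : z ∈ frontier Ω) : ∃ U e f K, z ∈ U ∧ IsChart Ω U e f K := by
  obtain ⟨e, f, K, hf, hev⟩ := hΩ.boundary z hz
  obtain ⟨U, hU, hUo, hzU⟩ := eventually_nhds_iff.1 hev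
  exact ⟨U, e, f, K, hzU, hUo, hf, hU⟩

/-! ### The gradient theorem on an epigraph and in a chart. -/

lemma lineDeriv_eq_zero_of_notMem_tsupport {g : Plane → ℝ} {z : Plane} (hz : z ∉ tsupport g)
    (v : Plane) : lineDeriv ℝ g z v = 0 := by
  have h : g =ᶠ[𝓝 z] fun _ => 0 := notMem_tsupport_iff_eventuallyEq.1 hz
  rw [h.lineDeriv_eq]
  simp [lineDeriv]

lemma integrable_lineDeriv {g : Plane → ℝ} {C : ℝ≥0} (hg : LipschitzWith C g)
    (hc : HasCompactSupport g) (v : Plane) : Integrable fun z => lineDeriv ℝ g z v := by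
  have h := (hg.locallyIntegrable_lineDeriv (μ := volume) v).integrableOn_isCompact hc
  rwa [integrableOn_iff_integrable_of_support_subset] at h
  intro z hz
  by_contra hmem
  exact hz (lineDeriv_eq_zero_of_notMem_tsupport hmem v)

/-- The map `(s, τ) ↦ (s, τ)` from the product to the Euclidean plane. -/
lemma volume_preserving_pair :
    MeasurePreserving (fun q : ℝ × ℝ => (!₂[q.1, q.2] : Plane)) volume volume :=
  (PiLp.volume_preserving_toLp (Fin 2)).comp (volume_preserving_finTwoArrow ℝ).symm

lemma measurableEmbedding_pair : MeasurableEmbedding fun q : ℝ × ℝ => (!₂[q.1, q.2] : Plane) :=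
  (MeasurableEquiv.toLp 2 (Fin 2 → ℝ)).measurableEmbedding.comp
    (MeasurableEquiv.finTwoArrow (α := ℝ)).symm.measurableEmbedding

lemma integral_plane {F : Plane → ℝ} (hF : Integrable F) :
    Integrable (fun s : ℝ => ∫ τ : ℝ, F !₂[s, τ]) ∧
      ∫ z, F z = ∫ s : ℝ, ∫ τ : ℝ, F !₂[s, τ] := by
  have h1 : Integrable (fun q : ℝ × ℝ => F !₂[q.1, q.2]) (volume.prod volume) :=
    (volume_preserving_pair.integrable_comp_emb measurableEmbedding_pair).2 hF
  refine ⟨h1.integral_prod_left, ?_⟩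
  rw [← integral_prod _ h1, ← volume_preserving_pair.integral_comp measurableEmbedding_pair]
  rfl

/-- A Lipschitz approximation of the indicator function of the epigraph of `f`. -/
def ramp (f : ℝ → ℝ) (k : ℝ) (p : Plane) : ℝ := max 0 (min 1 (k * (p 1 - f (p 0))))

lemma lipschitz_ramp {f : ℝ → ℝ} {K : ℝ≥0} (hf : LipschitzWith K f) (k : ℝ) :
    ∃ C, LipschitzWith C (ramp f k) := by
  have h0 : LipschitzWith ‖(EuclideanSpace.proj 0 : Plane →L[ℝ] ℝ)‖₊ fun p : Plane => p 0 :=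
    (EuclideanSpace.proj 0 : Plane →L[ℝ] ℝ).lipschitz
  have h1 : LipschitzWith ‖(EuclideanSpace.proj 1 : Plane →L[ℝ] ℝ)‖₊ fun p : Plane => p 1 :=
    (EuclideanSpace.proj 1 : Plane →L[ℝ] ℝ).lipschitz
  have h2 := (lipschitzWith_smul k).comp (h1.sub (hf.comp h0))
  exact ⟨_, (h2.const_min 1).const_max 0⟩

lemma ramp_nonneg (f : ℝ → ℝ) (k : ℝ) (p : Plane) : 0 ≤ ramp f k p := le_max_left _ _

lemma ramp_le_one (f : ℝ → ℝ) (k : ℝ) (p : Plane) : ramp f k p ≤ 1 :=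
  max_le zero_le_one (min_le_left _ _)

lemma ramp_of_le {f : ℝ → ℝ} {k : ℝ} (hk : 0 ≤ k) {p : Plane} (hp : p 1 ≤ f (p 0)) :
    ramp f k p = 0 :=
  max_eq_left ((min_le_right _ _).trans (mul_nonpos_of_nonneg_of_nonpos hk (by linarith)))

lemma ramp_of_ge {f : ℝ → ℝ} {k : ℝ} {p : Plane} (hp : 1 ≤ k * (p 1 - f (p 0))) :
    ramp f k p = 1 := by
  rw [ramp, min_eq_left hp]; simp

lemma ramp_of_mem {f : ℝ → ℝ} {k : ℝ} {p : Plane} (h0 : 0 ≤ k * (p 1 - f (p 0)))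
    (h1 : k * (p 1 - f (p 0)) ≤ 1) : ramp f k p = k * (p 1 - f (p 0)) := by
  rw [ramp, min_eq_right h1, max_eq_right h0]

/-- The ramp is locally 0, affine in the height above the graph, or 1. The two excluded heights are
its kinks; they are a null set on each vertical line. -/
lemma lineDeriv_ramp {f : ℝ → ℝ} (hfc : Continuous f) {k : ℝ} (hk : 0 < k) {s τ : ℝ}
    (hd : DifferentiableAt ℝ f s) (h0 : τ ≠ f s) (h1 : τ ≠ f s + k⁻¹) (w : Plane) :
    lineDeriv ℝ (ramp f k) !₂[s, τ] w =
      (Ioo (f s) (f s + k⁻¹)).indicator (fun _ => k * (w 1 - deriv f s * w 0)) τ := by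
  set φ : ℝ → ℝ := fun t => k * ((τ + t * w 1) - f (s + t * w 0)) with hφ
  have hφc : Continuous φ := by fun_prop
  have hφ0 : φ 0 = k * (τ - f s) := by simp [hφ]
  have hcoord : ∀ t : ℝ, k * ((!₂[s, τ] + t • w : Plane) 1 - f ((!₂[s, τ] + t • w : Plane) 0))
      = φ t := by intro t; simp [hφ]
  have hdφ : HasDerivAt φ (k * (w 1 - deriv f s * w 0)) 0 := by
    have hin : HasDerivAt (fun t : ℝ => s + t * w 0) (w 0) 0 := by
      simpa using ((hasDerivAt_id (0 : ℝ)).mul_const (w 0)).const_add s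
    have hin' : HasDerivAt (fun t : ℝ => τ + t * w 1) (w 1) 0 := by
      simpa using ((hasDerivAt_id (0 : ℝ)).mul_const (w 1)).const_add τ
    have hf' : HasDerivAt f (deriv f s) (s + 0 * w 0) := by simpa using hd.hasDerivAt
    exact (hin'.sub (hf'.comp 0 hin)).const_mul k
  rw [lineDeriv]
  have hkk : k * k⁻¹ = 1 := mul_inv_cancel₀ hk.ne'
  rcases lt_or_gt_of_ne h0 with hlt | hgt
  · rw [indicator_of_notMem (fun h => lt_asymm h.1 hlt)]
    have hneg : φ 0 < 0 := by rw [hφ0]; nlinarith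
    have : (fun t : ℝ => ramp f k (!₂[s, τ] + t • w)) =ᶠ[𝓝 0] fun _ => 0 := by
      filter_upwards [hφc.continuousAt.eventually_lt continuousAt_const hneg] with t ht
      rw [ramp, hcoord]
      exact max_eq_left ((min_le_right _ _).trans ht.le)
    rw [this.deriv_eq]; simp
  · rcases lt_or_gt_of_ne h1 with hlt' | hgt'
    · rw [indicator_of_mem (show τ ∈ Ioo (f s) (f s + k⁻¹) from ⟨hgt, hlt'⟩)]
      have hpos : 0 < φ 0 := by rw [hφ0]; nlinarith
      have hlt1 : φ 0 < 1 := by rw [hφ0]; nlinarith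
      have : (fun t : ℝ => ramp f k (!₂[s, τ] + t • w)) =ᶠ[𝓝 0] φ := by
        filter_upwards [hφc.continuousAt.eventually_lt continuousAt_const hlt1,
          continuousAt_const.eventually_lt hφc.continuousAt hpos] with t ht ht'
        rw [← hcoord]
        rw [← hcoord] at ht ht'
        exact ramp_of_mem ht'.le ht.le
      rw [this.deriv_eq, hdφ.deriv]
    · rw [indicator_of_notMem (fun h => lt_asymm h.2 hgt')]
      have hgt1 : 1 < φ 0 := by rw [hφ0]; nlinarith
      have : (fun t : ℝ => ramp f k (!₂[s, τ] + t • w)) =ᶠ[𝓝 0] fun _ => 1 := by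
        filter_upwards [continuousAt_const.eventually_lt hφc.continuousAt hgt1] with t ht
        rw [← hcoord] at ht
        exact ramp_of_ge ht.le
      rw [this.deriv_eq]; simp

lemma lipschitz_pair_right (s : ℝ) : LipschitzWith 1 fun τ : ℝ => (!₂[s, τ] : Plane) := by
  refine LipschitzWith.of_dist_le_mul fun τ τ' => ?_
  rw [EuclideanSpace.dist_eq]
  simp [Fin.sum_univ_two, Real.dist_eq, Real.sqrt_sq_eq_abs]

/-- The gradient theorem on the epigraph of a Lipschitz function. -/
theorem integral_epigraph_lineDeriv {f : ℝ → ℝ} {K C : ℝ≥0} (hf : LipschitzWith K f)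
    {g : Plane → ℝ} (hg : LipschitzWith C g) (hc : HasCompactSupport g) (w : Plane) :
    ∫ z in {p : Plane | f (p 0) < p 1}, lineDeriv ℝ g z w =
      ∫ s, g !₂[s, f s] * (deriv f s * w 0 - w 1) := by
  have hfc := hf.continuous
  have hgc := hg.continuous
  have hcont0 : Continuous fun p : Plane => p 0 :=
    (EuclideanSpace.proj 0 : Plane →L[ℝ] ℝ).continuous
  have hcont1 : Continuous fun p : Plane => p 1 :=
    (EuclideanSpace.proj 1 : Plane →L[ℝ] ℝ).continuous
  have hE : MeasurableSet {p : Plane | f (p 0) < p 1} :=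
    (isOpen_lt (hfc.comp hcont0) hcont1).measurableSet
  obtain ⟨M, hM⟩ := hc.exists_bound_of_continuous hgc
  have hM0 : 0 ≤ M := (norm_nonneg _).trans (hM 0)
  obtain ⟨R, hR⟩ : ∃ R : ℝ, ∀ p ∈ tsupport g, ‖p‖ ≤ R := hc.isBounded.exists_norm_le
  have hgR : ∀ s τ : ℝ, s ∉ Icc (-R) R → g !₂[s, τ] = 0 := by
    intro s τ hs
    refine image_eq_zero_of_notMem_tsupport fun hmem => hs (abs_le.1 ?_)
    have h1 := PiLp.norm_apply_le (!₂[s, τ] : Plane) 0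
    simp only [Matrix.cons_val_zero, Real.norm_eq_abs] at h1
    exact h1.trans (hR _ hmem)
  have hkpos : ∀ n : ℕ, (0 : ℝ) < n + 1 := fun n => by positivity
  -- the left-hand side as a limit
  have hL : Tendsto (fun n : ℕ => ∫ z, lineDeriv ℝ g z w * ramp f (n + 1) z) atTop
      (𝓝 (∫ z in {p : Plane | f (p 0) < p 1}, lineDeriv ℝ g z w)) := by
    rw [← integral_indicator hE]
    refine tendsto_integral_of_dominated_convergence (fun z => ‖lineDeriv ℝ g z w‖) ?_
      (integrable_lineDeriv hg hc w).norm ?_ ?_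
    · intro n
      obtain ⟨D, hD⟩ := lipschitz_ramp hf (n + 1)
      exact (integrable_lineDeriv hg hc w).aestronglyMeasurable.mul
        hD.continuous.aestronglyMeasurable
    · intro n
      refine Eventually.of_forall fun z => ?_
      rw [norm_mul, Real.norm_eq_abs (ramp _ _ _), abs_of_nonneg (ramp_nonneg _ _ _)]
      exact mul_le_of_le_one_right (norm_nonneg _) (ramp_le_one _ _ _)
    · refine Eventually.of_forall fun z => ?_
      by_cases hz : f (z 0) < z 1
      · rw [indicator_of_mem (by exact hz)]
        refine tendsto_const_nhds.congr' ?_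
        obtain ⟨n0, hn0⟩ := exists_nat_ge (z 1 - f (z 0))⁻¹
        filter_upwards [eventually_ge_atTop n0] with n hn
        rw [ramp_of_ge, mul_one]
        have hpos : 0 < z 1 - f (z 0) := by linarith
        have h1 : (n0 : ℝ) ≤ n := by exact_mod_cast hn
        have h2 : (z 1 - f (z 0))⁻¹ * (z 1 - f (z 0)) = 1 := inv_mul_cancel₀ hpos.ne'
        rw [← h2]
        exact mul_le_mul_of_nonneg_right (by linarith) hpos.le
      · rw [indicator_of_notMem (by exact hz)]
        refine tendsto_const_nhds.congr fun n => ?_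
        rw [ramp_of_le (hkpos n).le (not_lt.1 hz), mul_zero]
  -- integration by parts
  set B : ℕ → ℝ → ℝ := fun n s => ∫ τ, lineDeriv ℝ (ramp f (n + 1)) !₂[s, τ] w * g !₂[s, τ]
    with hBdef
  -- Both factors are Lipschitz on the whole plane and g has compact support, so no boundary term
  -- arises. The derivative of the ramp is then integrated along vertical lines first.
  have hparts : ∀ n : ℕ, Integrable (B n) ∧
      ∫ z, lineDeriv ℝ g z w * ramp f (n + 1) z = -∫ s, B n s := by
    intro n
    obtain ⟨D, hD⟩ := lipschitz_ramp hf (n + 1)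
    have hinteg : Integrable fun z => lineDeriv ℝ (ramp f (n + 1)) z w * g z := by
      have := (hgc.integrable_of_hasCompactSupport (μ := volume) hc).bdd_mul
        (c := D * ‖w‖) (f := fun z => lineDeriv ℝ (ramp f (n + 1)) z w)
        (aestronglyMeasurable_lineDeriv hD.continuous volume)
        (Eventually.of_forall fun _ => norm_lineDeriv_le_of_lipschitz ℝ hD)
      exact this
    obtain ⟨h1, h2⟩ := integral_plane hinteg
    refine ⟨h1, ?_⟩
    rw [← h2, hD.integral_lineDeriv_mul_eq hg hc w, ← integral_neg]
    simp [lineDeriv_neg]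
  -- The slope n + 1 is the reciprocal of the thickness of the layer, so the vertical integral is a
  -- mean value of g just above the graph.
  have hBval : ∀ n : ℕ, ∀ s, DifferentiableAt ℝ f s → B n s = (w 1 - deriv f s * w 0) *
      ((n + 1) * ∫ τ in Ioo (f s) (f s + ((n : ℝ) + 1)⁻¹), g !₂[s, τ]) := by
    intro n s hs
    rw [← mul_assoc, ← integral_const_mul, ← integral_indicator measurableSet_Ioo]
    refine integral_congr_ae ?_
    have hnull : ∀ a : ℝ, ∀ᵐ τ : ℝ, τ ≠ a := fun a => by
      simp [ae_iff]
    filter_upwards [hnull (f s), hnull (f s + ((n : ℝ) + 1)⁻¹)] with τ h0 h1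
    rw [lineDeriv_ramp hfc (hkpos n) hs h0 h1]
    by_cases hτ : τ ∈ Ioo (f s) (f s + ((n : ℝ) + 1)⁻¹)
    · rw [indicator_of_mem hτ, indicator_of_mem hτ]; ring
    · rw [indicator_of_notMem hτ, indicator_of_notMem hτ, zero_mul]
  have hvol : ∀ (n : ℕ) (s : ℝ),
      volume.real (Ioo (f s) (f s + ((n : ℝ) + 1)⁻¹)) = ((n : ℝ) + 1)⁻¹ := by
    intro n s
    rw [Real.volume_real_Ioo_of_le (by have := inv_pos.2 (hkpos n); linarith)]; ring
  have hderiv : ∀ s, |deriv f s| ≤ K := fun s => by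
    simpa using norm_deriv_le_of_lipschitz (x₀ := s) hf
  have hcoef : ∀ s, |w 1 - deriv f s * w 0| ≤ |w 1| + K * |w 0| := fun s => by
    refine (abs_sub _ _).trans ?_
    rw [abs_mul]
    gcongr
    exact hderiv s
  have havg : ∀ (n : ℕ) (s : ℝ),
      |((n : ℝ) + 1) * (∫ τ in Ioo (f s) (f s + ((n : ℝ) + 1)⁻¹), g !₂[s, τ]) - g !₂[s, f s]|
        ≤ C * ((n : ℝ) + 1)⁻¹ := by
    intro n s
    have hgs : Continuous fun τ : ℝ => g !₂[s, τ] := hgc.comp (lipschitz_pair_right s).continuous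
    have hI : IntegrableOn (fun τ : ℝ => g !₂[s, τ]) (Ioo (f s) (f s + ((n : ℝ) + 1)⁻¹)) :=
      (hgs.integrableOn_Icc).mono_set Ioo_subset_Icc_self
    have h1 : ((n : ℝ) + 1) * (∫ τ in Ioo (f s) (f s + ((n : ℝ) + 1)⁻¹), g !₂[s, τ])
        - g !₂[s, f s] = ((n : ℝ) + 1) *
          ∫ τ in Ioo (f s) (f s + ((n : ℝ) + 1)⁻¹), (g !₂[s, τ] - g !₂[s, f s]) := by
      rw [integral_sub hI (integrableOn_const (by simp)), setIntegral_const, hvol, smul_eq_mul]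
      field_simp [(hkpos n).ne']
    rw [h1, abs_mul, abs_of_pos (hkpos n)]
    have h2 : ‖∫ τ in Ioo (f s) (f s + ((n : ℝ) + 1)⁻¹), (g !₂[s, τ] - g !₂[s, f s])‖
        ≤ (C * ((n : ℝ) + 1)⁻¹) * volume.real (Ioo (f s) (f s + ((n : ℝ) + 1)⁻¹)) := by
      refine norm_setIntegral_le_of_norm_le_const (by simp) fun τ hτ => ?_
      have h3 := (hg.comp (lipschitz_pair_right s)).dist_le_mul τ (f s)
      rw [Real.dist_eq, Real.dist_eq, mul_one] at h3
      refine h3.trans (mul_le_mul_of_nonneg_left ?_ C.2)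
      rw [abs_of_pos (by linarith [hτ.1])]; linarith [hτ.2]
    rw [hvol] at h2
    refine (mul_le_mul_of_nonneg_left h2 (hkpos n).le).trans (le_of_eq ?_)
    field_simp [(hkpos n).ne']
  have hRlim : Tendsto (fun n : ℕ => ∫ s, B n s) atTop
      (𝓝 (∫ s, (w 1 - deriv f s * w 0) * g !₂[s, f s])) := by
    -- The means of g differ from its boundary value by at most C/(n + 1) ≤ C, hence are bounded by
    -- M + C; they vanish for s outside [-R, R], since the support of g lies in the ball of radius
    -- R.
    refine tendsto_integral_of_dominated_convergence
      ((Icc (-R) R).indicator fun _ => (|w 1| + K * |w 0|) * (M + C)) ?_ ?_ ?_ ?_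
    · exact fun n => (hparts n).1.aestronglyMeasurable
    · exact (integrable_indicator_iff measurableSet_Icc).2 (integrableOn_const (by simp))
    · intro n
      filter_upwards [hf.ae_differentiableAt_real] with s hs
      rw [hBval n s hs]
      by_cases hsR : s ∈ Icc (-R) R
      · rw [indicator_of_mem hsR, norm_mul]
        refine mul_le_mul (hcoef s) ?_ (norm_nonneg _) (by positivity)
        have h1 := havg n s
        have h2 := hM !₂[s, f s]
        have h3 : (C : ℝ) * ((n : ℝ) + 1)⁻¹ ≤ C :=
          mul_le_of_le_one_right C.2 (inv_le_one_of_one_le₀ (by linarith [n.cast_nonneg (α := ℝ)]))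
        rw [Real.norm_eq_abs] at h2 ⊢
        rw [abs_le] at h1 h2 ⊢
        constructor <;> linarith [h1.1, h1.2, h2.1, h2.2]
      · rw [indicator_of_notMem hsR]
        simp [hgR s _ hsR]
    · filter_upwards [hf.ae_differentiableAt_real] with s hs
      simp only [hBval _ s hs]
      refine Tendsto.const_mul _ ?_
      rw [tendsto_iff_norm_sub_tendsto_zero]
      refine squeeze_zero (fun n => norm_nonneg _) (fun n => havg n s) ?_
      have := (tendsto_one_div_add_atTop_nhds_zero_nat (𝕜 := ℝ)).const_mul (C : ℝ)
      simpa using this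
  have h1 : Tendsto (fun n : ℕ => ∫ z, lineDeriv ℝ g z w * ramp f (n + 1) z) atTop
      (𝓝 (-∫ s, (w 1 - deriv f s * w 0) * g !₂[s, f s])) := by
    simp only [(hparts _).2]
    exact hRlim.neg
  rw [tendsto_nhds_unique hL h1, ← integral_neg]
  congr 1 with s
  ring

lemma measurePreserving_affineIsometryEquiv (e : Plane ≃ᵃⁱ[ℝ] Plane) :
    MeasurePreserving e volume volume := by
  have h : (e : Plane → Plane) = (fun z => z + e 0) ∘ e.linearIsometryEquiv := by
    ext1 z
    have := e.map_vadd 0 z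
    simpa using this
  rw [h]
  exact (measurePreserving_add_right volume (e 0)).comp e.linearIsometryEquiv.measurePreserving

/-- The gradient theorem in a chart. -/
theorem IsChart.integral_lineDeriv {Ω U : Set Plane} {e : Plane ≃ᵃⁱ[ℝ] Plane} {f : ℝ → ℝ}
    {K C : ℝ≥0} (h : IsChart Ω U e f K) (hΩ : MeasurableSet Ω) {g : Plane → ℝ}
    (hg : LipschitzWith C g) (hc : HasCompactSupport g) (hU : tsupport g ⊆ U) (v : Plane) :
    ∫ z in Ω, lineDeriv ℝ g z v =
      ∫ z, g z * inner ℝ v (outerNormal Ω z) ∂(boundaryMeasure Ω) := by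
  have hemb : MeasurableEmbedding e := e.toHomeomorph.measurableEmbedding
  have hcont0 : Continuous fun p : Plane => p 0 :=
    (EuclideanSpace.proj 0 : Plane →L[ℝ] ℝ).continuous
  have hcont1 : Continuous fun p : Plane => p 1 :=
    (EuclideanSpace.proj 1 : Plane →L[ℝ] ℝ).continuous
  have hE : MeasurableSet {p : Plane | f (p 0) < p 1} :=
    (isOpen_lt (h.lipschitz.continuous.comp hcont0) hcont1).measurableSet
  have hg' : LipschitzWith C (g ∘ e.symm) := by
    simpa using hg.comp e.symm.isometry.lipschitz
  have hc' : HasCompactSupport (g ∘ e.symm) := hc.comp_homeomorph e.symm.toHomeomorph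
  have hline : ∀ z, lineDeriv ℝ (g ∘ e.symm) (e z) (e.linearIsometryEquiv v)
      = lineDeriv ℝ g z v := by
    intro z
    simp only [lineDeriv, Function.comp_def]
    congr 1
    ext1 t
    congr 1
    rw [AffineIsometryEquiv.symm_apply_eq, ← map_smul, add_comm, add_comm z]
    exact (e.map_vadd z (t • v)).symm
  rw [h.integral_boundary g (fun z hz => image_eq_zero_of_notMem_tsupport fun hz' => hz (hU hz')) v]
  have h1 := integral_epigraph_lineDeriv h.lipschitz hg' hc' (e.linearIsometryEquiv v)
  refine Eq.trans ?_ h1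
  refine Eq.trans ?_ ((measurePreserving_affineIsometryEquiv e).setIntegral_preimage_emb hemb _ _)
  simp only [hline]
  -- Ω and the epigraph need to agree only on the support of g, which lies in the chart domain.
  rw [← integral_indicator hΩ, ← integral_indicator (hemb.measurable hE)]
  congr 1
  ext1 z
  by_cases hz : z ∈ tsupport g
  · have h3 := h.mem_iff z (hU hz)
    by_cases hzΩ : z ∈ Ω
    · rw [indicator_of_mem hzΩ, indicator_of_mem (by exact h3.1 hzΩ)]
    · rw [indicator_of_notMem hzΩ, indicator_of_notMem (s := e ⁻¹' _) (fun h4 => hzΩ (h3.2 h4))]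
  · have h0 : ∀ S : Set Plane, S.indicator (fun z => lineDeriv ℝ g z v) z = 0 := fun S =>
      indicator_apply_eq_zero.2 fun _ => lineDeriv_eq_zero_of_notMem_tsupport hz v
    rw [h0, h0]

/-! ### From charts to the whole domain. -/

lemma LipschitzWith.exists_mul_of_bounded {X : Type*} [PseudoMetricSpace X] {f g : X → ℝ}
    {A B : ℝ≥0} {a b : ℝ} (hf : LipschitzWith A f) (hg : LipschitzWith B g)
    (ha : ∀ x, ‖f x‖ ≤ a) (hb : ∀ x, ‖g x‖ ≤ b) :
    ∃ C, LipschitzWith C fun x => f x * g x := by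
  refine ⟨Real.toNNReal (|a| * B + |b| * A), LipschitzWith.of_dist_le_mul fun x y => ?_⟩
  rw [Real.coe_toNNReal _ (by positivity), Real.dist_eq]
  have h1 := hf.dist_le_mul x y
  have h2 := hg.dist_le_mul x y
  rw [Real.dist_eq] at h1 h2
  have h3 : f x * g x - f y * g y = f x * (g x - g y) + (f x - f y) * g y := by ring
  rw [h3]
  refine (abs_add_le _ _).trans ?_
  rw [abs_mul, abs_mul]
  have h4 : |f x| ≤ |a| := (ha x).trans (le_abs_self a)
  have h5 : |g y| ≤ |b| := (hb y).trans (le_abs_self b)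
  calc |f x| * |g x - g y| + |f x - f y| * |g y|
      ≤ |a| * (B * dist x y) + (A * dist x y) * |b| := by gcongr
    _ = (|a| * B + |b| * A) * dist x y := by ring

/-- A finite smooth partition of unity on a compact set, subordinate to an open cover. -/
lemma exists_smooth_partition {S : Set Plane} (hS : IsCompact S) {U : Plane → Set Plane}
    (hU : ∀ z ∈ S, IsOpen (U z) ∧ z ∈ U z) :
    ∃ (t : Finset Plane) (ζ : Plane → Plane → ℝ), (∀ z ∈ t, z ∈ S) ∧
      (∀ z ∈ t, ContDiff ℝ ∞ (ζ z) ∧ HasCompactSupport (ζ z) ∧ tsupport (ζ z) ⊆ U z ∧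
        ∀ p, 0 ≤ ζ z p) ∧ ∀ p ∈ S, ∑ z ∈ t, ζ z p = 1 := by
  classical
  -- The unit balls serve only to make the supports of the partition functions compact.
  obtain ⟨t, htS, hcov⟩ := hS.elim_nhds_subcover (fun z => U z ∩ Metric.ball z 1) fun z hz =>
    inter_mem ((hU z hz).1.mem_nhds (hU z hz).2) (Metric.ball_mem_nhds z one_pos)
  obtain ⟨ρ, hρ⟩ := SmoothPartitionOfUnity.exists_isSubordinate (modelWithCornersSelf ℝ Plane)
    hS.isClosed (fun z : t => U z ∩ Metric.ball (z : Plane) 1)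
    (fun z => (hU z (htS z z.2)).1.inter Metric.isOpen_ball)
    (fun p hp => by
      obtain ⟨z, hz, hpz⟩ := mem_iUnion₂.1 (hcov hp)
      exact mem_iUnion.2 ⟨⟨z, hz⟩, hpz⟩)
  refine ⟨t, fun z p => if hz : z ∈ t then ρ ⟨z, hz⟩ p else 0, htS, fun z hz => ?_, fun p hp => ?_⟩
  · simp only [hz, dif_pos]
    have hsub := hρ ⟨z, hz⟩
    refine ⟨(ρ ⟨z, hz⟩).contMDiff.contDiff, ?_, hsub.trans inter_subset_left,
      fun p => ρ.nonneg _ p⟩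
    exact HasCompactSupport.of_support_subset_isCompact (isCompact_closedBall z 1)
      ((subset_tsupport _).trans (hsub.trans (inter_subset_right.trans
        Metric.ball_subset_closedBall)))
  · have h1 := ρ.sum_eq_one hp
    rw [finsum_eq_sum_of_fintype] at h1
    rw [← Finset.sum_coe_sort t, ← h1]
    refine Finset.sum_congr rfl fun z _ => ?_
    simp

lemma ContDiff.exists_lipschitz {ζ : Plane → ℝ} (h : ContDiff ℝ ∞ ζ) (hc : HasCompactSupport ζ) :
    ∃ C, LipschitzWith C ζ :=
  ContDiff.lipschitzWith_of_hasCompactSupport hc h (by simp)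

/-- The product of a test function and a continuous, locally Lipschitz function. -/
lemma exists_lipschitz_mul {ζ g : Plane → ℝ} (hζ : ContDiff ℝ ∞ ζ) (hζc : HasCompactSupport ζ)
    {C : ℝ≥0} (hg : LipschitzWith C g) (hgc : HasCompactSupport g) :
    ∃ D, LipschitzWith D fun z => ζ z * g z := by
  obtain ⟨A, hA⟩ := ContDiff.exists_lipschitz hζ hζc
  obtain ⟨a, ha⟩ := hζc.exists_bound_of_continuous hA.continuous
  obtain ⟨b, hb⟩ := hgc.exists_bound_of_continuous hg.continuous
  exact LipschitzWith.exists_mul_of_bounded hA hg ha hb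

/-- A smooth cutoff function around a bounded set. -/
lemma exists_cutoff {Ω : Set Plane} (hb : Bornology.IsBounded Ω) :
    ∃ χ : Plane → ℝ, ContDiff ℝ ∞ χ ∧ HasCompactSupport χ ∧ ∀ z ∈ closure Ω, χ =ᶠ[𝓝 z] 1 := by
  obtain ⟨R, hR⟩ := hb.closure.subset_ball 0
  let χ : ContDiffBump (0 : Plane) :=
    ⟨max R 1, max R 1 + 1, lt_max_of_lt_right one_pos, lt_add_one _⟩
  refine ⟨χ, χ.contDiff, χ.hasCompactSupport, fun z hz => ?_⟩
  exact χ.eventuallyEq_one_of_mem_ball (Metric.ball_subset_ball (le_max_left _ _) (hR hz))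

lemma integrableOn_of_continuous {Ω : Set Plane} (hb : Bornology.IsBounded Ω) {E : Type*}
    [NormedAddCommGroup E] {g : Plane → E} (hg : Continuous g) : IntegrableOn g Ω :=
  (hg.continuousOn.integrableOn_compact hb.isCompact_closure).mono_set subset_closure

variable {Ω : Set Plane}

lemma isCompact_frontier (hΩ : IsBoundedLipschitz Ω) : IsCompact (frontier Ω) :=
  hΩ.isBounded.isCompact_closure.of_isClosed_subset isClosed_frontier frontier_subset_closure

/-- Both sides vanish: the open set Ω does not meet its frontier, and the integral of a derivative
of a compactly supported function over the plane is zero, by parts against the constant 1. -/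
lemma integral_lineDeriv_of_tsupport_subset (hΩ : IsOpen Ω) {g : Plane → ℝ} {C : ℝ≥0}
    (hg : LipschitzWith C g) (hc : HasCompactSupport g) (hU : tsupport g ⊆ Ω) (v : Plane) :
    ∫ z in Ω, lineDeriv ℝ g z v =
      ∫ z, g z * inner ℝ v (outerNormal Ω z) ∂(boundaryMeasure Ω) := by
  have h1 : ∫ z, g z * inner ℝ v (outerNormal Ω z) ∂(boundaryMeasure Ω) = 0 := by
    rw [boundaryMeasure, setIntegral_eq_zero_of_forall_eq_zero]
    intro z hz
    rw [hΩ.frontier_eq] at hz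
    have h0 : g z = 0 := image_eq_zero_of_notMem_tsupport fun hz' => hz.2 (hU hz')
    rw [h0, zero_mul]
  have h2 := (LipschitzWith.const (α := Plane) (1 : ℝ)).integral_lineDeriv_mul_eq
    (μ := volume) hg hc (-v)
  rw [h1, setIntegral_eq_integral_of_forall_compl_eq_zero]
  · simpa [lineDeriv] using h2.symm
  · intro z hz
    exact lineDeriv_eq_zero_of_notMem_tsupport (fun hz' => hz (hU hz')) v

lemma ae_mem_frontier (Ω : Set Plane) : ∀ᵐ z ∂(boundaryMeasure Ω), z ∈ frontier Ω :=
  ae_restrict_mem isClosed_frontier.measurableSet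

/-- Near a boundary point, Γ is the Lipschitz image of a bounded parameter set, bounded because the
chart curve does not shrink distances. Compactness of Γ does the rest. -/
lemma isFiniteMeasure_boundaryMeasure (hΩ : IsBoundedLipschitz Ω) :
    IsFiniteMeasure (boundaryMeasure Ω) := by
  refine ⟨?_⟩
  rw [boundaryMeasure, Measure.restrict_apply_univ]
  refine (isCompact_frontier hΩ).measure_lt_top_of_nhdsWithin fun z hz => ?_
  obtain ⟨U, e, f, K, hzU, h⟩ := hΩ.exists_chart hz
  refine ⟨frontier Ω ∩ (U ∩ Metric.ball z 1), ?_, ?_⟩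
  · exact inter_mem_nhdsWithin _ (inter_mem (h.isOpen.mem_nhds hzU) (Metric.ball_mem_nhds z one_pos))
  · have hγ := isGraphParam_chartCurve e f
    have hsub : frontier Ω ∩ (U ∩ Metric.ball z 1)
        ⊆ chartCurve e f '' (chartCurve e f ⁻¹' Metric.ball z 1) := by
      rintro p ⟨hp, hpU, hpb⟩
      obtain ⟨s, rfl⟩ := (h.mem_frontier_iff hpU).1 hp
      exact ⟨s, hpb, rfl⟩
    refine (measure_mono hsub).trans_lt ?_
    refine ((hγ.lipschitz h.lipschitz).hausdorffMeasure_image_le zero_le_one _).trans_lt ?_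
    rw [hausdorffMeasure_real, ENNReal.rpow_one]
    refine ENNReal.mul_lt_top (by simp) ?_
    exact (hγ.antilipschitz.isBounded_preimage Metric.isBounded_ball).measure_lt_top

lemma ae_isOuterNormal (hΩ : IsBoundedLipschitz Ω) :
    ∀ᵐ z ∂(boundaryMeasure Ω), IsOuterNormal Ω z (outerNormal Ω z) := by
  have h0 : boundaryMeasure Ω {z | z ∈ frontier Ω ∧ ¬ IsOuterNormal Ω z (outerNormal Ω z)} = 0 := by
    refine measure_null_of_locally_null _ fun z hz => ?_
    obtain ⟨U, e, f, K, hzU, h⟩ := hΩ.exists_chart hz.1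
    refine ⟨_, inter_mem_nhdsWithin _ (h.isOpen.mem_nhds hzU), ?_⟩
    have h1 := h.ae_isOuterNormal
    rw [ae_restrict_iff' h.isOpen.measurableSet, ae_iff] at h1
    refine measure_mono_null (fun p hp => ?_) h1
    simp only [mem_ofPred_eq, Classical.not_imp]
    exact ⟨hp.2, hp.1.2⟩
  filter_upwards [ae_mem_frontier Ω, measure_eq_zero_iff_ae_notMem.1 h0] with z hz hz'
  by_contra hcon
  exact hz' ⟨hz, hcon⟩

lemma aemeasurable_outerNormal (hΩ : IsBoundedLipschitz Ω) :
    AEMeasurable (outerNormal Ω) (boundaryMeasure Ω) := by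
  have hloc : ∀ z, ∃ U : Set Plane, z ∈ frontier Ω → (IsOpen U ∧ z ∈ U) ∧
      AEMeasurable (outerNormal Ω) ((boundaryMeasure Ω).restrict U) := by
    intro z
    by_cases hz : z ∈ frontier Ω
    · obtain ⟨U, e, f, K, hzU, h⟩ := hΩ.exists_chart hz
      exact ⟨U, fun _ => ⟨⟨h.isOpen, hzU⟩, h.aemeasurable_outerNormal⟩⟩
    · exact ⟨∅, fun h => (hz h).elim⟩
  choose U hU using hloc
  obtain ⟨t, htS, hcov⟩ := (isCompact_frontier hΩ).elim_nhds_subcover U fun z hz =>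
    (hU z hz).1.1.mem_nhds (hU z hz).1.2
  have h1 : AEMeasurable (outerNormal Ω) ((boundaryMeasure Ω).restrict (⋃ z : t, U z)) := by
    rw [aemeasurable_iUnion_iff]
    exact fun z => (hU z (htS z z.2)).2
  have h2 : (boundaryMeasure Ω).restrict (⋃ z : t, U z) = boundaryMeasure Ω := by
    refine Measure.restrict_eq_self_of_ae_mem ?_
    filter_upwards [ae_mem_frontier Ω] with p hp
    obtain ⟨z, hz, hpz⟩ := mem_iUnion₂.1 (hcov hp)
    exact mem_iUnion.2 ⟨⟨z, hz⟩, hpz⟩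
  rwa [h2] at h1

/-- A continuous function has finite `L^p` norm on the boundary. -/
lemma memLp_boundary_of_continuousOn (hΩ : IsBoundedLipschitz Ω) {E : Type*}
    [NormedAddCommGroup E] [SecondCountableTopology E] {g : Plane → E}
    (hg : ContinuousOn g (frontier Ω)) (p : ℝ≥0∞) :
    MemLp g p (boundaryMeasure Ω) := by
  have := isFiniteMeasure_boundaryMeasure hΩ
  obtain ⟨C, hC⟩ := (isCompact_frontier hΩ).exists_bound_of_continuousOn hg
  refine MemLp.of_bound (hg.aestronglyMeasurable isClosed_frontier.measurableSet) C ?_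
  filter_upwards [ae_mem_frontier Ω] with z hz using hC z hz

lemma memLp_top_inner_outerNormal (hΩ : IsBoundedLipschitz Ω) {c : Plane → Plane}
    (hc : ContinuousOn c (frontier Ω)) :
    MemLp (fun z => inner ℝ (c z) (outerNormal Ω z)) ⊤ (boundaryMeasure Ω) := by
  obtain ⟨C, hC⟩ := (isCompact_frontier hΩ).exists_bound_of_continuousOn hc
  refine memLp_top_of_bound (AEStronglyMeasurable.inner
    (hc.aestronglyMeasurable isClosed_frontier.measurableSet)
    (aemeasurable_outerNormal hΩ).aestronglyMeasurable) C ?_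
  filter_upwards [ae_mem_frontier Ω] with z hz
  refine (norm_inner_le_norm _ _).trans ?_
  refine (mul_le_of_le_one_right (norm_nonneg _) (norm_outerNormal_le Ω z)).trans (hC z hz)

lemma integrable_mul_inner_outerNormal (hΩ : IsBoundedLipschitz Ω) {g : Plane → ℝ}
    (hg : Continuous g) (v : Plane) :
    Integrable (fun z => g z * inner ℝ v (outerNormal Ω z)) (boundaryMeasure Ω) := by
  have h1 := memLp_one_iff_integrable.1 (memLp_boundary_of_continuousOn hΩ hg.continuousOn 1)
  have h2 := memLp_top_inner_outerNormal hΩ (c := fun _ => v) continuousOn_const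
  exact h1.mul_of_top_left h2

/-- The gradient theorem on a bounded Lipschitz domain. -/
theorem integral_lineDeriv_eq_boundary (hΩ : IsBoundedLipschitz Ω) {g : Plane → ℝ} {C : ℝ≥0}
    (hg : LipschitzWith C g) (hc : HasCompactSupport g) (v : Plane) :
    ∫ z in Ω, lineDeriv ℝ g z v =
      ∫ z, g z * inner ℝ v (outerNormal Ω z) ∂(boundaryMeasure Ω) := by
  have hloc : ∀ z, ∃ U : Set Plane, z ∈ closure Ω → (IsOpen U ∧ z ∈ U) ∧
      ∀ (g : Plane → ℝ) (C : ℝ≥0), LipschitzWith C g → HasCompactSupport g → tsupport g ⊆ U →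
        ∫ z in Ω, lineDeriv ℝ g z v =
          ∫ z, g z * inner ℝ v (outerNormal Ω z) ∂(boundaryMeasure Ω) := by
    intro z
    by_cases hzΩ : z ∈ Ω
    · exact ⟨Ω, fun _ => ⟨⟨hΩ.isOpen, hzΩ⟩, fun g C hg hc hU =>
        integral_lineDeriv_of_tsupport_subset hΩ.isOpen hg hc hU v⟩⟩
    · by_cases hz : z ∈ frontier Ω
      · obtain ⟨U, e, f, K, hzU, hch⟩ := hΩ.exists_chart hz
        exact ⟨U, fun _ => ⟨⟨hch.isOpen, hzU⟩, fun g C hg hc hU =>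
          hch.integral_lineDeriv hΩ.isOpen.measurableSet hg hc hU v⟩⟩
      · refine ⟨∅, fun hcl => (hz ?_).elim⟩
        rw [hΩ.isOpen.frontier_eq]; exact ⟨hcl, hzΩ⟩
  choose U hU using hloc
  obtain ⟨t, ζ, htS, hζ, hsum⟩ := exists_smooth_partition hΩ.isBounded.isCompact_closure
    (fun z hz => (hU z hz).1)
  have hlip : ∀ z ∈ t, ∃ D, LipschitzWith D fun p => ζ z p * g p := fun z hz =>
    exists_lipschitz_mul (hζ z hz).1 (hζ z hz).2.1 hg hc
  have hcs : ∀ z ∈ t, HasCompactSupport fun p => ζ z p * g p := fun z hz =>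
    (hζ z hz).2.1.mul_right
  have h1 : ∀ z ∈ t, ∫ p in Ω, lineDeriv ℝ (fun p => ζ z p * g p) p v =
      ∫ p, ζ z p * g p * inner ℝ v (outerNormal Ω p) ∂(boundaryMeasure Ω) := by
    intro z hz
    obtain ⟨D, hD⟩ := hlip z hz
    exact (hU z (htS z hz)).2 _ D hD (hcs z hz)
      ((tsupport_mul_subset_left).trans (hζ z hz).2.2.1)
  have h2 : ∫ p in Ω, lineDeriv ℝ g p v
      = ∫ p in Ω, ∑ z ∈ t, lineDeriv ℝ (fun p => ζ z p * g p) p v := by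
    refine setIntegral_congr_ae hΩ.isOpen.measurableSet ?_
    -- The products are only Lipschitz, so the derivative of their sum splits only almost
    -- everywhere. The partition sums to 1 on the open set Ω, so g and the sum agree near each of
    -- its points.
    have hae : ∀ᵐ p : Plane, ∀ z ∈ t, LineDifferentiableAt ℝ (fun p => ζ z p * g p) p v := by
      refine (Filter.eventually_all_finset t).2 fun z hz => ?_
      obtain ⟨D, hD⟩ := hlip z hz
      exact hD.ae_lineDifferentiableAt v
    filter_upwards [hae] with p hp hpΩ
    have heq : g =ᶠ[𝓝 p] fun q => ∑ z ∈ t, ζ z q * g q := by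
      filter_upwards [hΩ.isOpen.mem_nhds hpΩ] with q hq
      rw [← Finset.sum_mul, hsum q (subset_closure hq), one_mul]
    rw [heq.lineDeriv_eq]
    exact (HasDerivAt.fun_sum fun z hz => (hp z hz).hasLineDerivAt).deriv
  rw [h2, integral_finsetSum, Finset.sum_congr rfl h1, ← integral_finsetSum]
  · refine setIntegral_congr_fun isClosed_frontier.measurableSet fun p hp => ?_
    rw [← Finset.sum_mul, ← Finset.sum_mul, hsum p (frontier_subset_closure hp), one_mul]
  · intro z hz
    exact integrable_mul_inner_outerNormal hΩ ((hζ z hz).1.continuous.mul hg.continuous) v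
  · intro z hz
    obtain ⟨D, hD⟩ := hlip z hz
    exact (integrable_lineDeriv hD (hcs z hz) v).integrableOn

/-! ### Integration by parts for smooth functions and the trace inequality. -/

lemma fderiv_apply_eq_inner_gradient {ψ : Plane → ℝ} (z v : Plane) :
    fderiv ℝ ψ z v = inner ℝ (gradient ψ z) v := by
  rw [gradient, InnerProductSpace.toDual_symm_apply]

lemma continuous_gradient {ψ : Plane → ℝ} (hψ : ContDiff ℝ ∞ ψ) : Continuous (gradient ψ) :=
  (InnerProductSpace.toDual ℝ Plane).symm.continuous.comp (hψ.continuous_fderiv (by simp))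

/-- Integration by parts for a smooth and a bounded Lipschitz function. -/
theorem integral_mul_boundary (hΩ : IsBoundedLipschitz Ω) {ψ b : Plane → ℝ}
    (hψ : ContDiff ℝ ∞ ψ) {B : ℝ≥0} (hb : LipschitzWith B b) {M : ℝ} (hM : ∀ z, ‖b z‖ ≤ M)
    (v : Plane) :
    ∫ z in Ω, (fderiv ℝ ψ z v * b z + ψ z * lineDeriv ℝ b z v) =
      ∫ z, ψ z * b z * inner ℝ v (outerNormal Ω z) ∂(boundaryMeasure Ω) := by
  -- The gradient theorem asks for compact support and a global Lipschitz constant. The cutoff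
  -- provides both and is 1 near the closure of Ω.
  obtain ⟨χ, hχ, hχc, hχ1⟩ := exists_cutoff hΩ.isBounded
  have hφ : ContDiff ℝ ∞ fun z => χ z * ψ z := hχ.mul hψ
  have hφc : HasCompactSupport fun z => χ z * ψ z := hχc.mul_right
  obtain ⟨A, hA⟩ := ContDiff.exists_lipschitz hφ hφc
  obtain ⟨a, ha⟩ := hφc.exists_bound_of_continuous hA.continuous
  obtain ⟨C, hC⟩ := LipschitzWith.exists_mul_of_bounded hA hb ha hM
  have hCc : HasCompactSupport fun z => χ z * ψ z * b z := hφc.mul_right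
  have hmain := integral_lineDeriv_eq_boundary hΩ hC hCc v
  have hR : ∫ z, χ z * ψ z * b z * inner ℝ v (outerNormal Ω z) ∂(boundaryMeasure Ω)
      = ∫ z, ψ z * b z * inner ℝ v (outerNormal Ω z) ∂(boundaryMeasure Ω) := by
    refine setIntegral_congr_fun isClosed_frontier.measurableSet fun z hz => ?_
    have : χ z = 1 := (hχ1 z (frontier_subset_closure hz)).eq_of_nhds
    simp only [this, one_mul]
  rw [← hR, ← hmain]
  refine setIntegral_congr_ae hΩ.isOpen.measurableSet ?_
  filter_upwards [hb.ae_lineDifferentiableAt (μ := volume) v] with z hz hzΩ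
  have heq : (fun z => χ z * ψ z * b z) =ᶠ[𝓝 z] fun z => ψ z * b z := by
    filter_upwards [hχ1 z (subset_closure hzΩ)] with q hq
    rw [hq, Pi.one_apply, one_mul]
  rw [heq.lineDeriv_eq]
  have h1 : HasLineDerivAt ℝ ψ (fderiv ℝ ψ z v) z v :=
    ((hψ.differentiable (by simp)) z).hasFDerivAt.hasLineDerivAt v
  have h2 := hz.hasLineDerivAt
  have h3 := HasDerivAt.mul h1 h2
  simp only [zero_smul, add_zero] at h3
  exact (HasDerivAt.deriv h3).symm

lemma integral_sq_mul_boundary (hΩ : IsBoundedLipschitz Ω) {ψ b : Plane → ℝ}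
    (hψ : ContDiff ℝ ∞ ψ) {B : ℝ≥0} (hb : LipschitzWith B b) {M : ℝ} (hM : ∀ z, ‖b z‖ ≤ M)
    (v : Plane) :
    ∫ z in Ω, (2 * ψ z * inner ℝ (gradient ψ z) v * b z + ψ z ^ 2 * lineDeriv ℝ b z v) =
      ∫ z, ψ z ^ 2 * b z * inner ℝ v (outerNormal Ω z) ∂(boundaryMeasure Ω) := by
  rw [← integral_mul_boundary hΩ (hψ.pow 2) hb hM v]
  congr 1 with z
  have h := ((hψ.differentiable (by simp)) z).hasFDerivAt.pow 2
  rw [h.fderiv, ← fderiv_apply_eq_inner_gradient]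
  simp

/-- The constant field v pointing down in the chart is uniformly transversal to the boundary: v·n =
1/√(1 + f'²) ≥ 1/(1 + K). Hence ψ² ζ on Γ is at most (1 + K) times the flux of ψ² ζ v, which Green's
formula turns into an interior integral. -/
lemma IsChart.exists_trace_bound (hΩ : IsBoundedLipschitz Ω) {U : Set Plane}
    {e : Plane ≃ᵃⁱ[ℝ] Plane} {f : ℝ → ℝ} {K : ℝ≥0} (h : IsChart Ω U e f K) {ζ : Plane → ℝ}
    (hζ : ContDiff ℝ ∞ ζ) (hζc : HasCompactSupport ζ) (hζU : tsupport ζ ⊆ U)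
    (hζ0 : ∀ p, 0 ≤ ζ p) :
    ∃ C : ℝ, 0 ≤ C ∧ ∀ ψ : Plane → ℝ, ContDiff ℝ ∞ ψ →
      ∫ z, ψ z ^ 2 * ζ z ∂(boundaryMeasure Ω) ≤ C * ∫ z in Ω, (ψ z ^ 2 + ‖gradient ψ z‖ ^ 2) := by
  obtain ⟨B, hB⟩ := ContDiff.exists_lipschitz hζ hζc
  obtain ⟨M, hM⟩ := hζc.exists_bound_of_continuous hB.continuous
  have hM0 : 0 ≤ M := (norm_nonneg _).trans (hM 0)
  set v : Plane := e.linearIsometryEquiv.symm !₂[0, -1] with hv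
  have hv1 : ‖v‖ = 1 := by
    rw [hv, LinearIsometryEquiv.norm_map, EuclideanSpace.norm_eq]; simp [Fin.sum_univ_two]
  -- M bounds ζ in the term containing 2ψ∇ψ, B bounds the derivative of ζ in the term containing ψ².
  refine ⟨(1 + K) * (M + B), by positivity, fun ψ hψ => ?_⟩
  have hI : IntegrableOn (fun z => ψ z ^ 2 + ‖gradient ψ z‖ ^ 2) Ω :=
    integrableOn_of_continuous hΩ.isBounded
      ((hψ.continuous.pow 2).add ((continuous_gradient hψ).norm.pow 2))
  have h1 : ∀ᵐ z ∂(boundaryMeasure Ω),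
      ψ z ^ 2 * ζ z ≤ (1 + K) * (ψ z ^ 2 * ζ z * inner ℝ v (outerNormal Ω z)) := by
    have hloc : ∀ᵐ z ∂((boundaryMeasure Ω).restrict U),
        1 ≤ (1 + K) * inner ℝ v (outerNormal Ω z) := by
      rw [h.ae_restrict_iff]
      filter_upwards [h.lipschitz.ae_differentiableAt_real] with s hd hs
      rw [h.outerNormal_eq hs hd, inner_chartNormal, hv, LinearIsometryEquiv.apply_symm_apply]
      have hK : arcDensity f s ≤ 1 + K := by
        have h2 : |deriv f s| ≤ K := by simpa using norm_deriv_le_of_lipschitz (x₀ := s) h.lipschitz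
        rw [arcDensity, Real.sqrt_le_left (by positivity)]
        nlinarith [abs_nonneg (deriv f s), sq_abs (deriv f s), K.2]
      have hJ := arcDensity_pos f s
      simp
      rw [← div_eq_mul_inv, one_le_div hJ]
      exact hK
    rw [MeasureTheory.ae_restrict_iff' h.isOpen.measurableSet] at hloc
    filter_upwards [hloc] with z hz
    by_cases hzU : z ∈ U
    · have := mul_le_mul_of_nonneg_left (hz hzU) (mul_nonneg (sq_nonneg (ψ z)) (hζ0 z))
      linarith
    · have : ζ z = 0 := image_eq_zero_of_notMem_tsupport fun hz' => hzU (hζU hz')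
      simp [this]
  calc ∫ z, ψ z ^ 2 * ζ z ∂(boundaryMeasure Ω)
      ≤ ∫ z, (1 + K) * (ψ z ^ 2 * ζ z * inner ℝ v (outerNormal Ω z)) ∂(boundaryMeasure Ω) := by
        refine integral_mono_of_nonneg (Eventually.of_forall fun z =>
          mul_nonneg (sq_nonneg _) (hζ0 z)) (Integrable.const_mul ?_ _) h1
        exact integrable_mul_inner_outerNormal hΩ ((hψ.continuous.pow 2).mul hζ.continuous) v
    _ = (1 + K) * ∫ z in Ω, (2 * ψ z * inner ℝ (gradient ψ z) v * ζ z
          + ψ z ^ 2 * lineDeriv ℝ ζ z v) := by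
        rw [integral_const_mul, integral_sq_mul_boundary hΩ hψ hB hM v]
    _ ≤ (1 + K) * ∫ z in Ω, (M + B) * (ψ z ^ 2 + ‖gradient ψ z‖ ^ 2) := by
        refine mul_le_mul_of_nonneg_left ?_ (by positivity)
        refine (le_abs_self _).trans ((abs_integral_le_integral_abs).trans ?_)
        refine integral_mono_of_nonneg (Eventually.of_forall fun z => abs_nonneg _)
          (hI.const_mul _) (Eventually.of_forall fun z => ?_)
        have a1 : |inner ℝ (gradient ψ z) v| ≤ ‖gradient ψ z‖ := by
          have := abs_real_inner_le_norm (gradient ψ z) v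
          rwa [hv1, mul_one] at this
        have a2 : |lineDeriv ℝ ζ z v| ≤ B := by
          have := norm_lineDeriv_le_of_lipschitz ℝ (x₀ := z) (v := v) hB
          rwa [hv1, mul_one] at this
        have a3 : |ζ z| ≤ M := hM z
        have a4 : 2 * |ψ z| * ‖gradient ψ z‖ ≤ ψ z ^ 2 + ‖gradient ψ z‖ ^ 2 := by
          nlinarith [sq_nonneg (|ψ z| - ‖gradient ψ z‖), sq_abs (ψ z)]
        have a5 : (0 : ℝ) ≤ B := B.2
        calc |2 * ψ z * inner ℝ (gradient ψ z) v * ζ z + ψ z ^ 2 * lineDeriv ℝ ζ z v|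
            ≤ |2 * ψ z * inner ℝ (gradient ψ z) v * ζ z| + |ψ z ^ 2 * lineDeriv ℝ ζ z v| :=
              abs_add_le _ _
          _ = 2 * |ψ z| * |inner ℝ (gradient ψ z) v| * |ζ z|
              + ψ z ^ 2 * |lineDeriv ℝ ζ z v| := by
              simp only [abs_mul, abs_two, abs_pow, sq_abs]
          _ ≤ 2 * |ψ z| * ‖gradient ψ z‖ * M + ψ z ^ 2 * B := by gcongr
          _ ≤ (M + B) * (ψ z ^ 2 + ‖gradient ψ z‖ ^ 2) := by
              nlinarith [mul_le_mul_of_nonneg_right a4 hM0, sq_nonneg ‖gradient ψ z‖,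
                mul_nonneg a5 (sq_nonneg ‖gradient ψ z‖)]
    _ = (1 + K) * (M + B) * ∫ z in Ω, (ψ z ^ 2 + ‖gradient ψ z‖ ^ 2) := by
        rw [integral_const_mul, mul_assoc]

/-- The trace inequality for smooth functions. -/
theorem exists_trace_bound (hΩ : IsBoundedLipschitz Ω) :
    ∃ C : ℝ, 0 ≤ C ∧ ∀ ψ : Plane → ℝ, ContDiff ℝ ∞ ψ →
      ∫ z, ψ z ^ 2 ∂(boundaryMeasure Ω) ≤ C * ∫ z in Ω, (ψ z ^ 2 + ‖gradient ψ z‖ ^ 2) := by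
  have hch : ∀ z, ∃ U : Set Plane, z ∈ frontier Ω →
      (IsOpen U ∧ z ∈ U) ∧ ∃ e f K, IsChart Ω U e f K := by
    intro z
    by_cases hz : z ∈ frontier Ω
    · obtain ⟨U, e, f, K, hzU, h⟩ := hΩ.exists_chart hz
      exact ⟨U, fun _ => ⟨⟨h.isOpen, hzU⟩, e, f, K, h⟩⟩
    · exact ⟨∅, fun h => (hz h).elim⟩
  choose U hU using hch
  obtain ⟨t, ζ, htS, hζ, hsum⟩ := exists_smooth_partition (isCompact_frontier hΩ)
    fun z hz => (hU z hz).1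
  have hloc : ∀ z, ∃ C : ℝ, z ∈ t → 0 ≤ C ∧ ∀ ψ : Plane → ℝ, ContDiff ℝ ∞ ψ →
      ∫ p, ψ p ^ 2 * ζ z p ∂(boundaryMeasure Ω)
        ≤ C * ∫ p in Ω, (ψ p ^ 2 + ‖gradient ψ p‖ ^ 2) := by
    intro z
    by_cases hz : z ∈ t
    · obtain ⟨e, f, K, h⟩ := (hU z (htS z hz)).2
      obtain ⟨C, hC⟩ := h.exists_trace_bound hΩ (hζ z hz).1 (hζ z hz).2.1 (hζ z hz).2.2.1
        (hζ z hz).2.2.2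
      exact ⟨C, fun _ => hC⟩
    · exact ⟨0, fun h => (hz h).elim⟩
  choose C hC using hloc
  refine ⟨∑ z ∈ t, C z, Finset.sum_nonneg fun z hz => (hC z hz).1, fun ψ hψ => ?_⟩
  have h1 : ∫ p, ψ p ^ 2 ∂(boundaryMeasure Ω)
      = ∑ z ∈ t, ∫ p, ψ p ^ 2 * ζ z p ∂(boundaryMeasure Ω) := by
    rw [← integral_finsetSum]
    · refine setIntegral_congr_fun isClosed_frontier.measurableSet fun p hp => ?_
      simp only [← Finset.mul_sum, hsum p hp, mul_one]
    · intro z hz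
      exact memLp_one_iff_integrable.1 (memLp_boundary_of_continuousOn hΩ
        ((hψ.continuous.pow 2).mul (hζ z hz).1.continuous).continuousOn 1)
  rw [h1, Finset.sum_mul]
  exact Finset.sum_le_sum fun z hz => (hC z hz).2 ψ hψ

/-! ### Mollification with a shifted kernel. -/

section Mollify

variable {E : Type*} [NormedAddCommGroup E]

/-- Translations act continuously on L², because the exponent is finite. -/
lemma tendsto_eLpNorm_translate {F : Plane → E} (hF : MemLp F 2 volume) :
    Tendsto (fun q : Plane => eLpNorm (fun p => F (p - q) - F p) 2 volume) (𝓝 0) (𝓝 0) := by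
  have : Fact ((2 : ℝ≥0∞) ≠ ⊤) := ⟨by simp⟩
  have hcont : Continuous fun q : Plane => (DomAddAct.mk (-q) +ᵥ hF.toLp F : Lp E 2 volume) := by
    have h1 : Continuous fun q : Plane => DomAddAct.mk (-q) :=
      DomAddAct.continuous_mk.comp continuous_neg
    exact h1.vadd continuous_const
  have h0 := hcont.tendsto 0
  have h00 : (DomAddAct.mk (-(0 : Plane)) +ᵥ hF.toLp F : Lp E 2 volume) = hF.toLp F := by
    rw [neg_zero, DomAddAct.mk_zero, zero_vadd]
  rw [h00, tendsto_iff_edist_tendsto_0] at h0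
  refine h0.congr fun q => ?_
  rw [DomAddAct.mk_vadd_toLp, Lp.edist_toLp_toLp]
  congr 1
  ext1 p
  simp [sub_eq_add_neg, add_comm]

lemma eLpNorm_two_sq {α : Type*} [MeasurableSpace α] (μ : Measure α) (f : α → E) :
    eLpNorm f 2 μ ^ (2 : ℝ) = ∫⁻ a, ‖f a‖ₑ ^ (2 : ℝ) ∂μ := by
  rw [eLpNorm_eq_eLpNorm' (by simp) (by simp)]
  exact (lintegral_rpow_enorm_eq_rpow_eLpNorm' (by norm_num)).symm

variable [NormedSpace ℝ E]

/-- An average of translates is as close to `F` in `L²` as the translates are. -/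
lemma eLpNorm_average_sub_le [CompleteSpace E] {F : Plane → E} (hF : StronglyMeasurable F)
    {P : Measure Plane} [IsProbabilityMeasure P] (hinteg : ∀ p, Integrable (fun q => F (p - q)) P)
    {ε : ℝ≥0∞} (hε : ∀ᵐ q ∂P, eLpNorm (fun p => F (p - q) - F p) 2 volume ≤ ε) :
    eLpNorm (fun p => (∫ q, F (p - q) ∂P) - F p) 2 volume ≤ ε := by
  have hmeas : Measurable fun a : Plane × Plane => ‖F (a.1 - a.2) - F a.1‖ₑ ^ (2 : ℝ) :=
    (((hF.comp_measurable (measurable_fst.sub measurable_snd)).sub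
      (hF.comp_measurable measurable_fst)).enorm).pow_const _
  rw [← ENNReal.rpow_le_rpow_iff (z := 2) (by norm_num), eLpNorm_two_sq]
  calc ∫⁻ p, ‖(∫ q, F (p - q) ∂P) - F p‖ₑ ^ (2 : ℝ)
      ≤ ∫⁻ p, ∫⁻ q, ‖F (p - q) - F p‖ₑ ^ (2 : ℝ) ∂P := by
        refine lintegral_mono fun p => ?_
        have h1 : (∫ q, F (p - q) ∂P) - F p = ∫ q, (F (p - q) - F p) ∂P := by
          rw [integral_sub (hinteg p) (integrable_const _)]; simp
        have hm : AEStronglyMeasurable (fun q => F (p - q) - F p) P :=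
          (hinteg p).aestronglyMeasurable.sub aestronglyMeasurable_const
        rw [h1, ← eLpNorm_two_sq]
        -- Jensen's inequality, in the form that the L¹ norm is at most the L² norm for a
        -- probability measure; Tonelli's theorem then exchanges the averages.
        refine ENNReal.rpow_le_rpow ?_ (by norm_num)
        refine (enorm_integral_le_lintegral_enorm _).trans ?_
        rw [← eLpNorm_one_eq_lintegral_enorm]
        exact eLpNorm_le_eLpNorm_of_exponent_le (by norm_num) hm
    _ = ∫⁻ q, (∫⁻ p, ‖F (p - q) - F p‖ₑ ^ (2 : ℝ)) ∂P :=
        lintegral_lintegral_swap hmeas.aemeasurable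
    _ ≤ ∫⁻ _, ε ^ (2 : ℝ) ∂P := by
        refine lintegral_mono_ae ?_
        filter_upwards [hε] with q hq
        rw [← eLpNorm_two_sq]
        exact ENNReal.rpow_le_rpow hq (by norm_num)
    _ = ε ^ (2 : ℝ) := by simp

/-- Mollification by a normalized bump function, not necessarily centred at the origin. -/
def mollify {c : Plane} (B : ContDiffBump c) (F : Plane → E) (p : Plane) : E :=
  ∫ z, B.normed volume (p - z) • F z

lemma mollify_eq_integral_sub {c : Plane} (B : ContDiffBump c) (F : Plane → E) (p : Plane) :
    mollify B F p = ∫ q, B.normed volume q • F (p - q) := by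
  rw [mollify, ← integral_sub_left_eq_self _ volume p]
  simp

lemma integrable_normed_smul {c : Plane} (B : ContDiffBump c) {F : Plane → E} (hF : Integrable F)
    (p : Plane) : Integrable fun q => B.normed volume q • F (p - q) := by
  obtain ⟨C, hC⟩ := (B.hasCompactSupport_normed (μ := volume)).exists_bound_of_continuous
    B.continuous_normed
  exact (hF.comp_sub_left p).bdd_smul C B.continuous_normed.aestronglyMeasurable
    (Eventually.of_forall hC)

lemma eLpNorm_mollify_sub_le [CompleteSpace E] {c : Plane} (B : ContDiffBump c) {F : Plane → E}
    (hF : StronglyMeasurable F) (hFi : Integrable F) {ε : ℝ≥0∞}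
    (hε : ∀ q ∈ Metric.ball c B.rOut, eLpNorm (fun p => F (p - q) - F p) 2 volume ≤ ε) :
    eLpNorm (fun p => mollify B F p - F p) 2 volume ≤ ε := by
  set ρ : Plane → ℝ := B.normed volume with hρ
  have hρm : Measurable fun q => ENNReal.ofReal (ρ q) :=
    B.continuous_normed.measurable.ennreal_ofReal
  set P : Measure Plane := volume.withDensity fun q => ENNReal.ofReal (ρ q) with hP
  have hPp : IsProbabilityMeasure P := by
    refine ⟨?_⟩
    rw [hP, withDensity_apply _ MeasurableSet.univ, Measure.restrict_univ,
      ← ofReal_integral_eq_lintegral_ofReal B.integrable_normed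
        (Eventually.of_forall B.nonneg_normed), B.integral_normed, ENNReal.ofReal_one]
  have hsmul : ∀ p, (fun q => (ENNReal.ofReal (ρ q)).toReal • F (p - q))
      = fun q => ρ q • F (p - q) := fun p => by
    ext1 q; rw [ENNReal.toReal_ofReal (B.nonneg_normed q)]
  have hinteg : ∀ p, Integrable (fun q => F (p - q)) P := fun p => by
    rw [hP, integrable_withDensity_iff_integrable_smul' hρm
      (Eventually.of_forall fun _ => ENNReal.ofReal_lt_top), hsmul]
    exact integrable_normed_smul B hFi p
  have heq : ∀ p, mollify B F p = ∫ q, F (p - q) ∂P := fun p => by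
    rw [hP, integral_withDensity_eq_integral_toReal_smul hρm
      (Eventually.of_forall fun _ => ENNReal.ofReal_lt_top), hsmul, mollify_eq_integral_sub]
  simp only [heq]
  -- Mollification is an average of translates for the probability measure with density ρ, and only
  -- shifts in the support of ρ count.
  refine eLpNorm_average_sub_le hF hinteg ?_
  rw [hP, ae_withDensity_iff hρm]
  refine Eventually.of_forall fun q hq => hε q ?_
  rw [← B.support_normed_eq (μ := volume)]
  intro h0
  exact hq (by rw [hρ, h0, ENNReal.ofReal_zero])

lemma mollify_eq_convolution {c : Plane} (B : ContDiffBump c) (F : Plane → E) :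
    mollify B F = convolution (B.normed volume) F (ContinuousLinearMap.lsmul ℝ ℝ) volume := by
  ext1 p
  rw [mollify_eq_integral_sub, convolution_def]
  rfl

lemma contDiff_mollify {c : Plane} (B : ContDiffBump c) {F : Plane → ℝ} (hF : Integrable F) :
    ContDiff ℝ ∞ (mollify B F) := by
  rw [mollify_eq_convolution]
  exact HasCompactSupport.contDiff_convolution_left _ B.hasCompactSupport_normed B.contDiff_normed
    hF.locallyIntegrable

lemma hasCompactSupport_mollify {c : Plane} (B : ContDiffBump c) {F : Plane → ℝ}
    (hF : HasCompactSupport F) : HasCompactSupport (mollify B F) := by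
  rw [mollify_eq_convolution]
  exact B.hasCompactSupport_normed.convolution _ hF

lemma fderiv_mollify {c : Plane} (B : ContDiffBump c) {F : Plane → ℝ} (hF : Integrable F)
    (p v : Plane) :
    fderiv ℝ (mollify B F) p v = ∫ z, fderiv ℝ (B.normed volume) (p - z) v * F z := by
  have hρ : ContDiff ℝ 1 (B.normed volume) := B.contDiff_normed (n := 1)
  have h := HasCompactSupport.hasFDerivAt_convolution_left (ContinuousLinearMap.lsmul ℝ ℝ)
    (B.hasCompactSupport_normed (μ := volume)) hρ (μ := volume) hF.locallyIntegrable p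
  rw [mollify_eq_convolution, h.fderiv, convolution_def]
  have hcd := hρ.continuous_fderiv (by simp)
  obtain ⟨C, hC⟩ := ((B.hasCompactSupport_normed (μ := volume)).fderiv (𝕜 := ℝ)
    ).exists_bound_of_continuous hcd
  have hi : Integrable fun t => (ContinuousLinearMap.precompL Plane
      (ContinuousLinearMap.lsmul ℝ ℝ)) (fderiv ℝ (B.normed volume) t) (F (p - t)) := by
    refine Integrable.mono' (((hF.comp_sub_left p).norm).const_mul C) ?_ ?_
    · exact ContinuousLinearMap.aestronglyMeasurable_comp₂ _ hcd.aestronglyMeasurable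
        (hF.comp_sub_left p).aestronglyMeasurable
    · refine Eventually.of_forall fun t => ?_
      have hC0 : 0 ≤ C := (norm_nonneg _).trans (hC t)
      refine ContinuousLinearMap.opNorm_le_bound _ (by positivity) fun w => ?_
      have := (fderiv ℝ (B.normed volume) t).le_opNorm w
      simp only [ContinuousLinearMap.precompL_apply, ContinuousLinearMap.lsmul_apply,
        smul_eq_mul, norm_mul]
      calc ‖fderiv ℝ (B.normed volume) t w‖ * ‖F (p - t)‖ ≤ (C * ‖w‖) * ‖F (p - t)‖ := by
            gcongr
            exact this.trans (by gcongr; exact hC t)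
        _ = C * ‖F (p - t)‖ * ‖w‖ := by ring
  rw [ContinuousLinearMap.integral_apply hi, ← integral_sub_left_eq_self _ volume p]
  simp

end Mollify

/-! ### Density of functions smooth up to the boundary. -/

/-- Every point of the closure has a neighbourhood `U` and a direction `ν` such that the cone around
`ν` with vertex at a point of `Ω ∩ U` stays in `Ω` as long as it stays in `U`. -/
lemma IsBoundedLipschitz.exists_cone (hΩ : IsBoundedLipschitz Ω) {z : Plane}
    (hz : z ∈ closure Ω) :
    ∃ (U : Set Plane) (ν : Plane) (δ : ℝ), (IsOpen U ∧ z ∈ U) ∧ 0 < δ ∧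
      ∀ p ∈ U, p ∈ Ω → ∀ q ∈ U, ∀ t : ℝ, 0 < t → ‖q - p - t • ν‖ ≤ δ * t → q ∈ Ω := by
  by_cases hzΩ : z ∈ Ω
  · exact ⟨Ω, 0, 1, ⟨hΩ.isOpen, hzΩ⟩, one_pos, fun p _ _ q hq _ _ _ => hq⟩
  have hfr : z ∈ frontier Ω := by rw [hΩ.isOpen.frontier_eq]; exact ⟨hz, hzΩ⟩
  obtain ⟨U, e, f, K, hzU, h⟩ := hΩ.exists_chart hfr
  have hK : (0 : ℝ) ≤ K := K.2
  have hK2 : (0 : ℝ) < 2 + K := by positivity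
  -- With δ = 1/(2 + K), the graph rises by at most Kδt while the point rises by at least (1 - δ)t,
  -- and (1 + K)δ < 1.
  refine ⟨U, e.linearIsometryEquiv.symm !₂[0, 1], (2 + (K : ℝ))⁻¹, ⟨h.isOpen, hzU⟩, by positivity,
    fun p hpU hp q hqU t ht hq => ?_⟩
  rw [h.mem_iff p hpU] at hp
  rw [h.mem_iff q hqU]
  set w : Plane := e.linearIsometryEquiv (q - p - t • e.linearIsometryEquiv.symm !₂[0, 1]) with hw
  have hwn : ‖w‖ ≤ (2 + (K : ℝ))⁻¹ * t := by rwa [hw, LinearIsometryEquiv.norm_map]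
  have hL : e.linearIsometryEquiv (q - p) = e q - e p := e.map_vsub q p
  have hwe : w = e q - e p - t • !₂[0, 1] := by
    rw [hw, map_sub, map_smul, LinearIsometryEquiv.apply_symm_apply, hL]
  have h0 : |e q 0 - e p 0| ≤ (2 + (K : ℝ))⁻¹ * t := by
    have := (PiLp.norm_apply_le w 0).trans hwn
    simpa [hwe] using this
  have h1 : |e q 1 - e p 1 - t| ≤ (2 + (K : ℝ))⁻¹ * t := by
    have := (PiLp.norm_apply_le w 1).trans hwn
    simpa [hwe] using this
  have h2 := h.lipschitz.dist_le_mul (e q 0) (e p 0)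
  rw [Real.dist_eq, Real.dist_eq] at h2
  have h3 := (abs_le.1 h2).2
  have h4 := (abs_le.1 h1).1
  have h5 := mul_le_mul_of_nonneg_left h0 hK
  have h6 : (2 + (K : ℝ))⁻¹ * t * (2 + K) = t := by field_simp
  have h7 : 0 < (2 + (K : ℝ))⁻¹ * t := by positivity
  nlinarith

/-- Local smooth approximation in `H¹`. -/
lemma exists_local_approx (hΩ : IsBoundedLipschitz Ω) {x : Plane → ℝ} {G : Plane → Plane}
    (hxm : StronglyMeasurable x) (hx : MemLp x 2 (volume.restrict Ω))
    (hGm : StronglyMeasurable G) (hG : MemLp G 2 (volume.restrict Ω)) (hxG : IsWeakGrad Ω x G)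
    {U : Set Plane} {ν : Plane} {δ : ℝ} (hU : IsOpen U) (hδ : 0 < δ)
    (hcone : ∀ p ∈ U, p ∈ Ω → ∀ q ∈ U, ∀ t : ℝ, 0 < t → ‖q - p - t • ν‖ ≤ δ * t → q ∈ Ω)
    {ζ : Plane → ℝ} (hζ : ContDiff ℝ ∞ ζ) (hζc : HasCompactSupport ζ) (hζU : tsupport ζ ⊆ U) :
    ∃ ψ : ℕ → Plane → ℝ, (∀ k, ContDiff ℝ ∞ (ψ k) ∧ HasCompactSupport (ψ k)) ∧
      Tendsto (fun k => eLpNorm (fun z => ψ k z - ζ z * x z) 2 (volume.restrict Ω)) atTop (𝓝 0) ∧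
      Tendsto (fun k => eLpNorm (fun z => gradient (ψ k) z - (x z • gradient ζ z + ζ z • G z)) 2
        (volume.restrict Ω)) atTop (𝓝 0) := by
  have hΩm := hΩ.isOpen.measurableSet
  have hfinΩ : IsFiniteMeasure (volume.restrict Ω) :=
    ⟨by simpa using hΩ.isBounded.measure_lt_top⟩
  -- boundedness of the cutoff
  obtain ⟨M, hM⟩ := hζc.exists_bound_of_continuous hζ.continuous
  have hgc := continuous_gradient hζ
  have hζd : HasCompactSupport (gradient ζ) :=
    (hζc.fderiv (𝕜 := ℝ)).comp_left (g := (InnerProductSpace.toDual ℝ Plane).symm) (map_zero _)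
  obtain ⟨M', hM'⟩ := hζd.exists_bound_of_continuous hgc
  set F₀ : Plane → ℝ := fun z => ζ z * x z with hF₀
  set H₀ : Plane → Plane := fun z => x z • gradient ζ z + ζ z • G z with hH₀
  have hF₀m : StronglyMeasurable F₀ := hζ.continuous.stronglyMeasurable.mul hxm
  have hH₀m : StronglyMeasurable H₀ :=
    (hxm.smul hgc.stronglyMeasurable).add (hζ.continuous.stronglyMeasurable.smul hGm)
  have hζtop : MemLp ζ ⊤ (volume.restrict Ω) :=
    memLp_top_of_bound hζ.continuous.aestronglyMeasurable M (Eventually.of_forall hM)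
  have hgtop : MemLp (gradient ζ) ⊤ (volume.restrict Ω) :=
    memLp_top_of_bound hgc.aestronglyMeasurable M' (Eventually.of_forall hM')
  have hF₀2 : MemLp F₀ 2 (volume.restrict Ω) := hx.mul hζtop
  have hH₀2 : MemLp H₀ 2 (volume.restrict Ω) := (hgtop.smul hx).add (hG.smul hζtop)
  -- Extension by zero. H is in general not a weak gradient of F across Γ; the shifted kernels make
  -- this harmless at points of Ω.
  set F : Plane → ℝ := Ω.indicator F₀ with hF
  set H : Plane → Plane := Ω.indicator H₀ with hH
  have hFm : StronglyMeasurable F := hF₀m.indicator hΩm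
  have hHm : StronglyMeasurable H := hH₀m.indicator hΩm
  have hF2 : MemLp F 2 volume := (memLp_indicator_iff_restrict hΩm).2 hF₀2
  have hH2 : MemLp H 2 volume := (memLp_indicator_iff_restrict hΩm).2 hH₀2
  have hF1 : Integrable F := (integrable_indicator_iff hΩm).2 (hF₀2.integrable (by norm_num))
  have hH1 : Integrable H := (integrable_indicator_iff hΩm).2 (hH₀2.integrable (by norm_num))
  have hFc : HasCompactSupport F := by
    refine HasCompactSupport.of_support_subset_isCompact hζc fun z hz => ?_
    refine subset_tsupport ζ fun h0 => hz ?_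
    exact indicator_apply_eq_zero.2 fun _ => by simp [hF₀, h0]
  -- the scale
  obtain ⟨ε₀, hε₀, hthick⟩ := IsCompact.exists_thickening_subset_open hζc hU hζU
  -- Every shift in the support of the kernel has norm at most τ(‖ν‖ + δ) < ε₀, so a point whose
  -- average meets the support of ζ still lies in U.
  set τ₀ : ℝ := ε₀ / (‖ν‖ + δ + 1) with hτ₀
  have hden : 0 < ‖ν‖ + δ + 1 := by positivity
  have hτpos : 0 < τ₀ := by positivity
  set τ : ℕ → ℝ := fun k => τ₀ * (1 / ((k : ℝ) + 1)) with hτ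
  have hτk : ∀ k, 0 < τ k := fun k => by positivity
  have hτle : ∀ k, τ k * (‖ν‖ + δ) < ε₀ := fun k => by
    have h1 : τ k ≤ τ₀ := mul_le_of_le_one_right hτpos.le (by
      rw [div_le_one (by positivity)]; linarith [k.cast_nonneg (α := ℝ)])
    have h2 : τ₀ * (‖ν‖ + δ + 1) = ε₀ := div_mul_cancel₀ _ hden.ne'
    have h3 : 0 ≤ ‖ν‖ + δ := by positivity
    nlinarith [mul_le_mul_of_nonneg_right h1 h3]
  have hτlim : Tendsto τ atTop (𝓝 0) := by
    rw [← mul_zero τ₀]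
    exact (tendsto_one_div_add_atTop_nhds_zero_nat (𝕜 := ℝ)).const_mul τ₀
  -- The value at p is an average of F over points within δτ of p + τν, that is, over points of the
  -- cone with vertex p.
  let B : ∀ k : ℕ, ContDiffBump (-(τ k • ν)) := fun k =>
    ⟨δ * τ k / 2, δ * τ k, by have := hτk k; positivity, by
      have := mul_pos hδ (hτk k); linarith⟩
  have hball : ∀ k, ∀ q ∈ Metric.closedBall (-(τ k • ν)) (δ * τ k), ‖q‖ ≤ τ k * (‖ν‖ + δ) := by
    intro k q hq
    rw [Metric.mem_closedBall, dist_eq_norm, sub_neg_eq_add] at hq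
    have h1 : q = (q + τ k • ν) - τ k • ν := by abel
    rw [h1]
    refine (norm_sub_le _ _).trans ?_
    rw [norm_smul, Real.norm_eq_abs, abs_of_pos (hτk k)]
    linarith
  have hconv : ∀ {E : Type} [NormedAddCommGroup E] [NormedSpace ℝ E] [CompleteSpace E]
      (f : Plane → E), StronglyMeasurable f → Integrable f → MemLp f 2 volume →
      Tendsto (fun k => eLpNorm (fun p => mollify (B k) f p - f p) 2 volume) atTop (𝓝 0) := by
    intro E _ _ _ f hfm hfi hf2
    rw [ENNReal.tendsto_nhds_zero]
    intro ε hε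
    have h1 := (ENNReal.tendsto_nhds_zero.1 (tendsto_eLpNorm_translate hf2)) ε hε
    obtain ⟨r, hr, hball'⟩ := Metric.eventually_nhds_iff.1 h1
    have h2 : Tendsto (fun k => τ k * (‖ν‖ + δ)) atTop (𝓝 0) := by
      simpa using hτlim.mul_const (‖ν‖ + δ)
    filter_upwards [h2.eventually (gt_mem_nhds hr)] with k hk
    refine eLpNorm_mollify_sub_le (B k) hfm hfi fun q hq => hball' ?_
    rw [dist_zero_right]
    exact (hball k q (Metric.ball_subset_closedBall hq)).trans_lt hk
  -- the derivative of the mollification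
  have hgrad : ∀ k, ∀ p ∈ Ω, gradient (mollify (B k) F) p = mollify (B k) H p := by
    intro k p hp
    set ρ : Plane → ℝ := (B k).normed volume with hρ
    have hρs : ContDiff ℝ ∞ ρ := (B k).contDiff_normed
    have hρt : tsupport ρ = Metric.closedBall (-(τ k • ν)) (δ * τ k) := (B k).tsupport_normed_eq
    have hρp : ContDiff ℝ ∞ fun z => ρ (p - z) := hρs.comp (contDiff_const.sub contDiff_id)
    have hdρ : ∀ z v, fderiv ℝ (fun z => ρ (p - z)) z v = -fderiv ℝ ρ (p - z) v := by
      intro z v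
      have h1 : HasFDerivAt ρ (fderiv ℝ ρ (p - z)) (p - z) :=
        ((hρs.differentiable (by simp)) (p - z)).hasFDerivAt
      have h2 : HasFDerivAt (fun z : Plane => p - z) (-ContinuousLinearMap.id ℝ Plane) z :=
        (hasFDerivAt_id z).const_sub p
      have h3 := h1.comp z h2
      have h4 : fderiv ℝ (fun z => ρ (p - z)) z
          = (fderiv ℝ ρ (p - z)).comp (-ContinuousLinearMap.id ℝ Plane) := h3.fderiv
      rw [h4]; simp
    -- This is the purpose of the shift: for p in Ω the cone property places the support of the
    -- product inside Ω. Testing the weak gradient with it and applying the product rule yields the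
    -- gradient of the mollification.
    have htest : IsTest Ω fun z => ζ z * ρ (p - z) := by
      refine ⟨hζ.mul hρp, hζc.mul_right, fun z hz => ?_⟩
      have hz1 : z ∈ tsupport ζ := tsupport_mul_subset_left hz
      have hz2 : p - z ∈ tsupport ρ := by
        have h1 : z ∈ tsupport fun z => ρ (p - z) := tsupport_mul_subset_right hz
        exact tsupport_comp_subset_preimage ρ (f := fun z => p - z) (by fun_prop) h1
      have hz3 := hz2
      rw [hρt] at hz2
      have hnorm := hball k _ hz2
      have hpU : p ∈ U := by
        refine hthick (Metric.mem_thickening_iff.2 ⟨z, hz1, ?_⟩)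
        rw [dist_eq_norm]
        exact hnorm.trans_lt (hτle k)
      refine hcone p hpU hp z (hζU hz1) (τ k) (hτk k) ?_
      rw [Metric.mem_closedBall, dist_eq_norm] at hz2
      have hneg : -(z - p - τ k • ν) = p - z - -(τ k • ν) := by abel
      rwa [← norm_neg, hneg]
    refine ext_inner_right ℝ fun v => ?_
    rw [← fderiv_apply_eq_inner_gradient, fderiv_mollify _ hF1]
    have hρb : ∃ C, ∀ z, ‖ρ z‖ ≤ C :=
      ((B k).hasCompactSupport_normed (μ := volume)).exists_bound_of_continuous hρs.continuous
    obtain ⟨C, hC⟩ := hρb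
    have hiH : Integrable fun z => ρ (p - z) • H z :=
      hH1.bdd_smul C hρp.continuous.aestronglyMeasurable (Eventually.of_forall fun z => hC _)
    have hweak := hxG.2.2 _ htest v
    have hdθ : ∀ z, fderiv ℝ (fun z => ζ z * ρ (p - z)) z v
        = inner ℝ (gradient ζ z) v * ρ (p - z) - ζ z * fderiv ℝ ρ (p - z) v := by
      intro z
      have h1 := ((hζ.differentiable (by simp)) z).hasFDerivAt.mul
        ((hρp.differentiable (by simp)) z).hasFDerivAt
      have h2 : fderiv ℝ (fun z => ζ z * ρ (p - z)) z
        = ζ z • fderiv ℝ (fun z => ρ (p - z)) z + ρ (p - z) • fderiv ℝ ζ z := h1.fderiv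
      rw [h2, ← fderiv_apply_eq_inner_gradient]
      simp only [add_apply, smul_apply, hdρ, smul_eq_mul]
      ring
    have hrhs : inner ℝ (mollify (B k) H p) v = ∫ z in Ω, ρ (p - z) * inner ℝ (H₀ z) v := by
      rw [mollify, real_inner_comm, ← integral_inner hiH, ← integral_indicator hΩm]
      congr 1
      ext1 z
      rw [real_inner_smul_right, real_inner_comm]
      by_cases hz : z ∈ Ω
      · rw [indicator_of_mem hz, hH, indicator_of_mem hz]
      · rw [indicator_of_notMem hz, hH, indicator_of_notMem hz, inner_zero_left, mul_zero]
    have hlhs : ∫ z, fderiv ℝ ρ (p - z) v * F z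
        = ∫ z in Ω, fderiv ℝ ρ (p - z) v * F₀ z := by
      rw [← integral_indicator hΩm]
      congr 1
      ext1 z
      by_cases hz : z ∈ Ω
      · rw [indicator_of_mem hz, hF, indicator_of_mem hz]
      · rw [indicator_of_notMem hz, hF, indicator_of_notMem hz, mul_zero]
    have hxi : IntegrableOn x Ω := hx.integrable (by norm_num)
    have hGi : IntegrableOn G Ω := hG.integrable (by norm_num)
    have hi1 : IntegrableOn (fun z => x z * fderiv ℝ (fun z => ζ z * ρ (p - z)) z v) Ω := by
      have hθc := (htest.1.continuous_fderiv (by simp)).clm_apply (continuous_const (y := v))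
      obtain ⟨D, hD⟩ := (htest.2.1.fderiv_apply (𝕜 := ℝ) v).exists_bound_of_continuous hθc
      exact hxi.mul_bdd (c := D) hθc.aestronglyMeasurable (Eventually.of_forall hD)
    have hi2 : IntegrableOn (fun z => inner ℝ (G z) v * (ζ z * ρ (p - z))) Ω := by
      obtain ⟨D, hD⟩ := htest.2.1.exists_bound_of_continuous htest.1.continuous
      exact (hGi.inner_const v).mul_bdd (c := D) htest.1.continuous.aestronglyMeasurable
        (Eventually.of_forall hD)
    rw [hrhs, hlhs]
    have h0 : ∫ z in Ω, (x z * fderiv ℝ (fun z => ζ z * ρ (p - z)) z v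
        + inner ℝ (G z) v * (ζ z * ρ (p - z))) = 0 := by
      rw [integral_add hi1 hi2, hweak]; ring
    have hi3 : IntegrableOn (fun z => ρ (p - z) * inner ℝ (H₀ z) v) Ω :=
      ((hH₀2.integrable (by norm_num)).inner_const v).bdd_mul (c := C)
        hρp.continuous.aestronglyMeasurable (Eventually.of_forall fun z => hC _)
    rw [← sub_zero (∫ z in Ω, ρ (p - z) * inner ℝ (H₀ z) v), ← h0]
    refine Eq.trans ?_ (integral_sub hi3 (hi1.add hi2))
    congr 1
    ext1 z
    rw [hH₀, hF₀]
    simp only [inner_add_left, real_inner_smul_left, hdθ]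
    ring
  refine ⟨fun k => mollify (B k) F, fun k => ⟨contDiff_mollify _ hF1,
    hasCompactSupport_mollify _ hFc⟩, ?_, ?_⟩
  · refine tendsto_of_tendsto_of_tendsto_of_le_of_le tendsto_const_nhds (hconv F hFm hF1 hF2)
      (fun _ => zero_le) fun k => ?_
    calc eLpNorm (fun z => mollify (B k) F z - F₀ z) 2 (volume.restrict Ω)
        = eLpNorm (fun z => mollify (B k) F z - F z) 2 (volume.restrict Ω) := by
          refine eLpNorm_congr_ae ?_
          filter_upwards [ae_restrict_mem hΩm] with z hz
          rw [hF, indicator_of_mem hz]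
      _ ≤ _ := eLpNorm_mono_measure _ Measure.restrict_le_self
  · refine tendsto_of_tendsto_of_tendsto_of_le_of_le tendsto_const_nhds (hconv H hHm hH1 hH2)
      (fun _ => zero_le) fun k => ?_
    calc eLpNorm (fun z => gradient (mollify (B k) F) z - H₀ z) 2 (volume.restrict Ω)
        = eLpNorm (fun z => mollify (B k) H z - H z) 2 (volume.restrict Ω) := by
          refine eLpNorm_congr_ae ?_
          filter_upwards [ae_restrict_mem hΩm] with z hz
          rw [hgrad k z hz, hH, indicator_of_mem hz]
      _ ≤ _ := eLpNorm_mono_measure _ Measure.restrict_le_self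

lemma isFiniteMeasure_restrict (hΩ : IsBoundedLipschitz Ω) :
    IsFiniteMeasure (volume.restrict Ω : Measure Plane) :=
  ⟨by simpa using hΩ.isBounded.measure_lt_top⟩

lemma memLp_restrict_of_continuous (hΩ : IsBoundedLipschitz Ω) {E : Type*} [NormedAddCommGroup E]
    [SecondCountableTopology E] {g : Plane → E} (hg : Continuous g) (p : ℝ≥0∞) :
    MemLp g p (volume.restrict Ω) := by
  have := isFiniteMeasure_restrict hΩ
  obtain ⟨C, hC⟩ := hΩ.isBounded.isCompact_closure.exists_bound_of_continuousOn hg.continuousOn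
  refine MemLp.of_bound hg.aestronglyMeasurable C ?_
  filter_upwards [ae_restrict_mem hΩ.isOpen.measurableSet] with z hz using hC z (subset_closure hz)

lemma IsWeakGrad.congr_ae (hΩ : IsBoundedLipschitz Ω) {x y : Plane → ℝ} {G H : Plane → Plane}
    (h : IsWeakGrad Ω x G) (hy : MemLp y 2 (volume.restrict Ω)) (hH : MemLp H 2 (volume.restrict Ω))
    (hxy : x =ᵐ[volume.restrict Ω] y) (hGH : G =ᵐ[volume.restrict Ω] H) : IsWeakGrad Ω y H := by
  have := isFiniteMeasure_restrict hΩ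
  have hyi : IntegrableOn y Ω := hy.integrable (by norm_num)
  have hHi : IntegrableOn H Ω := hH.integrable (by norm_num)
  refine ⟨hyi.locallyIntegrableOn, hHi.locallyIntegrableOn, fun ψ hψ v => ?_⟩
  have h1 : ∫ z in Ω, y z * fderiv ℝ ψ z v = ∫ z in Ω, x z * fderiv ℝ ψ z v :=
    integral_congr_ae (by filter_upwards [hxy] with z hz; rw [hz])
  have h2 : ∫ z in Ω, inner ℝ (H z) v * ψ z = ∫ z in Ω, inner ℝ (G z) v * ψ z :=
    integral_congr_ae (by filter_upwards [hGH] with z hz; rw [hz])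
  rw [h1, h2]
  exact h.2.2 ψ hψ v

lemma tendsto_eLpNorm_finsetSum {α ι E : Type*} [MeasurableSpace α] [NormedAddCommGroup E]
    {μ : Measure α} {t : Finset ι} {f : ι → ℕ → α → E}
    (hm : ∀ i ∈ t, ∀ k, AEStronglyMeasurable (f i k) μ)
    (h : ∀ i ∈ t, Tendsto (fun k => eLpNorm (f i k) 2 μ) atTop (𝓝 0)) :
    Tendsto (fun k => eLpNorm (∑ i ∈ t, f i k) 2 μ) atTop (𝓝 0) := by
  have h1 : Tendsto (fun k => ∑ i ∈ t, eLpNorm (f i k) 2 μ) atTop (𝓝 0) := by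
    simpa using tendsto_finsetSum t h
  exact tendsto_of_tendsto_of_tendsto_of_le_of_le tendsto_const_nhds h1 (fun _ => zero_le)
    fun k => eLpNorm_sum_le (fun i hi => hm i hi k) (by norm_num)

lemma gradient_finsetSum {ι : Type*} {t : Finset ι} {f : ι → Plane → ℝ} {z : Plane}
    (h : ∀ i ∈ t, DifferentiableAt ℝ (f i) z) :
    gradient (fun p => ∑ i ∈ t, f i p) z = ∑ i ∈ t, gradient (f i) z := by
  have h1 := (HasFDerivAt.fun_sum fun i hi => (h i hi).hasFDerivAt).fderiv
  simp only [gradient, h1, map_sum]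

/-- Functions that are smooth up to the boundary are dense in `H¹`. -/
theorem exists_smooth_approx (hΩ : IsBoundedLipschitz Ω) {x : Plane → ℝ} {G : Plane → Plane}
    (hx : MemLp x 2 (volume.restrict Ω)) (hG : MemLp G 2 (volume.restrict Ω))
    (hxG : IsWeakGrad Ω x G) :
    ∃ ψ : ℕ → Plane → ℝ, (∀ k, ContDiff ℝ ∞ (ψ k)) ∧
      Tendsto (fun k => eLpNorm (fun z => ψ k z - x z) 2 (volume.restrict Ω)) atTop (𝓝 0) ∧
      Tendsto (fun k => eLpNorm (fun z => gradient (ψ k) z - G z) 2 (volume.restrict Ω))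
        atTop (𝓝 0) := by
  have hΩm := hΩ.isOpen.measurableSet
  -- Strongly measurable representatives are needed for Tonelli's theorem in the mollification
  -- estimate.
  obtain ⟨x', hx'm, hxx'⟩ := hx.1
  obtain ⟨G', hG'm, hGG'⟩ := hG.1
  have hx' : MemLp x' 2 (volume.restrict Ω) := hx.ae_eq hxx'
  have hG' : MemLp G' 2 (volume.restrict Ω) := hG.ae_eq hGG'
  have hxG' : IsWeakGrad Ω x' G' := hxG.congr_ae hΩ hx' hG' hxx' hGG'
  have hcone : ∀ z, ∃ U : Set Plane, z ∈ closure Ω → (IsOpen U ∧ z ∈ U) ∧ ∃ (ν : Plane) (δ : ℝ),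
      0 < δ ∧ ∀ p ∈ U, p ∈ Ω → ∀ q ∈ U, ∀ t : ℝ, 0 < t → ‖q - p - t • ν‖ ≤ δ * t → q ∈ Ω := by
    intro z
    by_cases hz : z ∈ closure Ω
    · obtain ⟨U, ν, δ, hU, h⟩ := hΩ.exists_cone hz
      exact ⟨U, fun _ => ⟨hU, ν, δ, h⟩⟩
    · exact ⟨∅, fun h => (hz h).elim⟩
  choose U hU using hcone
  obtain ⟨t, ζ, htS, hζ, hsum⟩ := exists_smooth_partition hΩ.isBounded.isCompact_closure
    fun z hz => (hU z hz).1
  have hloc : ∀ w, ∃ ψ : ℕ → Plane → ℝ, w ∈ t → (∀ k, ContDiff ℝ ∞ (ψ k)) ∧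
      Tendsto (fun k => eLpNorm (fun z => ψ k z - ζ w z * x' z) 2 (volume.restrict Ω))
        atTop (𝓝 0) ∧
      Tendsto (fun k => eLpNorm (fun z => gradient (ψ k) z
        - (x' z • gradient (ζ w) z + ζ w z • G' z)) 2 (volume.restrict Ω)) atTop (𝓝 0) := by
    intro w
    by_cases hw : w ∈ t
    · obtain ⟨hUw, ν, δ, hδ, hc⟩ := hU w (htS w hw)
      obtain ⟨ψ, h1, h2, h3⟩ := exists_local_approx hΩ hx'm hx' hG'm hG' hxG' hUw.1 hδ hc
        (hζ w hw).1 (hζ w hw).2.1 (hζ w hw).2.2.1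
      exact ⟨ψ, fun _ => ⟨fun k => (h1 k).1, h2, h3⟩⟩
    · exact ⟨fun _ _ => 0, fun h => (hw h).elim⟩
  choose ψ hψ using hloc
  refine ⟨fun k z => ∑ w ∈ t, ψ w k z, fun k => ContDiff.sum fun w hw => (hψ w hw).1 k, ?_, ?_⟩
  · refine (tendsto_eLpNorm_finsetSum (f := fun w k z => ψ w k z - ζ w z * x' z) ?_
      fun w hw => (hψ w hw).2.1).congr fun k => eLpNorm_congr_ae ?_
    · intro w hw k
      exact ((hψ w hw).1 k).continuous.aestronglyMeasurable.sub
        ((hζ w hw).1.continuous.aestronglyMeasurable.mul hx'm.aestronglyMeasurable)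
    · filter_upwards [hxx', ae_restrict_mem hΩm] with z hz hzΩ
      rw [Finset.sum_apply, Finset.sum_sub_distrib, ← Finset.sum_mul,
        hsum z (subset_closure hzΩ), one_mul, hz]
  · refine (tendsto_eLpNorm_finsetSum (f := fun w k z => gradient (ψ w k) z
      - (x' z • gradient (ζ w) z + ζ w z • G' z)) ?_
      fun w hw => (hψ w hw).2.2).congr fun k => eLpNorm_congr_ae ?_
    · intro w hw k
      exact (continuous_gradient ((hψ w hw).1 k)).aestronglyMeasurable.sub
        ((hx'm.aestronglyMeasurable.smul
          (continuous_gradient (hζ w hw).1).aestronglyMeasurable).add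
        ((hζ w hw).1.continuous.aestronglyMeasurable.smul hG'm.aestronglyMeasurable))
    · filter_upwards [hGG', ae_restrict_mem hΩm] with z hz hzΩ
      -- The terms x ∇ζ of the local gradients cancel because the partition sums to a constant.
      have h1 : gradient (fun p => ∑ w ∈ t, ζ w p) z = 0 := by
        have : (fun p => ∑ w ∈ t, ζ w p) =ᶠ[𝓝 z] fun _ => 1 := by
          filter_upwards [hΩ.isOpen.mem_nhds hzΩ] with p hp using hsum p (subset_closure hp)
        rw [gradient, this.fderiv_eq]
        simp
      rw [gradient_finsetSum fun w hw => ((hζ w hw).1.differentiable (by simp)) z] at h1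
      rw [gradient_finsetSum fun w hw => (((hψ w hw).1 k).differentiable (by simp)) z,
        Finset.sum_apply, Finset.sum_sub_distrib, Finset.sum_add_distrib, ← Finset.smul_sum, h1,
        ← Finset.sum_smul, hsum z (subset_closure hzΩ), one_smul, smul_zero, zero_add, hz]

/-! ### Existence of traces. -/

lemma eLpNorm_two_sq_eq_ofReal {α E : Type*} [MeasurableSpace α] [NormedAddCommGroup E]
    {μ : Measure α} {f : α → E} (hf : MemLp f 2 μ) :
    eLpNorm f 2 μ ^ (2 : ℝ) = ENNReal.ofReal (∫ a, ‖f a‖ ^ 2 ∂μ) := by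
  rw [eLpNorm_two_sq, ofReal_integral_eq_lintegral_ofReal
    ((memLp_two_iff_integrable_sq_norm hf.1).1 hf) (Eventually.of_forall fun a => sq_nonneg _)]
  refine lintegral_congr fun a => ?_
  rw [← ofReal_norm, ENNReal.ofReal_rpow_of_nonneg (norm_nonneg _) (by norm_num)]
  norm_num

lemma exists_eLpNorm_trace_bound (hΩ : IsBoundedLipschitz Ω) :
    ∃ C : ℝ≥0∞, C ≠ ⊤ ∧ ∀ ψ : Plane → ℝ, ContDiff ℝ ∞ ψ →
      eLpNorm ψ 2 (boundaryMeasure Ω) ^ (2 : ℝ) ≤ C * (eLpNorm ψ 2 (volume.restrict Ω) ^ (2 : ℝ)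
        + eLpNorm (gradient ψ) 2 (volume.restrict Ω) ^ (2 : ℝ)) := by
  obtain ⟨C, hC0, hC⟩ := exists_trace_bound hΩ
  refine ⟨ENNReal.ofReal C, ENNReal.ofReal_ne_top, fun ψ hψ => ?_⟩
  have h1 := memLp_restrict_of_continuous hΩ hψ.continuous 2
  have h2 := memLp_restrict_of_continuous hΩ (continuous_gradient hψ) 2
  have h3 := memLp_boundary_of_continuousOn hΩ hψ.continuous.continuousOn 2
  rw [eLpNorm_two_sq_eq_ofReal h1, eLpNorm_two_sq_eq_ofReal h2, eLpNorm_two_sq_eq_ofReal h3,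
    ← ENNReal.ofReal_add (integral_nonneg fun _ => sq_nonneg _)
      (integral_nonneg fun _ => sq_nonneg _),
    ← integral_add ((memLp_two_iff_integrable_sq_norm h1.1).1 h1)
      ((memLp_two_iff_integrable_sq_norm h2.1).1 h2), ← ENNReal.ofReal_mul hC0]
  refine ENNReal.ofReal_le_ofReal ?_
  simpa only [Real.norm_eq_abs, sq_abs] using hC ψ hψ

lemma tendsto_eLpNorm_sub_sub {α E : Type*} [MeasurableSpace α] [NormedAddCommGroup E]
    {μ : Measure α} {f : ℕ → α → E} {g : α → E} (hf : ∀ k, AEStronglyMeasurable (f k) μ)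
    (hg : AEStronglyMeasurable g μ)
    (h : Tendsto (fun k => eLpNorm (fun a => f k a - g a) 2 μ) atTop (𝓝 0)) :
    Tendsto (fun n : ℕ × ℕ => eLpNorm (fun a => f n.1 a - f n.2 a) 2 μ) atTop (𝓝 0) := by
  have h1 : Tendsto (fun n : ℕ × ℕ => eLpNorm (fun a => f n.1 a - g a) 2 μ
      + eLpNorm (fun a => f n.2 a - g a) 2 μ) atTop (𝓝 0) := by
    rw [← prod_atTop_atTop_eq]
    simpa using (h.comp tendsto_fst).add (h.comp tendsto_snd)
  refine tendsto_of_tendsto_of_tendsto_of_le_of_le tendsto_const_nhds h1 (fun _ => zero_le)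
    fun n => ?_
  have h2 : (fun a => f n.1 a - f n.2 a)
      = (fun a => f n.1 a - g a) - fun a => f n.2 a - g a := by ext a; simp
  simp only [h2]
  exact eLpNorm_sub_le ((hf _).sub hg) ((hf _).sub hg) (by norm_num)

/-- Existence of the trace of an `H¹` function. -/
theorem exists_isTrace (hΩ : IsBoundedLipschitz Ω) {x : Plane → ℝ} (hx : MemH1 Ω x) :
    ∃ g, IsTrace Ω x g := by
  obtain ⟨hx2, G, hxG, hG⟩ := hx
  obtain ⟨ψ, hψ, h1, h2⟩ := exists_smooth_approx hΩ hx2 hG hxG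
  obtain ⟨C, hC, hbound⟩ := exists_eLpNorm_trace_bound hΩ
  have hmem : ∀ k, MemLp (ψ k) 2 (boundaryMeasure Ω) := fun k =>
    memLp_boundary_of_continuousOn hΩ (hψ k).continuous.continuousOn 2
  have c1 := tendsto_eLpNorm_sub_sub (fun k => (hψ k).continuous.aestronglyMeasurable) hx2.1 h1
  have c2 := tendsto_eLpNorm_sub_sub (fun k => (continuous_gradient (hψ k)).aestronglyMeasurable)
    hG.1 h2
  -- The trace inequality is applied to differences of approximants: Cauchy in H¹ implies Cauchy in
  -- L²(Γ), which is complete.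
  have c3 : Tendsto (fun n : ℕ × ℕ => eLpNorm (fun a => ψ n.1 a - ψ n.2 a) 2 (boundaryMeasure Ω)
      ^ (2 : ℝ)) atTop (𝓝 0) := by
    have hpow : ∀ {u : ℕ × ℕ → ℝ≥0∞}, Tendsto u atTop (𝓝 0) →
        Tendsto (fun n => u n ^ (2 : ℝ)) atTop (𝓝 0) := by
      intro u hu
      have h3 := ((ENNReal.continuous_rpow_const (y := 2)).tendsto 0).comp hu
      rwa [ENNReal.zero_rpow_of_pos (by norm_num)] at h3
    have h3 := ENNReal.Tendsto.const_mul (a := C) ((hpow c1).add (hpow c2)) (Or.inr hC)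
    rw [add_zero, mul_zero] at h3
    refine tendsto_of_tendsto_of_tendsto_of_le_of_le tendsto_const_nhds h3 (fun _ => zero_le)
      fun n => ?_
    have h4 := hbound (fun a => ψ n.1 a - ψ n.2 a) ((hψ _).sub (hψ _))
    have h5 : gradient (fun a => ψ n.1 a - ψ n.2 a)
        = fun a => gradient (ψ n.1) a - gradient (ψ n.2) a := by
      ext1 a
      have := (((hψ n.1).differentiable (by simp)) a).hasFDerivAt.sub
        (((hψ n.2).differentiable (by simp)) a).hasFDerivAt
      have h6 : fderiv ℝ (fun a => ψ n.1 a - ψ n.2 a) a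
        = fderiv ℝ (ψ n.1) a - fderiv ℝ (ψ n.2) a := this.fderiv
      simp only [gradient, h6, map_sub]
    rw [h5] at h4
    exact h4
  have c4 : Tendsto (fun n : ℕ × ℕ => eLpNorm (fun a => ψ n.1 a - ψ n.2 a) 2 (boundaryMeasure Ω))
      atTop (𝓝 0) := by
    have h3 := ((ENNReal.continuous_rpow_const (y := 2⁻¹)).tendsto 0).comp c3
    rw [ENNReal.zero_rpow_of_pos (by norm_num)] at h3
    refine h3.congr fun n => ?_
    rw [Function.comp_apply, ← ENNReal.rpow_mul, mul_inv_cancel₀ (by norm_num), ENNReal.rpow_one]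
  have hcs : CauchySeq fun k => (hmem k).toLp (ψ k) := by
    rw [Lp.cauchySeq_Lp_iff_cauchySeq_eLpNorm]
    refine c4.congr fun n => eLpNorm_congr_ae ?_
    filter_upwards [(hmem n.1).coeFn_toLp, (hmem n.2).coeFn_toLp] with z hz hz'
    rw [Pi.sub_apply, hz, hz']
  obtain ⟨g, hg⟩ := cauchySeq_tendsto_of_complete hcs
  refine ⟨g, Lp.memLp g, G, ψ, hxG, hψ, h1, h2, ?_⟩
  rw [tendsto_iff_edist_tendsto_0] at hg
  refine hg.congr fun k => ?_
  rw [Lp.edist_def]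
  refine eLpNorm_congr_ae ?_
  filter_upwards [(hmem k).coeFn_toLp] with z hz
  rw [Pi.sub_apply, hz]

/-! ### Integration by parts for H¹ functions. -/

/-- Continuity of the `L²` pairing. -/
lemma tendsto_integral_inner {α E : Type*} [MeasurableSpace α] [NormedAddCommGroup E]
    [InnerProductSpace ℝ E] {μ : Measure α} {f g : ℕ → α → E} {f' g' : α → E}
    (hf : ∀ k, MemLp (f k) 2 μ) (hf' : MemLp f' 2 μ) (hg : ∀ k, MemLp (g k) 2 μ)
    (hg' : MemLp g' 2 μ)
    (hff : Tendsto (fun k => eLpNorm (fun a => f k a - f' a) 2 μ) atTop (𝓝 0))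
    (hgg : Tendsto (fun k => eLpNorm (fun a => g k a - g' a) 2 μ) atTop (𝓝 0)) :
    Tendsto (fun k => ∫ a, inner ℝ (f k a) (g k a) ∂μ) atTop
      (𝓝 (∫ a, inner ℝ (f' a) (g' a) ∂μ)) := by
  have key : ∀ {u v : α → E} (hu : MemLp u 2 μ) (hv : MemLp v 2 μ),
      ∫ a, inner ℝ (u a) (v a) ∂μ = inner ℝ (hu.toLp u) (hv.toLp v) := by
    intro u v hu hv
    rw [L2.inner_def]
    refine integral_congr_ae ?_
    filter_upwards [hu.coeFn_toLp, hv.coeFn_toLp] with a h1 h2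
    rw [h1, h2]
  have lim : ∀ {u : ℕ → α → E} {v : α → E} (hu : ∀ k, MemLp (u k) 2 μ) (hv : MemLp v 2 μ),
      Tendsto (fun k => eLpNorm (fun a => u k a - v a) 2 μ) atTop (𝓝 0) →
      Tendsto (fun k => (hu k).toLp (u k)) atTop (𝓝 (hv.toLp v)) := by
    intro u v hu hv h
    rw [tendsto_iff_edist_tendsto_0]
    simp only [Lp.edist_toLp_toLp]
    exact h
  simp only [key (hf _) (hg _), key hf' hg']
  exact (lim hf hf' hff).inner (lim hg hg' hgg)

lemma tendsto_integral_mul {α : Type*} [MeasurableSpace α] {μ : Measure α} {f g : ℕ → α → ℝ}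
    {f' g' : α → ℝ} (hf : ∀ k, MemLp (f k) 2 μ) (hf' : MemLp f' 2 μ) (hg : ∀ k, MemLp (g k) 2 μ)
    (hg' : MemLp g' 2 μ)
    (hff : Tendsto (fun k => eLpNorm (fun a => f k a - f' a) 2 μ) atTop (𝓝 0))
    (hgg : Tendsto (fun k => eLpNorm (fun a => g k a - g' a) 2 μ) atTop (𝓝 0)) :
    Tendsto (fun k => ∫ a, f k a * g k a ∂μ) atTop (𝓝 (∫ a, f' a * g' a ∂μ)) := by
  simpa [mul_comm] using tendsto_integral_inner hf hf' hg hg' hff hgg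

section Bounded

variable {α : Type*} [MeasurableSpace α] {μ : Measure α} {E : Type*} [NormedAddCommGroup E]

lemma tendsto_eLpNorm_of_le_mul {f : ℕ → α → E} {u : ℕ → α → ℝ} {C : ℝ}
    (h : Tendsto (fun k => eLpNorm (f k) 2 μ) atTop (𝓝 0))
    (hle : ∀ k, ∀ᵐ a ∂μ, ‖u k a‖ ≤ C * ‖f k a‖) :
    Tendsto (fun k => eLpNorm (u k) 2 μ) atTop (𝓝 0) := by
  have h1 := ENNReal.Tendsto.const_mul (a := ENNReal.ofReal C) h (Or.inr ENNReal.ofReal_ne_top)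
  rw [mul_zero] at h1
  exact tendsto_of_tendsto_of_tendsto_of_le_of_le tendsto_const_nhds h1 (fun _ => zero_le)
    fun k => eLpNorm_le_mul_eLpNorm_of_ae_le_mul (hle k) 2

/-- The definition of a trace supplies a weak gradient that is only locally integrable; its L²
integrability is recovered here from the convergence of smooth gradients. -/
lemma memLp_of_tendsto_eLpNorm {f : ℕ → α → E} {g : α → E} (hf : ∀ k, MemLp (f k) 2 μ)
    (hg : AEStronglyMeasurable g μ)
    (h : Tendsto (fun k => eLpNorm (fun a => f k a - g a) 2 μ) atTop (𝓝 0)) : MemLp g 2 μ := by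
  obtain ⟨k, hk⟩ := (h.eventually (gt_mem_nhds ENNReal.zero_lt_top)).exists
  have h1 : MemLp (fun a => f k a - g a) 2 μ := ⟨(hf k).1.sub hg, hk⟩
  have h2 := (hf k).sub h1
  convert h2 using 1
  ext a; simp

end Bounded

/-- The sequence `ψ` of smooth functions approximates the function `x` with weak gradient `G`
in `H¹(Ω)`. -/
structure ApproximatesH1 (Ω : Set Plane) (ψ : ℕ → Plane → ℝ) (x : Plane → ℝ) (G : Plane → Plane) :
    Prop where
  memLp : MemLp x 2 (volume.restrict Ω)
  memLp_grad : MemLp G 2 (volume.restrict Ω)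
  contDiff : ∀ k, ContDiff ℝ ∞ (ψ k)
  tendsto : Tendsto (fun k => eLpNorm (fun z => ψ k z - x z) 2 (volume.restrict Ω)) atTop (𝓝 0)
  tendsto_grad : Tendsto (fun k => eLpNorm (fun z => gradient (ψ k) z - G z) 2
    (volume.restrict Ω)) atTop (𝓝 0)

namespace ApproximatesH1

variable {ψ : ℕ → Plane → ℝ} {x : Plane → ℝ} {G : Plane → Plane} {b : Plane → ℝ} {M : ℝ}

/-- `∫ ψ ∂_v ψ b → ∫ x ∂_v x b`, more generally against a bounded function and a second sequence. -/
lemma tendsto_integral_mul_grad (hΩ : IsBoundedLipschitz Ω) (h : ApproximatesH1 Ω ψ x G)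
    {φ : ℕ → Plane → ℝ} {φ' : Plane → ℝ} (hφ : ∀ k, MemLp (φ k) 2 (volume.restrict Ω))
    (hφ' : MemLp φ' 2 (volume.restrict Ω))
    (hφφ : Tendsto (fun k => eLpNorm (fun z => φ k z - φ' z) 2 (volume.restrict Ω)) atTop (𝓝 0))
    (hb : AEStronglyMeasurable b (volume.restrict Ω)) (hM : ∀ z, ‖b z‖ ≤ M) (v : Plane) :
    Tendsto (fun k => ∫ z in Ω, φ k z * (inner ℝ (gradient (ψ k) z) v * b z)) atTop
      (𝓝 (∫ z in Ω, φ' z * (inner ℝ (G z) v * b z))) := by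
  have hbtop : MemLp b ⊤ (volume.restrict Ω) := memLp_top_of_bound hb M (Eventually.of_forall hM)
  refine tendsto_integral_mul hφ hφ' (fun k => ?_) ?_ hφφ ?_
  · exact hbtop.mul ((memLp_restrict_of_continuous hΩ (continuous_gradient (h.contDiff k))
      2).inner_const v)
  · exact hbtop.mul (h.memLp_grad.inner_const v)
  · refine tendsto_eLpNorm_of_le_mul (C := ‖v‖ * M) h.tendsto_grad fun k =>
      Eventually.of_forall fun z => ?_
    rw [← sub_mul, ← inner_sub_left, norm_mul]
    have h1 := norm_inner_le_norm (𝕜 := ℝ) (gradient (ψ k) z - G z) v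
    calc _ ≤ (‖gradient (ψ k) z - G z‖ * ‖v‖) * M :=
          mul_le_mul h1 (hM z) (norm_nonneg _) (by positivity)
      _ = ‖v‖ * M * ‖gradient (ψ k) z - G z‖ := by ring

lemma tendsto_integral_mul_bounded (hΩ : IsBoundedLipschitz Ω) (h : ApproximatesH1 Ω ψ x G)
    {φ : ℕ → Plane → ℝ} {φ' : Plane → ℝ} (hφ : ∀ k, MemLp (φ k) 2 (volume.restrict Ω))
    (hφ' : MemLp φ' 2 (volume.restrict Ω))
    (hφφ : Tendsto (fun k => eLpNorm (fun z => φ k z - φ' z) 2 (volume.restrict Ω)) atTop (𝓝 0))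
    (hb : AEStronglyMeasurable b (volume.restrict Ω)) (hM : ∀ z, ‖b z‖ ≤ M) :
    Tendsto (fun k => ∫ z in Ω, φ k z * (ψ k z * b z)) atTop
      (𝓝 (∫ z in Ω, φ' z * (x z * b z))) := by
  have hbtop : MemLp b ⊤ (volume.restrict Ω) := memLp_top_of_bound hb M (Eventually.of_forall hM)
  refine tendsto_integral_mul hφ hφ' (fun k => ?_) ?_ hφφ ?_
  · exact hbtop.mul (memLp_restrict_of_continuous hΩ (h.contDiff k).continuous 2)
  · exact hbtop.mul h.memLp
  · refine tendsto_eLpNorm_of_le_mul (C := M) h.tendsto fun k => Eventually.of_forall fun z => ?_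
    rw [← sub_mul, norm_mul, mul_comm]
    exact mul_le_mul_of_nonneg_right (hM z) (norm_nonneg _)

lemma integrable_mul_grad_mul {f : Plane → ℝ} {g : Plane → Plane}
    (hf : MemLp f 2 (volume.restrict Ω)) (hg : MemLp g 2 (volume.restrict Ω))
    (hb : AEStronglyMeasurable b (volume.restrict Ω)) (hM : ∀ z, ‖b z‖ ≤ M) (v : Plane) :
    IntegrableOn (fun z => f z * (inner ℝ (g z) v * b z)) Ω := by
  have hbtop : MemLp b ⊤ (volume.restrict Ω) := memLp_top_of_bound hb M (Eventually.of_forall hM)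
  have h : MemLp (fun z => inner ℝ (g z) v * b z) 2 (volume.restrict Ω) :=
    hbtop.mul (hg.inner_const v)
  exact hf.integrable_mul h

lemma integrable_mul_mul {f g : Plane → ℝ}
    (hf : MemLp f 2 (volume.restrict Ω)) (hg : MemLp g 2 (volume.restrict Ω))
    (hb : AEStronglyMeasurable b (volume.restrict Ω)) (hM : ∀ z, ‖b z‖ ≤ M) :
    IntegrableOn (fun z => f z * (g z * b z)) Ω := by
  have hbtop : MemLp b ⊤ (volume.restrict Ω) := memLp_top_of_bound hb M (Eventually.of_forall hM)
  have h : MemLp (fun z => g z * b z) 2 (volume.restrict Ω) := hbtop.mul hg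
  exact hf.integrable_mul h

/-- Integration by parts for the square of an `H¹` function. -/
theorem integral_sq_mul_boundary (hΩ : IsBoundedLipschitz Ω) (h : ApproximatesH1 Ω ψ x G)
    {g : Plane → ℝ} (hg : MemLp g 2 (boundaryMeasure Ω))
    (hψg : Tendsto (fun k => eLpNorm (fun z => ψ k z - g z) 2 (boundaryMeasure Ω)) atTop (𝓝 0))
    {B : ℝ≥0} (hb : LipschitzWith B b) (hM : ∀ z, ‖b z‖ ≤ M) (v : Plane) :
    2 * (∫ z in Ω, x z * (inner ℝ (G z) v * b z)) + ∫ z in Ω, x z * (x z * lineDeriv ℝ b z v) =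
      ∫ z, g z * (g z * (b z * inner ℝ v (outerNormal Ω z))) ∂(boundaryMeasure Ω) := by
  have hbm : AEStronglyMeasurable b (volume.restrict Ω) := hb.continuous.aestronglyMeasurable
  have hdm : AEStronglyMeasurable (fun z => lineDeriv ℝ b z v) (volume.restrict Ω) :=
    aestronglyMeasurable_lineDeriv hb.continuous _
  have hdM : ∀ z, ‖lineDeriv ℝ b z v‖ ≤ B * ‖v‖ := fun z => norm_lineDeriv_le_of_lipschitz ℝ hb
  have hψ2 : ∀ k, MemLp (ψ k) 2 (volume.restrict Ω) := fun k =>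
    memLp_restrict_of_continuous hΩ (h.contDiff k).continuous 2
  have h1 := h.tendsto_integral_mul_grad hΩ hψ2 h.memLp h.tendsto hbm hM v
  have h2 := h.tendsto_integral_mul_bounded hΩ hψ2 h.memLp h.tendsto hdm hdM
  have h12 := (h1.const_mul 2).add h2
  have hβ : MemLp (fun z => b z * inner ℝ v (outerNormal Ω z)) ⊤ (boundaryMeasure Ω) :=
    (memLp_top_inner_outerNormal hΩ (c := fun _ => v) continuousOn_const).mul
      (memLp_boundary_of_continuousOn hΩ hb.continuous.continuousOn ⊤)
  have hψΓ : ∀ k, MemLp (ψ k) 2 (boundaryMeasure Ω) := fun k =>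
    memLp_boundary_of_continuousOn hΩ (h.contDiff k).continuous.continuousOn 2
  have h3 : Tendsto (fun k => ∫ z, ψ k z * (ψ k z * (b z * inner ℝ v (outerNormal Ω z)))
      ∂(boundaryMeasure Ω)) atTop
      (𝓝 (∫ z, g z * (g z * (b z * inner ℝ v (outerNormal Ω z))) ∂(boundaryMeasure Ω))) := by
    refine tendsto_integral_mul hψΓ hg (fun k => hβ.mul (hψΓ k)) (hβ.mul hg) hψg ?_
    refine tendsto_eLpNorm_of_le_mul (C := M * ‖v‖) hψg fun k => Eventually.of_forall fun z => ?_
    rw [← sub_mul, norm_mul, norm_mul, mul_comm]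
    refine mul_le_mul_of_nonneg_right ?_ (norm_nonneg _)
    refine mul_le_mul (hM z) ?_ (norm_nonneg _) ((norm_nonneg _).trans (hM z))
    exact (norm_inner_le_norm _ _).trans
      (mul_le_of_le_one_right (norm_nonneg _) (norm_outerNormal_le Ω z))
  -- The identity holds for each smooth approximant, and both sides converge.
  refine tendsto_nhds_unique h12 (h3.congr fun k => ?_)
  have h4 := Transport2D.integral_sq_mul_boundary hΩ (h.contDiff k) hb hM v
  have e1 : ∫ z, ψ k z * (ψ k z * (b z * inner ℝ v (outerNormal Ω z))) ∂(boundaryMeasure Ω)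
      = ∫ z, ψ k z ^ 2 * b z * inner ℝ v (outerNormal Ω z) ∂(boundaryMeasure Ω) := by
    congr 1 with z; ring
  rw [e1, ← h4, ← integral_const_mul, ← integral_add]
  · congr 1 with z; ring
  · exact (integrable_mul_grad_mul (hψ2 k) (memLp_restrict_of_continuous hΩ
      (continuous_gradient (h.contDiff k)) 2) hbm hM v).const_mul 2
  · exact integrable_mul_mul (hψ2 k) (hψ2 k) hdm hdM

/-- The product rule for an `H¹` function and a Lipschitz function, in the weak form. -/
theorem integral_mul_test (hΩ : IsBoundedLipschitz Ω) (h : ApproximatesH1 Ω ψ x G)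
    {B : ℝ≥0} (hb : LipschitzWith B b) (hM : ∀ z, ‖b z‖ ≤ M) (v : Plane)
    {θ : Plane → ℝ} (hθ : IsTest Ω θ) :
    (∫ z in Ω, θ z * (inner ℝ (G z) v * b z)) + (∫ z in Ω, θ z * (x z * lineDeriv ℝ b z v))
      + ∫ z in Ω, fderiv ℝ θ z v * (x z * b z) = 0 := by
  have hbm : AEStronglyMeasurable b (volume.restrict Ω) := hb.continuous.aestronglyMeasurable
  have hdm : AEStronglyMeasurable (fun z => lineDeriv ℝ b z v) (volume.restrict Ω) :=
    aestronglyMeasurable_lineDeriv hb.continuous _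
  have hdM : ∀ z, ‖lineDeriv ℝ b z v‖ ≤ B * ‖v‖ := fun z => norm_lineDeriv_le_of_lipschitz ℝ hb
  have hψ2 : ∀ k, MemLp (ψ k) 2 (volume.restrict Ω) := fun k =>
    memLp_restrict_of_continuous hΩ (h.contDiff k).continuous 2
  have hg2 : ∀ k, MemLp (gradient (ψ k)) 2 (volume.restrict Ω) := fun k =>
    memLp_restrict_of_continuous hΩ (continuous_gradient (h.contDiff k)) 2
  have hθ2 : MemLp θ 2 (volume.restrict Ω) :=
    memLp_restrict_of_continuous hΩ hθ.1.continuous 2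
  have hdθ : Continuous fun z => fderiv ℝ θ z v :=
    (hθ.1.continuous_fderiv (by simp)).clm_apply continuous_const
  have hdθ2 : MemLp (fun z => fderiv ℝ θ z v) 2 (volume.restrict Ω) :=
    memLp_restrict_of_continuous hΩ hdθ 2
  have hconst : ∀ φ : Plane → ℝ, Tendsto (fun _ : ℕ => eLpNorm (fun z => φ z - φ z) 2
      (volume.restrict Ω)) atTop (𝓝 0) := fun φ => by simp
  have h1 := h.tendsto_integral_mul_grad hΩ (fun _ => hθ2) hθ2 (hconst θ) hbm hM v
  have h2 := h.tendsto_integral_mul_bounded hΩ (fun _ => hθ2) hθ2 (hconst θ) hdm hdM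
  have h3 := h.tendsto_integral_mul_bounded hΩ (fun _ => hdθ2) hdθ2 (hconst _) hbm hM
  refine tendsto_nhds_unique ((h1.add h2).add h3) (tendsto_const_nhds.congr fun k => ?_)
  -- Green's formula for the approximant times θ; its boundary term vanishes because θ is supported
  -- inside Ω.
  have h4 := integral_mul_boundary hΩ ((h.contDiff k).mul hθ.1) hb hM v
  have h5 : ∫ z, ψ k z * θ z * b z * inner ℝ v (outerNormal Ω z) ∂(boundaryMeasure Ω) = 0 := by
    rw [boundaryMeasure, setIntegral_eq_zero_of_forall_eq_zero]
    intro z hz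
    rw [hΩ.isOpen.frontier_eq] at hz
    have h0 : θ z = 0 := image_eq_zero_of_notMem_tsupport fun hz' => hz.2 (hθ.2.2 hz')
    rw [h0]; ring
  rw [h5] at h4
  rw [← h4, ← integral_add, ← integral_add]
  · congr 1 with z
    have h6 : fderiv ℝ (fun z => ψ k z * θ z) z
        = ψ k z • fderiv ℝ θ z + θ z • fderiv ℝ (ψ k) z :=
      ((((h.contDiff k).differentiable (by simp)) z).hasFDerivAt.mul
        ((hθ.1.differentiable (by simp)) z).hasFDerivAt).fderiv
    rw [h6, ← fderiv_apply_eq_inner_gradient]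
    simp only [add_apply, smul_apply, smul_eq_mul]
    ring
  · exact (integrable_mul_grad_mul hθ2 (hg2 k) hbm hM v).add
      (integrable_mul_mul hθ2 (hψ2 k) hdm hdM)
  · exact integrable_mul_mul hdθ2 (hψ2 k) hbm hM
  · exact integrable_mul_grad_mul hθ2 (hg2 k) hbm hM v
  · exact integrable_mul_mul hθ2 (hψ2 k) hdm hdM

end ApproximatesH1

/-! ### Divergence of Lipschitz fields. -/

/-- The almost everywhere defined divergence of a Lipschitz field. -/
def fieldDiv (c : Plane → Plane) (z : Plane) : ℝ :=
  ∑ i, lineDeriv ℝ (fun p => c p i) z (EuclideanSpace.single i 1)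

/-- A vector field with bounded Lipschitz components. -/
def IsBoundedLipschitzField (c : Plane → Plane) : Prop :=
  ∃ (K : ℝ≥0) (M : ℝ), ∀ i, LipschitzWith K (fun p => c p i) ∧ ∀ z, ‖c z i‖ ≤ M

lemma inner_eq_sum_mul_inner_single (a b : Plane) :
    inner ℝ a b = ∑ i, inner ℝ a (EuclideanSpace.single i (1 : ℝ)) * b i := by
  simp [PiLp.inner_apply, Fin.sum_univ_two]
  ring

namespace IsBoundedLipschitzField

variable {c : Plane → Plane}

lemma continuous (hc : IsBoundedLipschitzField c) : Continuous c := by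
  obtain ⟨K, M, h⟩ := hc
  have h1 : Continuous fun z => (WithLp.ofLp (c z)) := continuous_pi fun i => (h i).1.continuous
  exact (PiLp.continuous_toLp 2 _).comp h1

lemma memLp_top_fieldDiv (hc : IsBoundedLipschitzField c) (μ : Measure Plane) :
    MemLp (fieldDiv c) ⊤ μ := by
  obtain ⟨K, M, h⟩ := hc
  exact memLp_finsetSum _ fun i _ => (h i).1.memLp_lineDeriv _

lemma memLp_top (hΩ : IsBoundedLipschitz Ω) (hc : IsBoundedLipschitzField c) :
    MemLp c ⊤ (volume.restrict Ω) :=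
  memLp_restrict_of_continuous hΩ hc.continuous ⊤

lemma memLp_inner (hΩ : IsBoundedLipschitz Ω) (hc : IsBoundedLipschitzField c)
    {G : Plane → Plane} (hG : MemLp G 2 (volume.restrict Ω)) :
    MemLp (fun z => inner ℝ (G z) (c z)) 2 (volume.restrict Ω) := by
  obtain ⟨C, hC⟩ := hΩ.isBounded.isCompact_closure.exists_bound_of_continuousOn
    hc.continuous.continuousOn
  refine MemLp.of_le_mul (c := C) hG (hG.1.inner hc.continuous.aestronglyMeasurable) ?_
  filter_upwards [ae_restrict_mem hΩ.isOpen.measurableSet] with z hz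
  rw [mul_comm]
  exact (norm_inner_le_norm _ _).trans
    (mul_le_mul_of_nonneg_left (hC z (subset_closure hz)) (norm_nonneg _))

lemma memLp_div (hΩ : IsBoundedLipschitz Ω) (hc : IsBoundedLipschitzField c)
    {x : Plane → ℝ} {G : Plane → Plane} (hx : MemLp x 2 (volume.restrict Ω))
    (hG : MemLp G 2 (volume.restrict Ω)) :
    MemLp (fun z => inner ℝ (G z) (c z) + x z * fieldDiv c z) 2 (volume.restrict Ω) :=
  (hc.memLp_inner hΩ hG).add ((hc.memLp_top_fieldDiv _).mul hx)

lemma integrableOn_smul (hΩ : IsBoundedLipschitz Ω) (hc : IsBoundedLipschitzField c)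
    {x : Plane → ℝ} (hx : MemLp x 2 (volume.restrict Ω)) : IntegrableOn (fun z => x z • c z) Ω := by
  have hfin := isFiniteMeasure_restrict hΩ
  exact ((hc.memLp_top hΩ).smul hx).integrable (by norm_num : (1 : ℝ≥0∞) ≤ 2)

/-- The divergence of the product of an `H¹` function and a Lipschitz field. -/
theorem isWeakDiv_smul (hΩ : IsBoundedLipschitz Ω) (hc : IsBoundedLipschitzField c)
    {ψ : ℕ → Plane → ℝ} {x : Plane → ℝ} {G : Plane → Plane} (h : ApproximatesH1 Ω ψ x G) :
    IsWeakDiv Ω (fun z => x z • c z) fun z => inner ℝ (G z) (c z) + x z * fieldDiv c z := by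
  have hfin := isFiniteMeasure_restrict hΩ
  have h1 := hc.integrableOn_smul hΩ h.memLp
  have h2 : IntegrableOn (fun z => inner ℝ (G z) (c z) + x z * fieldDiv c z) Ω :=
    (hc.memLp_div hΩ h.memLp h.memLp_grad).integrable (by norm_num)
  refine ⟨h1.locallyIntegrableOn, h2.locallyIntegrableOn, fun θ hθ => ?_⟩
  obtain ⟨K, M, hK⟩ := hc
  -- The scalar identity for b = c_i in the direction of the i-th basis vector; the sum over i
  -- produces the divergence.
  have hsum := Finset.sum_congr rfl fun (i : Fin 2) (_ : i ∈ Finset.univ) =>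
    h.integral_mul_test hΩ (hK i).1 (hK i).2 (EuclideanSpace.single i 1) hθ
  have hθ2 : MemLp θ 2 (volume.restrict Ω) :=
    memLp_restrict_of_continuous hΩ hθ.1.continuous 2
  have hdθ2 : ∀ v, MemLp (fun z => fderiv ℝ θ z v) 2 (volume.restrict Ω) := fun v =>
    memLp_restrict_of_continuous hΩ
      ((hθ.1.continuous_fderiv (by simp)).clm_apply continuous_const) 2
  have i1 : ∀ i, IntegrableOn (fun z => θ z * (inner ℝ (G z) (EuclideanSpace.single i 1) * c z i)) Ω :=
    fun i => ApproximatesH1.integrable_mul_grad_mul hθ2 h.memLp_grad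
      (hK i).1.continuous.aestronglyMeasurable (hK i).2 _
  have i2 : ∀ i, IntegrableOn (fun z => θ z * (x z *
      lineDeriv ℝ (fun p => c p i) z (EuclideanSpace.single i 1))) Ω :=
    fun i => ApproximatesH1.integrable_mul_mul hθ2 h.memLp
      (aestronglyMeasurable_lineDeriv (hK i).1.continuous _)
      (fun z => norm_lineDeriv_le_of_lipschitz ℝ (hK i).1)
  have i3 : ∀ i, IntegrableOn (fun z => fderiv ℝ θ z (EuclideanSpace.single i 1)
      * (x z * c z i)) Ω :=
    fun i => ApproximatesH1.integrable_mul_mul (hdθ2 _) h.memLp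
      (hK i).1.continuous.aestronglyMeasurable (hK i).2
  rw [Finset.sum_const_zero, Finset.sum_add_distrib, Finset.sum_add_distrib,
    ← integral_finsetSum _ (fun i _ => i1 i), ← integral_finsetSum _ (fun i _ => i2 i),
    ← integral_finsetSum _ (fun i _ => i3 i),
    ← integral_add (integrable_finsetSum _ fun i _ => i1 i)
      (integrable_finsetSum _ fun i _ => i2 i)] at hsum
  rw [← sub_eq_zero, sub_neg_eq_add, add_comm, ← hsum]
  congr 1
  · congr 1 with z
    beta_reduce
    rw [inner_eq_sum_mul_inner_single, fieldDiv, Finset.mul_sum, add_mul, mul_comm _ (θ z),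
      mul_comm _ (θ z), Finset.mul_sum, Finset.mul_sum]
  · congr 1 with z
    rw [map_smul, fderiv_apply_eq_inner_gradient, inner_eq_sum_mul_inner_single, smul_eq_mul,
      Finset.mul_sum]
    refine Finset.sum_congr rfl fun i _ => ?_
    rw [fderiv_apply_eq_inner_gradient]; ring

/-- The balance equation for the square of an `H¹` function. -/
theorem integral_sq_trace (hΩ : IsBoundedLipschitz Ω) (hc : IsBoundedLipschitzField c)
    {ψ : ℕ → Plane → ℝ} {x : Plane → ℝ} {G : Plane → Plane} (h : ApproximatesH1 Ω ψ x G)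
    {g : Plane → ℝ} (hg : MemLp g 2 (boundaryMeasure Ω))
    (hψg : Tendsto (fun k => eLpNorm (fun z => ψ k z - g z) 2 (boundaryMeasure Ω)) atTop (𝓝 0)) :
    2 * (∫ z in Ω, x z * inner ℝ (G z) (c z)) + ∫ z in Ω, x z * (x z * fieldDiv c z) =
      ∫ z, g z ^ 2 * inner ℝ (c z) (outerNormal Ω z) ∂(boundaryMeasure Ω) := by
  obtain ⟨K, M, hK⟩ := hc
  have hsum := Finset.sum_congr rfl fun (i : Fin 2) (_ : i ∈ Finset.univ) =>
    h.integral_sq_mul_boundary hΩ hg hψg (hK i).1 (hK i).2 (EuclideanSpace.single i 1)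
  have i1 : ∀ i, IntegrableOn (fun z => x z * (inner ℝ (G z) (EuclideanSpace.single i 1) * c z i)) Ω :=
    fun i => ApproximatesH1.integrable_mul_grad_mul h.memLp h.memLp_grad
      (hK i).1.continuous.aestronglyMeasurable (hK i).2 _
  have i2 : ∀ i, IntegrableOn (fun z => x z * (x z *
      lineDeriv ℝ (fun p => c p i) z (EuclideanSpace.single i 1))) Ω :=
    fun i => ApproximatesH1.integrable_mul_mul h.memLp h.memLp
      (aestronglyMeasurable_lineDeriv (hK i).1.continuous _)
      (fun z => norm_lineDeriv_le_of_lipschitz ℝ (hK i).1)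
  have i3 : ∀ i, Integrable (fun z => g z * (g z * (c z i *
      inner ℝ (EuclideanSpace.single i 1) (outerNormal Ω z)))) (boundaryMeasure Ω) := by
    intro i
    have h1 : MemLp (fun z => c z i * inner ℝ (EuclideanSpace.single i 1) (outerNormal Ω z)) ⊤
        (boundaryMeasure Ω) :=
      (memLp_top_inner_outerNormal hΩ (c := fun _ => EuclideanSpace.single i 1)
        continuousOn_const).mul
      (memLp_boundary_of_continuousOn hΩ (hK i).1.continuous.continuousOn ⊤)
    have h2 : MemLp (fun z => g z * (c z i * inner ℝ (EuclideanSpace.single i 1)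
        (outerNormal Ω z))) 2 (boundaryMeasure Ω) := h1.mul hg
    exact hg.integrable_mul h2
  rw [Finset.sum_add_distrib, ← Finset.mul_sum, ← integral_finsetSum _ (fun i _ => i1 i),
    ← integral_finsetSum _ (fun i _ => i2 i), ← integral_finsetSum _ (fun i _ => i3 i)] at hsum
  convert hsum using 2
  · congr 1
    congr 1 with z
    rw [inner_eq_sum_mul_inner_single, Finset.mul_sum]
  · congr 1 with z
    rw [fieldDiv, Finset.mul_sum, Finset.mul_sum]
  · ext1 z
    rw [real_inner_comm, inner_eq_sum_mul_inner_single, Finset.mul_sum]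
    refine Finset.sum_congr rfl fun i _ => ?_
    rw [real_inner_comm]; ring

end IsBoundedLipschitzField

/-- A Lipschitz field on a bounded set agrees there with a bounded Lipschitz field. -/
lemma exists_isBoundedLipschitzField {S : Set Plane} (hS : IsCompact S) {c : Plane → Plane}
    {K : ℝ≥0} (hc : LipschitzOnWith K c S) :
    ∃ c' : Plane → Plane, IsBoundedLipschitzField c' ∧ EqOn c c' S := by
  have hci : ∀ i : Fin 2, LipschitzOnWith K (fun p => c p i) S := fun i =>
    LipschitzOnWith.of_dist_le_mul fun p hp q hq => by
      refine le_trans ?_ (hc.dist_le_mul p hp q hq)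
      rw [dist_eq_norm, dist_eq_norm]
      exact PiLp.norm_apply_le (c p - c q) i
  -- Each component is extended to the plane with the same Lipschitz constant, then clamped to
  -- [-|M|, |M|]. The clamp keeps the constant and does not change values on S.
  choose f hf hfc using fun i => (hci i).extend_real
  obtain ⟨M, hM⟩ := hS.exists_bound_of_continuousOn hc.continuousOn
  have hcM : ∀ i, ∀ p ∈ S, |c p i| ≤ |M| := fun i p hp =>
    (PiLp.norm_apply_le (c p) i).trans ((hM p hp).trans (le_abs_self M))
  refine ⟨fun p => WithLp.toLp 2 fun i => max (-|M|) (min |M| (f i p)), ⟨K, |M|, fun i => ⟨?_, ?_⟩⟩, ?_⟩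
  · exact ((hf i).const_min |M|).const_max (-|M|)
  · intro z
    rw [Real.norm_eq_abs, abs_le]
    exact ⟨le_max_left _ _, max_le (by linarith [abs_nonneg M]) (min_le_left _ _)⟩
  · intro p hp
    ext i
    have h1 := abs_le.1 (hcM i p hp)
    have h2 : f i p = c p i := (hfc i hp).symm
    simp only [h2]
    rw [min_eq_right h1.2, max_eq_right h1.1]

/-! ### Chosen divergences and traces, and the flux identity. -/

/-- The weak divergence is determined almost everywhere. -/
lemma IsWeakDiv.ae_eq (hΩ : IsOpen Ω) {w : Plane → Plane} {d d' : Plane → ℝ}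
    (h : IsWeakDiv Ω w d) (h' : IsWeakDiv Ω w d') : d =ᵐ[volume.restrict Ω] d' := by
  have key : ∀ᵐ z, z ∈ Ω → (d - d') z = 0 := by
    refine hΩ.ae_eq_zero_of_integral_contDiff_smul_eq_zero (h.2.1.sub h'.2.1) fun θ hθ hθc hθΩ => ?_
    have hi : ∀ {u : Plane → ℝ}, LocallyIntegrableOn u Ω → IntegrableOn (fun z => u z * θ z) Ω := by
      intro u hu
      obtain ⟨C, hC⟩ := hθc.exists_bound_of_continuous hθ.continuous
      have h1 := hu.integrableOn_compact_subset hθΩ hθc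
      have h2 : IntegrableOn (fun z => u z * θ z) (tsupport θ) :=
        h1.mul_bdd (c := C) hθ.continuous.aestronglyMeasurable (Eventually.of_forall hC)
      rw [integrableOn_iff_integrable_of_support_subset] at h2
      · exact h2.integrableOn
      · exact fun z hz => subset_tsupport θ fun h0 => hz (by simp [h0])
    have h1 := h.2.2 θ ⟨hθ, hθc, hθΩ⟩
    have h2 := h'.2.2 θ ⟨hθ, hθc, hθΩ⟩
    have h3 : ∫ z in Ω, (d z * θ z - d' z * θ z) = 0 := by
      rw [integral_sub (hi h.2.1) (hi h'.2.1)]; linarith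
    rw [← setIntegral_eq_integral_of_forall_compl_eq_zero (s := Ω), ← h3]
    · congr 1 with z
      simp only [Pi.sub_apply, smul_eq_mul]; ring
    · intro z hz
      have h0 : θ z = 0 := image_eq_zero_of_notMem_tsupport fun hz' => hz (hθΩ hz')
      rw [h0, zero_smul]
  rw [EventuallyEq, ae_restrict_iff' hΩ.measurableSet]
  filter_upwards [key] with z hz hzΩ
  exact sub_eq_zero.1 (hz hzΩ)

lemma IsWeakDiv.congr_field (hΩ : IsOpen Ω) {w w' : Plane → Plane} {d : Plane → ℝ}
    (h : IsWeakDiv Ω w d) (hi : IntegrableOn w Ω) (hw : EqOn w w' Ω) : IsWeakDiv Ω w' d := by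
  refine ⟨(hi.congr_fun hw hΩ.measurableSet).locallyIntegrableOn, h.2.1, fun θ hθ => ?_⟩
  rw [← h.2.2 θ hθ]
  refine setIntegral_congr_fun hΩ.measurableSet fun z hz => ?_
  simp only [hw hz]

lemma IsWeakDiv.weakDiv {w : Plane → Plane} {d : Plane → ℝ} (h : IsWeakDiv Ω w d) :
    IsWeakDiv Ω w (weakDiv Ω w) := by
  have h' : ∃ d, IsWeakDiv Ω w d := ⟨d, h⟩
  rw [Transport2D.weakDiv, dif_pos h']
  exact h'.choose_spec

lemma isTrace_boundaryTrace (hΩ : IsBoundedLipschitz Ω) {x : Plane → ℝ} (hx : MemH1 Ω x) :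
    IsTrace Ω x (boundaryTrace Ω x) := by
  have h := exists_isTrace hΩ hx
  rw [boundaryTrace, dif_pos h]
  exact h.choose_spec

variable {N : ℕ}

lemma MemH1.approx (hΩ : IsBoundedLipschitz Ω) {Φ : Fin N → Plane → ℝ} (hΦ : ∀ i, MemH1 Ω (Φ i))
    (a : Fin N → ℝ) : MemH1 Ω (approx Φ a) := by
  have hfin := isFiniteMeasure_restrict hΩ
  choose hΦ2 G hG hG2 using hΦ
  have hx : MemLp (Transport2D.approx Φ a) 2 (volume.restrict Ω) :=
    memLp_finsetSum _ fun j _ => (hΦ2 j).mul_const (a j)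
  have hH : MemLp (fun z => ∑ j, a j • G j z) 2 (volume.restrict Ω) :=
    memLp_finsetSum _ fun j _ => (hG2 j).const_smul (a j)
  have hxi : IntegrableOn (Transport2D.approx Φ a) Ω := hx.integrable (by norm_num)
  have hHi : IntegrableOn (fun z => ∑ j, a j • G j z) Ω := hH.integrable (by norm_num)
  refine ⟨hx, _, ⟨hxi.locallyIntegrableOn, hHi.locallyIntegrableOn, fun θ hθ v => ?_⟩, hH⟩
  have hdθ2 : MemLp (fun z => fderiv ℝ θ z v) 2 (volume.restrict Ω) :=
    memLp_restrict_of_continuous hΩ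
      ((hθ.1.continuous_fderiv (by simp)).clm_apply continuous_const) 2
  have hθ2 : MemLp θ 2 (volume.restrict Ω) := memLp_restrict_of_continuous hΩ hθ.1.continuous 2
  have i1 : ∀ j, IntegrableOn (fun z => Φ j z * fderiv ℝ θ z v) Ω := fun j =>
    (hΦ2 j).integrable_mul hdθ2
  have i2 : ∀ j, IntegrableOn (fun z => inner ℝ (G j z) v * θ z) Ω := fun j =>
    ((hG2 j).inner_const v).integrable_mul hθ2
  have e1 : ∫ z in Ω, Transport2D.approx Φ a z * fderiv ℝ θ z v
      = ∑ j, a j * ∫ z in Ω, Φ j z * fderiv ℝ θ z v := by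
    simp only [← integral_const_mul]
    rw [← integral_finsetSum _ fun j _ => (i1 j).const_mul (a j)]
    congr 1 with z
    rw [Transport2D.approx, Finset.sum_mul]
    exact Finset.sum_congr rfl fun j _ => by ring
  have e2 : ∫ z in Ω, inner ℝ (∑ j, a j • G j z) v * θ z
      = ∑ j, a j * ∫ z in Ω, inner ℝ (G j z) v * θ z := by
    simp only [← integral_const_mul]
    rw [← integral_finsetSum _ fun j _ => (i2 j).const_mul (a j)]
    congr 1 with z
    rw [sum_inner, Finset.sum_mul]
    exact Finset.sum_congr rfl fun j _ => by rw [real_inner_smul_left]; ring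
  rw [e1, e2, ← Finset.sum_neg_distrib]
  exact Finset.sum_congr rfl fun j _ => by rw [(hG j).2.2 θ hθ v, mul_neg]

/-- With x = 1 the product rule identifies the weak divergence of the field itself. -/
lemma approximatesH1_one (hΩ : IsBoundedLipschitz Ω) :
    ApproximatesH1 Ω (fun _ _ => 1) (fun _ => 1) fun _ => 0 where
  memLp := memLp_restrict_of_continuous hΩ continuous_const 2
  memLp_grad := memLp_restrict_of_continuous hΩ continuous_const 2
  contDiff _ := contDiff_const
  tendsto := by simp
  tendsto_grad := by simp [gradient]

section Divergence

variable {c c' : Plane → Plane}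

lemma IsBoundedLipschitzField.isWeakDiv (hΩ : IsBoundedLipschitz Ω)
    (hc' : IsBoundedLipschitzField c') (hcc' : EqOn c c' (closure Ω)) :
    IsWeakDiv Ω c (fieldDiv c') := by
  have h1 := hc'.isWeakDiv_smul hΩ (approximatesH1_one hΩ)
  simp only [inner_zero_left, one_mul, zero_add, one_smul] at h1
  exact h1.congr_field hΩ.isOpen (integrableOn_of_continuous hΩ.isBounded hc'.continuous)
    fun z hz => (hcc' (subset_closure hz)).symm

lemma memLp_top_weakDiv (hΩ : IsBoundedLipschitz Ω) (hc' : IsBoundedLipschitzField c')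
    (hcc' : EqOn c c' (closure Ω)) : MemLp (weakDiv Ω c) ⊤ (volume.restrict Ω) := by
  have h := hc'.isWeakDiv hΩ hcc'
  exact (hc'.memLp_top_fieldDiv _).ae_eq (h.ae_eq hΩ.isOpen h.weakDiv)

lemma memLp_top_normalFlux (hΩ : IsBoundedLipschitz Ω) (hc : ContinuousOn c (closure Ω)) :
    MemLp (normalFlux Ω c) ⊤ (boundaryMeasure Ω) :=
  memLp_top_inner_outerNormal hΩ (hc.mono frontier_subset_closure)

lemma integrable_sq_mul_normalFlux (hΩ : IsBoundedLipschitz Ω) (hc : ContinuousOn c (closure Ω))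
    {g : Plane → ℝ} (hg : MemLp g 2 (boundaryMeasure Ω)) :
    Integrable (fun z => g z ^ 2 * normalFlux Ω c z) (boundaryMeasure Ω) := by
  have h : MemLp (fun z => g z * normalFlux Ω c z) 2 (boundaryMeasure Ω) :=
    (memLp_top_normalFlux hΩ hc).mul hg
  refine (hg.integrable_mul h).congr (Eventually.of_forall fun z => ?_)
  simp only [Pi.mul_apply]; ring

/-- An `H¹` function with its trace and the divergence of the flux `x c`. -/
theorem flux_balance (hΩ : IsBoundedLipschitz Ω) (hc' : IsBoundedLipschitzField c')
    (hcc' : EqOn c c' (closure Ω)) {x : Plane → ℝ} (hx : MemH1 Ω x) :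
    IsWeakDiv Ω (fun p => x p • c p) (weakDiv Ω fun p => x p • c p) ∧
      MemLp (weakDiv Ω fun p => x p • c p) 2 (volume.restrict Ω) ∧
      ∫ z in Ω, x z * weakDiv Ω (fun p => x p • c p) z
        = 1 / 2 * (∫ z in Ω, x z * x z * weakDiv Ω c z)
          + 1 / 2 * ∫ z, boundaryTrace Ω x z ^ 2 * normalFlux Ω c z ∂(boundaryMeasure Ω) := by
  -- The sequence attached to the trace is used: it converges to x in H¹ and to the trace in L²(Γ)
  -- simultaneously.
  obtain ⟨hg, G, ψ, hxG, hψ, h1, h2, h3⟩ := isTrace_boundaryTrace hΩ hx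
  have hG : MemLp G 2 (volume.restrict Ω) := memLp_of_tendsto_eLpNorm
    (fun k => memLp_restrict_of_continuous hΩ (continuous_gradient (hψ k)) 2)
    hxG.2.1.aestronglyMeasurable h2
  have h : ApproximatesH1 Ω ψ x G := ⟨hx.1, hG, hψ, h1, h2⟩
  have hdiv : IsWeakDiv Ω (fun p => x p • c p)
      fun z => inner ℝ (G z) (c' z) + x z * fieldDiv c' z :=
    (hc'.isWeakDiv_smul hΩ h).congr_field hΩ.isOpen (hc'.integrableOn_smul hΩ hx.1)
      fun z hz => by simp only [hcc' (subset_closure hz)]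
  have hae := hdiv.ae_eq hΩ.isOpen hdiv.weakDiv
  refine ⟨hdiv.weakDiv, (hc'.memLp_div hΩ hx.1 hG).ae_eq hae, ?_⟩
  have hdc := (hc'.isWeakDiv hΩ hcc')
  have hae' := hdc.ae_eq hΩ.isOpen hdc.weakDiv
  have hgreen := hc'.integral_sq_trace hΩ h hg h3
  have e1 : ∫ z in Ω, x z * weakDiv Ω (fun p => x p • c p) z
      = (∫ z in Ω, x z * inner ℝ (G z) (c' z)) + ∫ z in Ω, x z * (x z * fieldDiv c' z) := by
    rw [← integral_add]
    · refine integral_congr_ae ?_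
      filter_upwards [hae] with z hz
      rw [← hz, mul_add]
    · exact hx.1.integrable_mul (hc'.memLp_inner hΩ hG)
    · have h4 : MemLp (fun z => x z * fieldDiv c' z) 2 (volume.restrict Ω) :=
        (hc'.memLp_top_fieldDiv _).mul hx.1
      exact hx.1.integrable_mul h4
  have e2 : ∫ z in Ω, x z * x z * weakDiv Ω c z = ∫ z in Ω, x z * (x z * fieldDiv c' z) := by
    refine integral_congr_ae ?_
    filter_upwards [hae'] with z hz
    rw [← hz, mul_assoc]
  have e3 : ∫ z, boundaryTrace Ω x z ^ 2 * normalFlux Ω c z ∂(boundaryMeasure Ω)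
      = ∫ z, boundaryTrace Ω x z ^ 2 * inner ℝ (c' z) (outerNormal Ω z) ∂(boundaryMeasure Ω) := by
    refine setIntegral_congr_fun isClosed_frontier.measurableSet fun z hz => ?_
    simp only [normalFlux, hcc' (frontier_subset_closure hz)]
  -- With A = ∫ x ∇x·c and D = ∫ x² div c, the left side is A + D and the boundary integral is 2A +
  -- D.
  rw [e1, e2, e3, ← hgreen]
  ring

end Divergence

/-! ### Inflow and outflow. -/

section Flow

variable {c : Plane → Plane}

/-- The normal is only known to be almost everywhere measurable, hence null measurability here and
the corresponding forms of the indicator lemmas below. -/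
lemma nullMeasurableSet_inflow (hΩ : IsBoundedLipschitz Ω) (hc : ContinuousOn c (closure Ω)) :
    NullMeasurableSet (inflow Ω c) (boundaryMeasure Ω) :=
  isClosed_frontier.measurableSet.nullMeasurableSet.inter
    (nullMeasurableSet_lt (memLp_top_normalFlux hΩ hc).1.aemeasurable aemeasurable_const)

lemma nullMeasurableSet_outflow (hΩ : IsBoundedLipschitz Ω) (hc : ContinuousOn c (closure Ω)) :
    NullMeasurableSet (outflow Ω c) (boundaryMeasure Ω) :=
  isClosed_frontier.measurableSet.nullMeasurableSet.inter
    (nullMeasurableSet_lt aemeasurable_const (memLp_top_normalFlux hΩ hc).1.aemeasurable)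

/-- The boundary power is the difference of the outgoing and the incoming power. -/
lemma integral_boundary_eq_outflow_sub_inflow (hΩ : IsBoundedLipschitz Ω)
    (hc : ContinuousOn c (closure Ω)) {g : Plane → ℝ} (hg : MemLp g 2 (boundaryMeasure Ω)) :
    ∫ z, g z ^ 2 * normalFlux Ω c z ∂(boundaryMeasure Ω)
      = (∫ z in outflow Ω c, g z ^ 2 * normalFlux Ω c z ∂(boundaryMeasure Ω))
        - ∫ z in inflow Ω c, g z ^ 2 * |normalFlux Ω c z| ∂(boundaryMeasure Ω) := by
  have hi := integrable_sq_mul_normalFlux hΩ hc hg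
  have h1 : ∫ z in inflow Ω c, g z ^ 2 * |normalFlux Ω c z| ∂(boundaryMeasure Ω)
      = -∫ z in inflow Ω c, g z ^ 2 * normalFlux Ω c z ∂(boundaryMeasure Ω) := by
    rw [← integral_neg]
    refine integral_congr_ae ?_
    filter_upwards [ae_restrict_mem₀ (nullMeasurableSet_inflow hΩ hc)] with z hz
    rw [abs_of_neg hz.2, mul_neg]
  rw [h1, sub_neg_eq_add, ← integral_indicator₀ (nullMeasurableSet_outflow hΩ hc),
    ← integral_indicator₀ (nullMeasurableSet_inflow hΩ hc),
    ← integral_add (hi.indicator₀ (nullMeasurableSet_outflow hΩ hc))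
      (hi.indicator₀ (nullMeasurableSet_inflow hΩ hc))]
  refine integral_congr_ae ?_
  filter_upwards [ae_mem_frontier Ω] with z hz
  rcases lt_trichotomy (normalFlux Ω c z) 0 with h | h | h
  · rw [indicator_of_notMem (fun h' => lt_asymm h h'.2),
      indicator_of_mem (show z ∈ inflow Ω c from ⟨hz, h⟩), zero_add]
  · rw [indicator_of_notMem (fun h' => h'.2.ne h.symm), indicator_of_notMem (fun h' => h'.2.ne h),
      h]
    simp
  · rw [indicator_of_mem (show z ∈ outflow Ω c from ⟨hz, h⟩),
      indicator_of_notMem (fun h' => lt_asymm h h'.2), add_zero]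

end Flow

/-! ### The Galerkin system as a quadratic form. -/

section Galerkin

variable {Φ : Fin N → Plane → ℝ}

/-- This linearity turns the N Galerkin equations into one equation tested with the approximation
itself. -/
lemma integral_approx_mul (hΦ : ∀ i, MemLp (Φ i) 2 (volume.restrict Ω)) (a : Fin N → ℝ)
    {f : Plane → ℝ} (hf : MemLp f 2 (volume.restrict Ω)) :
    ∫ z in Ω, approx Φ a z * f z = ∑ i, a i * ∫ z in Ω, Φ i z * f z := by
  simp only [← integral_const_mul]
  have hi : ∀ i, IntegrableOn (fun z => Φ i z * f z) Ω := fun i => (hΦ i).integrable_mul hf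
  rw [← integral_finsetSum _ fun i _ => (hi i).const_mul (a i)]
  congr 1 with z
  rw [approx, Finset.sum_mul]
  exact Finset.sum_congr rfl fun i _ => by ring

lemma memLp_approx (hΦ : ∀ i, MemLp (Φ i) 2 (volume.restrict Ω)) (a : Fin N → ℝ) :
    MemLp (approx Φ a) 2 (volume.restrict Ω) :=
  memLp_finsetSum _ fun j _ => (hΦ j).mul_const (a j)

lemma integral_approx_mul_approx (hΦ : ∀ i, MemLp (Φ i) 2 (volume.restrict Ω)) (a b : Fin N → ℝ) :
    ∫ z in Ω, approx Φ a z * approx Φ b z = a ⬝ᵥ (massMatrix Ω Φ).mulVec b := by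
  rw [integral_approx_mul hΦ a (memLp_approx hΦ b), dotProduct]
  refine Finset.sum_congr rfl fun i _ => ?_
  congr 1
  have h : ∀ z, Φ i z * approx Φ b z = approx Φ b z * Φ i z := fun z => mul_comm _ _
  simp only [h]
  rw [integral_approx_mul hΦ b (hΦ i), Matrix.mulVec, dotProduct]
  refine Finset.sum_congr rfl fun j _ => ?_
  rw [massMatrix, Matrix.of_apply, mul_comm]
  congr 1
  congr 1 with z
  ring

lemma integral_approx_sq_mul_weakDiv {c : Plane → Plane}
    (hΦ : ∀ i, MemLp (Φ i) 2 (volume.restrict Ω)) (hd : MemLp (weakDiv Ω c) ⊤ (volume.restrict Ω))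
    (a : Fin N → ℝ) :
    ∫ z in Ω, approx Φ a z * approx Φ a z * weakDiv Ω c z
      = a ⬝ᵥ (divMatrix Ω c Φ).mulVec a := by
  have hΦd : ∀ i, MemLp (fun z => Φ i z * weakDiv Ω c z) 2 (volume.restrict Ω) := fun i =>
    hd.mul (hΦ i)
  have had : MemLp (fun z => approx Φ a z * weakDiv Ω c z) 2 (volume.restrict Ω) :=
    hd.mul (memLp_approx hΦ a)
  simp only [mul_assoc]
  rw [integral_approx_mul hΦ a had, dotProduct]
  refine Finset.sum_congr rfl fun i _ => ?_
  congr 1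
  have h : ∀ z, Φ i z * (approx Φ a z * weakDiv Ω c z)
      = approx Φ a z * (Φ i z * weakDiv Ω c z) := fun z => by ring
  simp only [h]
  rw [integral_approx_mul hΦ a (hΦd i), Matrix.mulVec, dotProduct]
  refine Finset.sum_congr rfl fun j _ => ?_
  rw [divMatrix, Matrix.of_apply, mul_comm]
  congr 1
  congr 1 with z
  ring

lemma discreteHamiltonian_eq (hΦ : ∀ i, MemLp (Φ i) 2 (volume.restrict Ω)) (a : Fin N → ℝ) :
    discreteHamiltonian Ω Φ a = 1 / 2 * (a ⬝ᵥ (massMatrix Ω Φ).mulVec a) := by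
  rw [discreteHamiltonian, integral_approx_mul_approx hΦ]

lemma hasDerivWithinAt_discreteHamiltonian (hΦ : ∀ i, MemLp (Φ i) 2 (volume.restrict Ω))
    {xd : ℝ → Fin N → ℝ} {v : Fin N → ℝ} {S : Set ℝ} {t : ℝ} (hxd : HasDerivWithinAt xd v S t) :
    HasDerivWithinAt (fun s => discreteHamiltonian Ω Φ (xd s))
      (∫ z in Ω, approx Φ (xd t) z * approx Φ v z) S t := by
  have hi : ∀ i, HasDerivWithinAt (fun s => xd s i) (v i) S t := hasDerivWithinAt_pi.1 hxd
  have h1 : HasDerivWithinAt (fun s => xd s ⬝ᵥ (massMatrix Ω Φ).mulVec (xd s))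
      (v ⬝ᵥ (massMatrix Ω Φ).mulVec (xd t) + xd t ⬝ᵥ (massMatrix Ω Φ).mulVec v) S t := by
    simp only [dotProduct, Matrix.mulVec, ← Finset.sum_add_distrib]
    refine HasDerivWithinAt.fun_sum fun i _ => ?_
    exact (hi i).mul (HasDerivWithinAt.fun_sum fun j _ => (hi j).const_mul _)
  have h2 := h1.const_mul (1 / 2)
  simp only [discreteHamiltonian_eq hΦ]
  refine h2.congr_deriv ?_
  rw [← integral_approx_mul_approx hΦ, ← integral_approx_mul_approx hΦ]
  -- Symmetry of the mass form merges the two terms of the product rule and absorbs the factor ½.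
  have h3 : ∫ z in Ω, approx Φ v z * approx Φ (xd t) z
      = ∫ z in Ω, approx Φ (xd t) z * approx Φ v z := by congr 1 with z; ring
  rw [h3]; ring

end Galerkin

end Transport2D

end

/-! ### The energy balance. -/

open Transport2D in
theorem mainTheorem2 (Ω : Set Plane) (hΩ : IsBoundedLipschitz Ω)
    (c : Plane → Plane) (hc : ∃ K : NNReal, LipschitzOnWith K c (closure Ω))
    (N : ℕ) (Φ : Fin N → Plane → ℝ) (hΦ : ∀ i, MemH1 Ω (Φ i))
    (xd : ℝ → Fin N → ℝ) (hxd : IsGalerkinSolution Ω c Φ xd)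
    (u y : ℝ → Plane → ℝ)
    (hu : ∀ t : ℝ, 0 ≤ t → u t =ᵐ[(boundaryMeasure Ω).restrict (inflow Ω c)]
      boundaryTrace Ω (approx Φ (xd t)))
    (hy : ∀ t : ℝ, 0 ≤ t → y t =ᵐ[(boundaryMeasure Ω).restrict (outflow Ω c)]
      boundaryTrace Ω (approx Φ (xd t))) :
    -- the normal, the divergences, the traces and all the integrals are genuine
    ((∀ᵐ z ∂(boundaryMeasure Ω), IsOuterNormal Ω z (outerNormal Ω z)) ∧
      IsWeakDiv Ω c (weakDiv Ω c) ∧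
      (∀ i j, IntegrableOn (fun z => Φ i z * Φ j z) Ω) ∧
      (∀ i j, IntegrableOn (fun z => Φ i z * weakDiv Ω c z * Φ j z) Ω)) ∧
    (∀ t : ℝ, 0 ≤ t →
      IsWeakDiv Ω (fun p => approx Φ (xd t) p • c p)
        (weakDiv Ω (fun p => approx Φ (xd t) p • c p)) ∧
      MemLp (weakDiv Ω (fun p => approx Φ (xd t) p • c p)) 2 (volume.restrict Ω) ∧
      IsTrace Ω (approx Φ (xd t)) (boundaryTrace Ω (approx Φ (xd t))) ∧
      Integrable (fun z => boundaryTrace Ω (approx Φ (xd t)) z ^ 2 * normalFlux Ω c z)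
        (boundaryMeasure Ω) ∧
      IntegrableOn (fun z => u t z ^ 2 * |normalFlux Ω c z|) (inflow Ω c) (boundaryMeasure Ω) ∧
      IntegrableOn (fun z => y t z ^ 2 * normalFlux Ω c z) (outflow Ω c) (boundaryMeasure Ω)) ∧
    -- the discretized Hamiltonian is a quadratic form in the coefficients
    (∀ t : ℝ, 0 ≤ t → discreteHamiltonian Ω Φ (xd t) =
      1 / 2 * (xd t ⬝ᵥ (massMatrix Ω Φ).mulVec (xd t))) ∧
    -- the balance in terms of the approximated state
    (∀ t : ℝ, 0 ≤ t → HasDerivWithinAt (fun s => discreteHamiltonian Ω Φ (xd s))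
      (-(1 / 2) * (∫ z in Ω, approx Φ (xd t) z * approx Φ (xd t) z * weakDiv Ω c z)
        - 1 / 2 * ∫ z, boundaryTrace Ω (approx Φ (xd t)) z ^ 2 * normalFlux Ω c z
            ∂(boundaryMeasure Ω)) (Set.Ici 0) t) ∧
    -- the balance in terms of the coefficients, the input and the output
    (∀ t : ℝ, 0 ≤ t → HasDerivWithinAt (fun s => discreteHamiltonian Ω Φ (xd s))
      (-(1 / 2) * (xd t ⬝ᵥ (divMatrix Ω c Φ).mulVec (xd t))
        + 1 / 2 * (∫ z in inflow Ω c, u t z ^ 2 * |normalFlux Ω c z| ∂(boundaryMeasure Ω))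
        - 1 / 2 * ∫ z in outflow Ω c, y t z ^ 2 * normalFlux Ω c z ∂(boundaryMeasure Ω))
      (Set.Ici 0) t) ∧
    -- the scattering energy preserving balance for divergence-free velocity fields
    (weakDiv Ω c =ᵐ[volume.restrict Ω] 0 →
      ∀ t : ℝ, 0 ≤ t → HasDerivWithinAt (fun s => discreteHamiltonian Ω Φ (xd s))
        (1 / 2 * (∫ z in inflow Ω c, u t z ^ 2 * |normalFlux Ω c z| ∂(boundaryMeasure Ω))
          - 1 / 2 * ∫ z in outflow Ω c, y t z ^ 2 * normalFlux Ω c z ∂(boundaryMeasure Ω))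
        (Set.Ici 0) t) := by
  obtain ⟨K, hK⟩ := hc
  have hcont : ContinuousOn c (closure Ω) := hK.continuousOn
  obtain ⟨c', hc', hcc'⟩ := exists_isBoundedLipschitzField hΩ.isBounded.isCompact_closure hK
  have hΦ2 : ∀ i, MemLp (Φ i) 2 (volume.restrict Ω) := fun i => (hΦ i).1
  have hd := memLp_top_weakDiv hΩ hc' hcc'
  have hx : ∀ t, MemH1 Ω (approx Φ (xd t)) := fun t => MemH1.approx hΩ hΦ (xd t)
  have hflux := fun t => flux_balance hΩ hc' hcc' (hx t)
  have htr := fun t => isTrace_boundaryTrace hΩ (hx t)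
  have hbal : ∀ t : ℝ, 0 ≤ t → HasDerivWithinAt (fun s => discreteHamiltonian Ω Φ (xd s))
      (-(1 / 2) * (∫ z in Ω, approx Φ (xd t) z * approx Φ (xd t) z * weakDiv Ω c z)
        - 1 / 2 * ∫ z, boundaryTrace Ω (approx Φ (xd t)) z ^ 2 * normalFlux Ω c z
            ∂(boundaryMeasure Ω)) (Set.Ici 0) t := by
    intro t ht
    obtain ⟨v, hv, hgal⟩ := hxd t ht
    refine (hasDerivWithinAt_discreteHamiltonian hΦ2 hv).congr_deriv ?_
    obtain ⟨-, hw2, henergy⟩ := hflux t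
    -- The state tests its own equation: the i-th Galerkin equation is multiplied by the i-th
    -- coefficient and the results are summed.
    have h0 : ∫ z in Ω, approx Φ (xd t) z *
        (approx Φ v z + weakDiv Ω (fun p => approx Φ (xd t) p • c p) z) = 0 := by
      refine (integral_approx_mul hΦ2 (xd t) ((memLp_approx hΦ2 v).add hw2)).trans ?_
      exact Finset.sum_eq_zero fun i _ => mul_eq_zero_of_right _ (hgal i)
    have h1 := integral_add ((hx t).1.integrable_mul (memLp_approx hΦ2 v))
      ((hx t).1.integrable_mul hw2)
    simp only [Pi.mul_apply, ← mul_add] at h1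
    rw [h0, henergy] at h1
    -- Now 0 = ∫ x ẋ + ∫ x div(c x), with the second integral replaced by the flux identity.
    linarith
  have hu2 : ∀ t : ℝ, 0 ≤ t → (fun z => u t z ^ 2 * |normalFlux Ω c z|)
      =ᵐ[(boundaryMeasure Ω).restrict (inflow Ω c)]
      fun z => boundaryTrace Ω (approx Φ (xd t)) z ^ 2 * |normalFlux Ω c z| := by
    intro t ht
    filter_upwards [hu t ht] with z hz
    rw [hz]
  have hy2 : ∀ t : ℝ, 0 ≤ t → (fun z => y t z ^ 2 * normalFlux Ω c z)
      =ᵐ[(boundaryMeasure Ω).restrict (outflow Ω c)]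
      fun z => boundaryTrace Ω (approx Φ (xd t)) z ^ 2 * normalFlux Ω c z := by
    intro t ht
    filter_upwards [hy t ht] with z hz
    rw [hz]
  have hinteg := fun t => integrable_sq_mul_normalFlux hΩ hcont (htr t).1
  have hcoef : ∀ t : ℝ, 0 ≤ t → HasDerivWithinAt (fun s => discreteHamiltonian Ω Φ (xd s))
      (-(1 / 2) * (xd t ⬝ᵥ (divMatrix Ω c Φ).mulVec (xd t))
        + 1 / 2 * (∫ z in inflow Ω c, u t z ^ 2 * |normalFlux Ω c z| ∂(boundaryMeasure Ω))
        - 1 / 2 * ∫ z in outflow Ω c, y t z ^ 2 * normalFlux Ω c z ∂(boundaryMeasure Ω))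
      (Set.Ici 0) t := by
    intro t ht
    refine (hbal t ht).congr_deriv ?_
    rw [integral_congr_ae (hu2 t ht), integral_congr_ae (hy2 t ht),
      integral_boundary_eq_outflow_sub_inflow hΩ hcont (htr t).1,
      integral_approx_sq_mul_weakDiv hΦ2 hd]
    ring
  refine ⟨⟨ae_isOuterNormal hΩ, (hc'.isWeakDiv hΩ hcc').weakDiv,
    fun i j => (hΦ2 i).integrable_mul (hΦ2 j), fun i j => ?_⟩,
    fun t ht => ⟨(hflux t).1, (hflux t).2.1, htr t, hinteg t, ?_, ?_⟩,
    fun t _ => discreteHamiltonian_eq hΦ2 (xd t), hbal, hcoef,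
    fun hdiv t ht => ?_⟩
  · have h : MemLp (fun z => Φ i z * weakDiv Ω c z) 2 (volume.restrict Ω) := hd.mul (hΦ2 i)
    exact h.integrable_mul (hΦ2 j)
  · refine Integrable.congr ?_ (hu2 t ht).symm
    refine ((hinteg t).abs.integrableOn (s := inflow Ω c)).congr (Eventually.of_forall fun z => ?_)
    simp [abs_mul]
  · exact (hinteg t).integrableOn.congr (hy2 t ht).symm
  · refine (hcoef t ht).congr_deriv ?_
    rw [← integral_approx_sq_mul_weakDiv hΦ2 hd]
    have h0 : ∫ z in Ω, approx Φ (xd t) z * approx Φ (xd t) z * weakDiv Ω c z = 0 := by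
      refine integral_eq_zero_of_ae ?_
      filter_upwards [hdiv] with z hz
      rw [hz, Pi.zero_apply, mul_zero]
    rw [h0]; ring
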